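/- For integers $a,b\ge 2$ let $\theta_{a,b}$ denote the graph consisting of $a$ internally vertex-disjoint paths of length $b$ with the same two endpoints; it has $ab$ edges. A copy of a graph $H$ in a graph $G$ is a subgraph of $G$ isomorphic to $H$. For a finite set $\mathcal{H}$ of copies of $H$ in $G$ and $\sigma\subseteq E(G)$, write $d_{\mathcal{H}}(\sigma)=|\{H'\in\mathcal{H}:\sigma\subseteq E(H')\}|$, and write $e(G)=|E(G)|$. All graphs are finite and simple. For $\alpha>0$, a graph $H$ is called Erdős–Simonovits $\alpha$-good for a function $m=m(n)$ if there are constants $C,k_0>0$ such that for every real $k\ge k_0$, every $n\ge 1$ and every graph $G$ with $n$ vertices and exactly $k\cdot m(n)$ edges there is a non-empty set $\mathcal{H}$ of copies of $H$ in $G$ with \[ d_{\mathcal{H}}(\sigma)\le\frac{C\,|\mathcal{H}|}{k^{(1+\alpha)(|\sigma|-1)}\,e(G)}\qquad\text{for every }\sigma\subseteq E(G)\text{ with }1\le|\sigma|\le e(H). \] **Theorem.** Let $a,b\ge 2$ be integers and let $\alpha=\frac{1}{ab-1}$. There are positive constants $C$, $\delta$ and $k_0$, depending only on $a$ and $b$,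 such that for every real $k\ge k_0$ and every graph $G$ with $n$ vertices and exactly $k n^{1+1/b}$ edges there is a set $\mathcal{H}$ of copies of $\theta_{a,b}$ in $G$ such that (i) $|\mathcal{H}|\ge\delta k^{ab}n^2$, and (ii) $d_{\mathcal{H}}(\sigma)\le\dfrac{C\,|\mathcal{H}|}{k^{(1+\alpha)(|\sigma|-1)}\,e(G)}$ for every $\sigma\subseteq E(G)$ with $1\le|\sigma|\le ab$. In particular, $\theta_{a,b}$ is Erdős–Simonovits $\alpha$-good for $m(n)=n^{1+1/b}$. -/

import Mathlib

universe u w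

/-- Vertices of the theta graph: the two common end-vertices (`Sum.inl 0` and `Sum.inl 1`), and
for each of the `a` paths its `b - 1` internal vertices. -/
abbrev ThetaVertex (a b : ℕ) : Type := Fin 2 ⊕ (Fin a × Fin (b - 1))

/-- The `j`-th vertex, `0 ≤ j ≤ b`, of the `i`-th path of the theta graph. -/
def thetaPathVertex (a b : ℕ) (i : Fin a) (j : ℕ) : ThetaVertex a b :=
  if h : 0 < j ∧ j < b then Sum.inr (i, ⟨j - 1, by omega⟩)
  else if j = 0 then Sum.inl 0
  else Sum.inl 1

/-- The theta graph `θ_{a,b}`: `a` internally vertex-disjoint paths of length `b` with the same two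
endpoints (meaningful for `b ≥ 2`). -/
def thetaGraph (a b : ℕ) : SimpleGraph (ThetaVertex a b) :=
  SimpleGraph.fromRel fun x y =>
    ∃ i : Fin a, ∃ j : ℕ, j < b ∧ x = thetaPathVertex a b i j ∧ y = thetaPathVertex a b i (j + 1)

/-- A subgraph `G'` of `G` is a copy of `H` if it is isomorphic to `H`. -/
def IsCopyOf {V : Type u} {W : Type w} {G : SimpleGraph V} (H : SimpleGraph W)
    (G' : G.Subgraph) : Prop :=
  Nonempty (H ≃g G'.coe)

open Classical in
/-- The degree `d_ℋ(σ)`: the number of members of `ℋ` that contain all the edges in `σ`. -/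
noncomputable def familyDegree {V : Type u} {G : SimpleGraph V} (ℋ : Finset G.Subgraph)
    (σ : Finset (Sym2 V)) : ℕ :=
  (ℋ.filter fun H' => (σ : Set (Sym2 V)) ⊆ H'.edgeSet).card

/-- The graph `H` is Erdős–Simonovits `α`-good for the function `m`. The quantification is over
graphs `G` with at least one vertex, and `k` is a real number. -/
def ErdosSimonovitsGood {W : Type w} [Finite W] (H : SimpleGraph W) (α : ℝ) (m : ℕ → ℝ) : Prop :=
  0 < α ∧ ∃ C k₀ : ℝ, 0 < C ∧ 0 < k₀ ∧
    ∀ (k : ℝ), k₀ ≤ k → ∀ (V : Type u) [Fintype V] [Nonempty V] (G : SimpleGraph V),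
      (G.edgeSet.ncard : ℝ) = k * m (Fintype.card V) →
      ∃ ℋ : Finset G.Subgraph, ℋ.Nonempty ∧ (∀ H' ∈ ℋ, IsCopyOf H H') ∧
        ∀ σ : Finset (Sym2 V), (σ : Set (Sym2 V)) ⊆ G.edgeSet →
          1 ≤ σ.card → σ.card ≤ H.edgeSet.ncard →
          (familyDegree ℋ σ : ℝ) ≤
            C * (ℋ.card : ℝ) /
              (k ^ ((1 + α) * ((σ.card : ℝ) - 1)) * (G.edgeSet.ncard : ℝ))

/-!
Write `n` for the number of vertices and `e = k n ^ (1 + 1 / b)` for the number of edges of `G`.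
The family of copies is extracted from a weight `w` on the theta graphs of `G`. A greedy choice
(`exists_balanced_subfamily`) turns a weight into a family: take a largest family of theta graphs
obeying the required bounds for the codegrees; every other theta graph contains an edge set `σ`
whose codegree is, up to a factor `2`, as large as allowed. If the total weight `w` of the theta
graphs containing `σ` is at most `ρ` times the allowed codegree, and each single theta graph has
weight at most `ρ`, then summing over all saturated `σ` shows that the total weight is `O(ρ)`
times the size of the family. So it suffices to find a weight of total order `e` for which the
theta graphs containing `σ` have weight `O(k ^ (-(1 + α) (|σ| - 1)))`, while each theta graph has
weight `O(e / (k ^ (a b) n ^ 2))`.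

*Reduction to almost regular graphs.* By regularization (`exists_almost_regular_core`), each
subgraph with at least half of the edges of `G` contains an almost regular induced subgraph, on
`m` vertices with degrees of order `d`, where `d` is at least of order
`k n ^ (1 / b) (m / n) ^ γ`. The exponent `γ = (a - 1) / (a b - 1)` is the largest for which both required bounds pass from
the subgraph to `G`. Removing such subgraphs one by one, and adding up their weights
(`exists_weight_of_pieces`), leaves the bounds intact because the subgraphs are edge-disjoint.
Thus a probability measure on the theta graphs of an almost regular graph is wanted. Put
`lam = (d ^ b / m) ^ (1 / (b - 1))`, so that two vertices are joined on average by about `lam ^ (b - 1)`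
walks of length `b`, and prescribing an inner vertex should cost a factor `lam`.

*A spread family of short paths.* Walks of length `b` cannot be used directly, since their ends
may be joined by many walks that pass through a common vertex. Let `t` be the least length for
which a positive proportion of the walks of length `t` have heavy ends, that is, ends joined by at
least half of `lam ^ (t - 1)` walks of this length; averaging gives `t ≤ b`. Most of these walks
are paths whose proper segments have light ends (`exists_isLightHeavy`). Lightness bounds the
number of such paths through prescribed vertices or edges. After a cleaning step
(`exists_clean_subset`) that makes the number of paths with given ends large whenever it is not
zero, prescribing `s` inner vertices of a path with given ends costs `lam ^ s`
(`exists_isSpreadFamily`).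

*From length `t` to length `b`.* Draw a path of the family, with start `x`, and go on with a
random walk that zigzags between the last two layers of the paths of the family from `x`, choosing
each edge with probability proportional to the number of these paths that end with it. This walk
is reversible and starts from its stationary distribution, so that after every step the last
vertex has an explicit distribution, and each step is spread over at least about `lam` vertices.
Hence the bounds persist (`IsSpreadFamily.exists_isPathMeasure`).

*From walks to theta graphs.* Draw the ends of a random walk of this kind, and then,
independently, `a` walks with these ends (`thetaWeight`). Prescribing `s` edges in a single walk
costs `lam ^ (s - 1)` besides the factor `m d` for the first edge; prescribing `s` edges in a
further walk, whose ends are then given, costs `lam ^ min s (b - 1)`. The worst case is that of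
all `a b` edges, which gives the exponent `1 + α` (`IsPathMeasure.thetaMass_edges`). The weight of
a single theta graph is smaller still, because two walks with the same ends are bounded together
(`IsPathMeasure.thetaWeight_le`). If `lam` is large, at least half of the mass lies on families of
walks that are internally disjoint paths (`IsPathMeasure.half_le_thetaMass`).
-/

namespace ThetaSupersaturation

open Finset
open scoped Classical

/-! ### Extremal choices in finite families -/

/-- From a weight on edge sets whose codegrees are at most `ρ * cap`, and which is at most `ρ` on
single sets, one extracts a family whose codegrees are at most `cap` and whose size is at least a
constant times the total weight over `ρ`. A largest family with codegrees at most `cap` works: each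
set of the support outside of it contains a saturated set `σ`, and the saturated sets are few, as
each of them lies in many members of the family. -/
lemma exists_balanced_subfamily {α : Type*} [Fintype α] (w : Finset α → ℝ)
    (hw : ∀ E, 0 ≤ w E) (N : ℕ) (hN : ∀ E, w E ≠ 0 → E.card ≤ N) (cap : ℕ → ℝ)
    (hcap : ∀ s, 1 ≤ s → s ≤ N → 1 ≤ cap s) (ρ : ℝ) (hρ : 0 ≤ ρ)
    (hdeg : ∀ σ : Finset α, σ.Nonempty → σ.card ≤ N →
      ∑ E with σ ⊆ E, w E ≤ ρ * cap σ.card)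
    (hpt : ∀ E, w E ≤ ρ) :
    ∃ 𝓗 : Finset (Finset α), (∀ E ∈ 𝓗, w E ≠ 0) ∧
      (∀ σ : Finset α, σ.Nonempty → σ.card ≤ N →
        ((𝓗.filter fun E => σ ⊆ E).card : ℝ) ≤ cap σ.card) ∧
      ∑ E, w E ≤ ρ * (2 ^ (N + 1) + 1) * 𝓗.card := by
  set good : Finset (Finset (Finset α)) := univ.filter fun 𝓗 => (∀ E ∈ 𝓗, w E ≠ 0) ∧
      (∀ σ : Finset α, σ.Nonempty → σ.card ≤ N →
        ((𝓗.filter fun E => σ ⊆ E).card : ℝ) ≤ cap σ.card) with hgood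
  have hne : good.Nonempty := by
    refine ⟨∅, ?_⟩
    simp only [hgood, mem_filter, mem_univ, true_and]
    refine ⟨by simp, fun σ h1 h2 => ?_⟩
    have := hcap σ.card h1.card_pos h2
    simp; linarith
  obtain ⟨𝓗, hH, hmax⟩ := exists_max_image good Finset.card hne
  simp only [hgood, mem_filter, mem_univ, true_and] at hH
  obtain ⟨hH1, hH2⟩ := hH
  refine ⟨𝓗, hH1, hH2, ?_⟩
  set deg : Finset α → ℝ := fun σ => ((𝓗.filter fun E => σ ⊆ E).card : ℝ) with hdegdef
  set sat : Finset (Finset α) := univ.filter fun σ => σ.Nonempty ∧ σ.card ≤ N ∧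
    cap σ.card ≤ 2 * deg σ with hsat
  have key : ∀ E, w E ≤ (if E ∈ 𝓗 then w E else 0) + ∑ σ ∈ sat, if σ ⊆ E then w E else 0 := by
    intro E
    have hnn : 0 ≤ ∑ σ ∈ sat, if σ ⊆ E then w E else 0 :=
      sum_nonneg fun σ _ => by split_ifs <;> simp [hw]
    by_cases hE : E ∈ 𝓗
    · simp only [hE, if_true]; linarith
    by_cases hz : w E = 0
    · rw [hz] at hnn ⊢; simp
    have hbad : insert E 𝓗 ∉ good := by
      intro h
      have := hmax _ h
      rw [card_insert_of_notMem hE] at this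
      omega
    simp only [hgood, mem_filter, mem_univ, true_and, not_and, not_forall] at hbad
    obtain ⟨σ, hσ1, hσ2, hσ3⟩ := hbad (by
      intro E' hE'
      rcases mem_insert.1 hE' with rfl | h
      · exact hz
      · exact hH1 _ h)
    have hsub : σ ⊆ E := by
      by_contra hns
      apply hσ3
      rw [filter_insert, if_neg hns]
      exact hH2 σ hσ1 hσ2
    have hσsat : σ ∈ sat := by
      simp only [hsat, mem_filter, mem_univ, true_and]
      refine ⟨hσ1, hσ2, ?_⟩
      rw [filter_insert, if_pos hsub, card_insert_of_notMem (by simp [hE]), not_le] at hσ3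
      push_cast at hσ3
      have h1 := hcap _ hσ1.card_pos hσ2
      simp only [hdegdef]
      -- the codegree is an integer, so that `cap - 1 < deg` yields `cap ≤ 2 * deg`
      rcases Nat.eq_zero_or_pos (𝓗.filter fun E => σ ⊆ E).card with h0 | h0
      · rw [h0] at hσ3; norm_num at hσ3; linarith
      · have : (1 : ℝ) ≤ ((𝓗.filter fun E => σ ⊆ E).card : ℝ) := by exact_mod_cast h0
        linarith
    have := single_le_sum (f := fun σ => if σ ⊆ E then w E else 0)
      (fun σ _ => by split_ifs <;> simp [hw]) hσsat
    simp only [hsub, if_true] at this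
    simp only [hE, if_false]; linarith
  have h1 : ∑ E, (if E ∈ 𝓗 then w E else 0) ≤ ρ * 𝓗.card := by
    rw [← sum_filter]
    calc _ ≤ ∑ E ∈ univ.filter (· ∈ 𝓗), ρ := sum_le_sum fun E _ => hpt E
      _ = ρ * 𝓗.card := by simp [mul_comm]
  have h2 : ∑ E, ∑ σ ∈ sat, (if σ ⊆ E then w E else 0) ≤ ρ * (2 * (2 ^ N * 𝓗.card)) := by
    rw [sum_comm]
    calc ∑ σ ∈ sat, ∑ E, (if σ ⊆ E then w E else 0)
        ≤ ∑ σ ∈ sat, ρ * (2 * deg σ) := by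
          refine sum_le_sum fun σ hσ => ?_
          simp only [hsat, mem_filter, mem_univ, true_and] at hσ
          rw [← sum_filter]
          exact (hdeg σ hσ.1 hσ.2.1).trans (mul_le_mul_of_nonneg_left hσ.2.2 hρ)
      _ = ρ * (2 * ∑ σ ∈ sat, deg σ) := by rw [← mul_sum, ← mul_sum]
      _ ≤ ρ * (2 * (2 ^ N * 𝓗.card)) := by
          gcongr
          calc ∑ σ ∈ sat, deg σ ≤ ∑ σ, deg σ :=
                sum_le_sum_of_subset_of_nonneg (subset_univ _) fun _ _ _ => by positivity
            _ = ∑ E ∈ 𝓗, ((E.powerset.card : ℕ) : ℝ) := by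
                simp only [hdegdef, card_filter]
                push_cast
                rw [sum_comm]
                refine sum_congr rfl fun E _ => ?_
                rw [← sum_filter, sum_const, nsmul_eq_mul, mul_one]
                congr 2
                ext σ; simp
            _ ≤ ∑ E ∈ 𝓗, (2 : ℝ) ^ N := by
                refine sum_le_sum fun E hE => ?_
                rw [card_powerset]
                push_cast
                exact pow_le_pow_right₀ (by norm_num) (hN E (hH1 E hE))
            _ = 2 ^ N * 𝓗.card := by simp [mul_comm]
  calc ∑ E, w E ≤ ∑ E, ((if E ∈ 𝓗 then w E else 0) +
        ∑ σ ∈ sat, if σ ⊆ E then w E else 0) := sum_le_sum fun E _ => key E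
    _ ≤ ρ * 𝓗.card + ρ * (2 * (2 ^ N * 𝓗.card)) := by
        rw [sum_add_distrib]; exact add_le_add h1 h2
    _ = ρ * (2 ^ (N + 1) + 1) * 𝓗.card := by ring

/-- A subset losing at most the total threshold and meeting every class `c` either not at all or in
at least `h c` elements: it maximizes the size minus the thresholds of the classes it meets. -/
lemma exists_clean_subset {τ κ : Type*} [Fintype κ] (T : Finset τ) (R : τ → κ → Prop)
    (h : κ → ℝ) (hh : ∀ c, 0 ≤ h c) :
    ∃ T' ⊆ T, (T.card : ℝ) - ∑ c, h c ≤ T'.card ∧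
      ∀ c, (∃ P ∈ T', R P c) → h c ≤ (T'.filter fun P => R P c).card := by
  set Φ : Finset τ → ℝ := fun S => S.card - ∑ c with (∃ P ∈ S, R P c), h c with hΦ
  obtain ⟨T', hT', hmax⟩ := exists_max_image T.powerset Φ ⟨T, by simp⟩
  rw [mem_powerset] at hT'
  refine ⟨T', hT', ?_, ?_⟩
  · have h1 := hmax T (by simp)
    have h2 : ∑ c with (∃ P ∈ T, R P c), h c ≤ ∑ c, h c :=
      sum_le_sum_of_subset_of_nonneg (subset_univ _) fun _ _ _ => hh _
    have h3 : 0 ≤ ∑ c with (∃ P ∈ T', R P c), h c := sum_nonneg fun _ _ => hh _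
    simp only [hΦ] at h1
    linarith
  · intro c hc
    have h1 := hmax (T'.filter fun P => ¬ R P c) (by
      rw [mem_powerset]; exact (filter_subset _ _).trans hT')
    have h2 := card_filter_add_card_filter_not (s := T') (fun P => R P c)
    have h2' : ((T'.filter fun P => R P c).card : ℝ) + (T'.filter fun P => ¬ R P c).card
        = T'.card := by exact_mod_cast h2
    have h3 : ∑ c' with (∃ P ∈ T'.filter (fun P => ¬ R P c), R P c'), h c' + h c ≤
        ∑ c' with (∃ P ∈ T', R P c'), h c' := by
      have hc' : c ∉ univ.filter fun c' => ∃ P ∈ T'.filter (fun P => ¬ R P c), R P c' := by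
        simp only [mem_filter, mem_univ, true_and, not_exists, not_and]
        rintro P ⟨_, hP⟩
        exact hP
      rw [add_comm, ← sum_insert hc']
      refine sum_le_sum_of_subset_of_nonneg ?_ fun _ _ _ => hh _
      intro c' hc''
      rcases mem_insert.1 hc'' with rfl | h
      · simpa using hc
      · simp only [mem_filter, mem_univ, true_and] at h ⊢
        obtain ⟨P, hP, hR⟩ := h
        exact ⟨P, hP.1, hR⟩
    simp only [hΦ] at h1
    linarith

/-! ### An almost regular subgraph of extremal density -/

/-- The number of neighbours of `u` in `U`. -/
noncomputable def degIn {V : Type*} (G : SimpleGraph V) (U : Finset V) (u : V) : ℝ :=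
  ((U.filter fun v => G.Adj u v).card : ℝ)

/-- Twice the number of edges of `G` inside `U`. -/
noncomputable def degSum {V : Type*} (G : SimpleGraph V) (U : Finset V) : ℝ :=
  ∑ u ∈ U, degIn G U u

section
variable {V : Type*} (G : SimpleGraph V)

lemma degIn_nonneg (U : Finset V) (u : V) : 0 ≤ degIn G U u := Nat.cast_nonneg _

lemma degSum_nonneg (U : Finset V) : 0 ≤ degSum G U := sum_nonneg fun _ _ => degIn_nonneg _ _ _

lemma degIn_mono {U U' : Finset V} (h : U ⊆ U') (u : V) : degIn G U u ≤ degIn G U' u := by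
  unfold degIn
  exact_mod_cast card_le_card (filter_subset_filter _ h)

lemma degIn_eq_sum (U : Finset V) (u : V) :
    degIn G U u = ∑ v ∈ U, if G.Adj u v then (1 : ℝ) else 0 := by
  simp [degIn]

lemma sum_degIn_comm (U W : Finset V) :
    ∑ u ∈ U, degIn G W u = ∑ w ∈ W, degIn G U w := by
  simp only [degIn_eq_sum]
  rw [sum_comm]
  simp only [G.adj_comm]

lemma degIn_union {U W : Finset V} (h : Disjoint U W) (u : V) :
    degIn G (U ∪ W) u = degIn G U u + degIn G W u := by
  simp only [degIn_eq_sum, sum_union h]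

lemma degSum_union {U W : Finset V} (h : Disjoint U W) :
    degSum G (U ∪ W) = degSum G U + degSum G W + 2 * ∑ u ∈ U, degIn G W u := by
  unfold degSum
  rw [sum_union h]
  simp only [degIn_union G h, sum_add_distrib]
  rw [sum_degIn_comm G W U]
  ring

end

/-- If every block of at most `q` elements has sum at most `M`, the whole sum is at most `M` times
the number of blocks. -/
lemma sum_le_of_blocks {V : Type*} (h : V → ℝ) (M : ℝ) (hM : 0 ≤ M) (q : ℕ) (hq : 1 ≤ q) :
    ∀ X : Finset V, (∀ B ⊆ X, B.card ≤ q → ∑ b ∈ B, h b ≤ M) →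
      ∑ x ∈ X, h x ≤ M * (X.card / q + 1) := by
  intro X
  induction X using Finset.strongInduction with
  | H X ih =>
    intro hB
    have hq' : (0 : ℝ) < q := by exact_mod_cast hq
    by_cases hX : X.card ≤ q
    · refine (hB X subset_rfl hX).trans ?_
      have : (0 : ℝ) ≤ X.card / q := by positivity
      nlinarith
    · obtain ⟨B, hBX, hBc⟩ := exists_subset_card_eq (s := X) (n := q) (by omega)
      have hss : X \ B ⊂ X := by
        refine sdiff_ssubset hBX ?_
        rw [← card_pos]; omega
      have h1 := ih (X \ B) hss fun B' hB' => hB B' (hB'.trans sdiff_subset)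
      have h2 := hB B hBX hBc.le
      have h3 : ((X \ B).card : ℝ) = X.card - q := by
        rw [card_sdiff_of_subset hBX, hBc, Nat.cast_sub (by omega)]
      rw [h3] at h1
      rw [← sum_sdiff hBX]
      have : M * ((X.card - q : ℝ) / q + 1) = M * (X.card / q + 1) - M := by
        field_simp; ring
      linarith

/-- Erdős–Simonovits regularization. A vertex set `U` maximizing `degSum G U / |U| ^ (1 + γ)` has few
edges at its vertices of large degree: otherwise these vertices together with a suitable set of the
same size would be denser. Removing them and then all vertices of small degree leaves an almost
regular graph. -/
lemma exists_almost_regular_core (γ : ℝ) (hγ : 0 < γ) :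
    ∃ K : ℝ, 1 ≤ K ∧ ∀ {V : Type*} [Fintype V] (G : SimpleGraph V), 0 < degSum G univ →
      ∃ (U : Finset V) (d : ℝ), U.Nonempty ∧ 0 < d ∧
        (∀ u ∈ U, d ≤ degIn G U u ∧ degIn G U u ≤ K * d) ∧
        degSum G univ / (Fintype.card V : ℝ) ^ (1 + γ) ≤ 4 * d / (U.card : ℝ) ^ γ := by
  set K₁ : ℝ := 2 * 32 ^ (1 / γ) with hK₁
  have h32 : (1 : ℝ) ≤ 32 ^ (1 / γ) := Real.one_le_rpow (by norm_num) (by positivity)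
  have hK₁pos : 0 < K₁ := by positivity
  refine ⟨4 * K₁, by linarith, ?_⟩
  intro V _ G hG
  have hVne : (univ : Finset V).Nonempty := by
    rw [nonempty_iff_ne_empty]; rintro h
    rw [h] at hG; simp [degSum] at hG
  obtain ⟨U₀, hU₀mem, hmax⟩ := exists_max_image
    (univ.filter fun U : Finset V => U.Nonempty) (fun U => degSum G U / (U.card : ℝ) ^ (1 + γ))
    ⟨univ, by simpa using hVne⟩
  have hU₀ : U₀.Nonempty := by simpa using hU₀mem
  have hmpos : (0 : ℝ) < U₀.card := by exact_mod_cast hU₀.card_pos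
  set m : ℝ := ((U₀.card : ℕ) : ℝ) with hm
  set S : ℝ := degSum G U₀ with hS
  have hmaxV : degSum G univ / (Fintype.card V : ℝ) ^ (1 + γ) ≤ S / m ^ (1 + γ) := by
    simpa using hmax univ (by simpa using hVne)
  have hnpos : (0 : ℝ) < Fintype.card V := by
    exact_mod_cast Fintype.card_pos_iff.2 ⟨hVne.choose⟩
  have hSpos : 0 < S := by
    have : 0 < S / m ^ (1 + γ) := lt_of_lt_of_le (by positivity) hmaxV
    by_contra hneg
    exact absurd this (not_lt.2 (div_nonpos_of_nonpos_of_nonneg (not_lt.1 hneg) (by positivity)))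
  set D : ℝ := S / m with hD
  have hDpos : 0 < D := by positivity
  have hDm : D * m = S := by rw [hD]; field_simp
  -- extremality, as a bound on the number of edges inside small sets
  have hext : ∀ U : Finset V, U.Nonempty → degSum G U ≤ S * (U.card / m) ^ (1 + γ) := by
    intro U hU
    have h1 := hmax U (by simpa using hU)
    have hc : (0 : ℝ) < U.card := by exact_mod_cast hU.card_pos
    have h1' : degSum G U / (U.card : ℝ) ^ (1 + γ) ≤ S / m ^ (1 + γ) := h1
    rw [div_le_iff₀ (by positivity)] at h1'
    rw [Real.div_rpow hc.le hmpos.le]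
    calc _ ≤ _ := h1'
      _ = _ := by ring
  set A : Finset V := U₀.filter fun u => K₁ * D < degIn G U₀ u with hA
  have hAsub : A ⊆ U₀ := filter_subset _ _
  set s : ℝ := ∑ u ∈ A, degIn G U₀ u with hs
  have hs8 : s ≤ S / 8 := by
    rcases A.eq_empty_or_nonempty with h0 | hAne
    · rw [hs, h0]; simp; positivity
    have hp1 : 1 ≤ A.card := hAne.card_pos
    have hppos : (0 : ℝ) < A.card := by exact_mod_cast hp1
    set p : ℝ := ((A.card : ℕ) : ℝ) with hp
    have hpm : p * K₁ ≤ m := by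
      have h1 : p * (K₁ * D) ≤ s := by
        rw [hs, hp, ← nsmul_eq_mul, ← sum_const]
        exact sum_le_sum fun u hu => (mem_filter.1 hu).2.le
      have h2 : s ≤ S := sum_le_sum_of_subset_of_nonneg hAsub fun _ _ _ => degIn_nonneg _ _ _
      have h3 : p * K₁ * D ≤ m * D := by linarith
      exact le_of_mul_le_mul_right h3 hDpos
    have hblock : ∀ B ⊆ U₀, B.card ≤ A.card →
        ∑ b ∈ B, degIn G A b ≤ S * (2 * p / m) ^ (1 + γ) := by
      intro B _ hBc
      have hne : (A ∪ B).Nonempty := hAne.mono subset_union_left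
      have hc : ((A ∪ B).card : ℝ) ≤ 2 * p := by
        have h1 := card_union_le A B
        have : (A ∪ B).card ≤ 2 * A.card := by omega
        rw [hp]; exact_mod_cast this
      calc ∑ b ∈ B, degIn G A b ≤ ∑ b ∈ B, degIn G (A ∪ B) b :=
            sum_le_sum fun b _ => degIn_mono G subset_union_left b
        _ ≤ degSum G (A ∪ B) :=
            sum_le_sum_of_subset_of_nonneg subset_union_right fun _ _ _ => degIn_nonneg _ _ _
        _ ≤ _ := hext _ hne
        _ ≤ _ := by gcongr
    have h1 := sum_le_of_blocks (degIn G A) (S * (2 * p / m) ^ (1 + γ)) (by positivity) A.card hp1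
      U₀ hblock
    rw [← sum_degIn_comm G A U₀] at h1
    have hmp : 1 ≤ m / p := by
      rw [le_div_iff₀ hppos]
      have : (1 : ℝ) ≤ K₁ := by linarith
      nlinarith
    have hsmall : (2 * p / m) ^ γ ≤ 1 / 32 := by
      have h2 : 2 * p / m ≤ 1 / 32 ^ (1 / γ) := by
        rw [div_le_div_iff₀ hmpos (by positivity)]
        rw [hK₁] at hpm; linarith
      calc (2 * p / m) ^ γ ≤ (1 / 32 ^ (1 / γ)) ^ γ := by gcongr
        _ = 1 / 32 := by
          rw [Real.div_rpow (by norm_num) (by positivity), Real.one_rpow,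
            ← Real.rpow_mul (by norm_num), one_div_mul_cancel hγ.ne', Real.rpow_one]
    calc s ≤ S * (2 * p / m) ^ (1 + γ) * (m / p + 1) := h1
      _ ≤ S * (2 * p / m) ^ (1 + γ) * (2 * (m / p)) := by gcongr; linarith
      _ = 4 * S * (2 * p / m) ^ γ := by
          rw [Real.rpow_add (by positivity), Real.rpow_one]; field_simp; ring
      _ ≤ 4 * S * (1 / 32) := by gcongr
      _ = S / 8 := by ring
  set U₁ := U₀ \ A with hU₁
  have hU₁S : 3 / 4 * S ≤ degSum G U₁ := by
    have hdisj : Disjoint U₁ A := sdiff_disjoint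
    have hun : U₁ ∪ A = U₀ := sdiff_union_of_subset hAsub
    have h1 := degSum_union G hdisj
    rw [hun] at h1
    have h2 : degSum G A + ∑ u ∈ U₁, degIn G A u = s := by
      rw [sum_degIn_comm, degSum, ← sum_add_distrib, hs]
      refine sum_congr rfl fun u _ => ?_
      rw [add_comm, ← degIn_union G hdisj, hun]
    have h3 := degSum_nonneg G A
    have : degSum G U₀ = S := rfl
    linarith
  obtain ⟨U, hUmem, hUmax⟩ := exists_max_image U₁.powerset
    (fun U => degSum G U - D / 2 * U.card) ⟨U₁, by simp⟩
  have hUU₁ : U ⊆ U₁ := mem_powerset.1 hUmem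
  have hUU₀ : U ⊆ U₀ := hUU₁.trans sdiff_subset
  have hUpos : 0 < degSum G U - D / 2 * U.card := by
    have h1 := hUmax U₁ (by simp)
    have h2 : (U₁.card : ℝ) ≤ m := by rw [hm]; exact_mod_cast card_le_card sdiff_subset
    have h3 : D / 2 * U₁.card ≤ S / 2 := by rw [← hDm]; nlinarith
    linarith
  have hUne : U.Nonempty := by
    rw [nonempty_iff_ne_empty]; rintro rfl
    simp [degSum] at hUpos
  refine ⟨U, D / 4, hUne, by positivity, fun u hu => ⟨?_, ?_⟩, ?_⟩
  · have h1 := hUmax (U.erase u) (by rw [mem_powerset]; exact (erase_subset _ _).trans hUU₁)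
    have h2 : degSum G U = degSum G (U.erase u) + 2 * degIn G U u := by
      have hdisj : Disjoint (U.erase u) {u} := by simp
      have hun : U.erase u ∪ {u} = U := by
        ext x; by_cases hx : x = u <;> simp [hx, hu]
      have h3 := degSum_union G hdisj
      have h4 := degIn_union G hdisj u
      rw [sum_degIn_comm] at h3
      rw [hun] at h3 h4
      have h5 : degIn G {u} u = 0 := by simp [degIn, filter_singleton]
      simp only [degSum, sum_singleton, h5] at h3 h4 ⊢
      rw [h4, h3]; ring
    have h3 : ((U.erase u).card : ℝ) = U.card - 1 := by
      rw [card_erase_of_mem hu, Nat.cast_sub (card_pos.2 ⟨u, hu⟩)]; simp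
    simp only [h3] at h1
    linarith
  · have h1 : u ∉ A := (mem_sdiff.1 (hUU₁ hu)).2
    have h2 : degIn G U₀ u ≤ K₁ * D := by
      by_contra h; exact h1 (mem_filter.2 ⟨hUU₀ hu, not_le.1 h⟩)
    have := degIn_mono G hUU₀ u
    linarith
  · have hc : (0 : ℝ) < U.card := by exact_mod_cast hUne.card_pos
    calc _ ≤ S / m ^ (1 + γ) := hmaxV
      _ = D / m ^ γ := by rw [Real.rpow_add hmpos, Real.rpow_one, hD]; field_simp
      _ ≤ D / (U.card : ℝ) ^ γ := by
          have : (U.card : ℝ) ≤ m := by rw [hm]; exact_mod_cast card_le_card hUU₀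
          gcongr
      _ = _ := by ring

/-! ### Counting walks -/

section
variable {V : Type*}

/-- The vertex at position `i` of a sequence of `r + 1` vertices; positions beyond `r` return the
last vertex. Indexing by natural numbers keeps subsequences free of casts. -/
def pt {r : ℕ} (P : Fin (r + 1) → V) (i : ℕ) : V := P ⟨min i r, by omega⟩

/-- The sequence `Q` followed by `v`. -/
def app {r : ℕ} (Q : Fin (r + 1) → V) (v : V) : Fin (r + 1 + 1) → V :=
  Fin.snoc (α := fun _ => V) Q v

/-- The sequence `Q` preceded by `v`. -/
def pre {r : ℕ} (v : V) (Q : Fin (r + 1) → V) : Fin (r + 1 + 1) → V :=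
  Fin.cons (α := fun _ => V) v Q

/-- The subsequence of length `l` starting at position `s`. -/
def seg {r : ℕ} (P : Fin (r + 1) → V) (s l : ℕ) : Fin (l + 1) → V := fun i => pt P (s + i)

lemma pt_app_of_le {r : ℕ} (Q : Fin (r + 1) → V) (v : V) {i : ℕ} (hi : i ≤ r) :
    pt (app Q v) i = pt Q i := by
  have h : (⟨min i (r + 1), by omega⟩ : Fin (r + 1 + 1)) =
      Fin.castSucc ⟨min i r, by omega⟩ := by
    ext; simp; omega
  unfold pt app
  rw [h, Fin.snoc_castSucc]

lemma pt_app_last {r : ℕ} (Q : Fin (r + 1) → V) (v : V) : pt (app Q v) (r + 1) = v := by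
  have h : (⟨min (r + 1) (r + 1), by omega⟩ : Fin (r + 1 + 1)) = Fin.last (r + 1) := by
    ext; simp
  unfold pt app
  rw [h, Fin.snoc_last]

lemma pt_pre_zero {r : ℕ} (v : V) (Q : Fin (r + 1) → V) : pt (pre v Q) 0 = v := by
  unfold pt pre
  exact Fin.cons_zero (α := fun _ => V) v Q

lemma pt_pre_succ {r : ℕ} (v : V) (Q : Fin (r + 1) → V) (i : ℕ) :
    pt (pre v Q) (i + 1) = pt Q i := by
  have h : (⟨min (i + 1) (r + 1), by omega⟩ : Fin (r + 1 + 1)) =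
      Fin.succ ⟨min i r, by omega⟩ := by
    ext; simp
  unfold pt pre
  rw [h, Fin.cons_succ]

lemma pt_seg {r : ℕ} (P : Fin (r + 1) → V) (s l : ℕ) {i : ℕ} (hi : i ≤ l) :
    pt (seg P s l) i = pt P (s + i) := by
  unfold seg
  conv_lhs => unfold pt
  simp only [min_eq_left hi]
  rfl

lemma pt_ext {r : ℕ} {P Q : Fin (r + 1) → V} (h : ∀ i ≤ r, pt P i = pt Q i) : P = Q := by
  funext i
  have := h i (by omega)
  unfold pt at this
  have hi : (⟨min (i : ℕ) r, by omega⟩ : Fin (r + 1)) = i := by ext; simp; omega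
  rwa [hi] at this

lemma pt_coe {r : ℕ} (P : Fin (r + 1) → V) (i : Fin (r + 1)) : pt P i = P i := by
  unfold pt
  congr 1
  ext; simp; omega

/-- Consecutive vertices of the sequence are adjacent. -/
def IsWalk (H : SimpleGraph V) {r : ℕ} (P : Fin (r + 1) → V) : Prop :=
  ∀ i < r, H.Adj (pt P i) (pt P (i + 1))

lemma isWalk_app (H : SimpleGraph V) {r : ℕ} (Q : Fin (r + 1) → V) (v : V) :
    IsWalk H (app Q v) ↔ IsWalk H Q ∧ H.Adj (pt Q r) v := by
  constructor
  · intro h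
    refine ⟨fun i hi => ?_, ?_⟩
    · have := h i (by omega)
      rwa [pt_app_of_le _ _ (by omega), pt_app_of_le _ _ (by omega)] at this
    · have := h r (by omega)
      rwa [pt_app_of_le _ _ le_rfl, pt_app_last] at this
  · rintro ⟨h1, h2⟩ i hi
    rcases Nat.lt_succ_iff_lt_or_eq.1 hi with hlt | rfl
    · rw [pt_app_of_le _ _ (by omega), pt_app_of_le _ _ (by omega)]
      exact h1 i hlt
    · rwa [pt_app_of_le _ _ le_rfl, pt_app_last]

lemma isWalk_pre (H : SimpleGraph V) {r : ℕ} (Q : Fin (r + 1) → V) (v : V) :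
    IsWalk H (pre v Q) ↔ H.Adj v (pt Q 0) ∧ IsWalk H Q := by
  constructor
  · intro h
    refine ⟨?_, fun i hi => ?_⟩
    · have := h 0 (by omega)
      rwa [pt_pre_zero, pt_pre_succ] at this
    · have := h (i + 1) (by omega)
      rwa [pt_pre_succ, pt_pre_succ] at this
  · rintro ⟨h1, h2⟩ i hi
    rcases i with _ | i
    · rwa [pt_pre_zero, pt_pre_succ]
    · rw [pt_pre_succ, pt_pre_succ]
      exact h2 i (by omega)

lemma IsWalk.seg (H : SimpleGraph V) {r : ℕ} {P : Fin (r + 1) → V} (hP : IsWalk H P) {s l : ℕ}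
    (h : s + l ≤ r) :
    IsWalk H (seg P s l) := by
  intro i hi
  rw [pt_seg _ _ _ (by omega), pt_seg _ _ _ (by omega)]
  exact hP (s + i) (by omega)

variable [Fintype V]

lemma sum_app {M : Type*} [AddCommMonoid M] {r : ℕ} (g : (Fin (r + 1 + 1) → V) → M) :
    ∑ P, g P = ∑ Q : Fin (r + 1) → V, ∑ v, g (app Q v) := by
  rw [← (Fin.snocEquiv fun _ : Fin (r + 1 + 1) => V).sum_comp, Fintype.sum_prod_type, sum_comm]
  rfl

lemma sum_pre {M : Type*} [AddCommMonoid M] {r : ℕ} (g : (Fin (r + 1 + 1) → V) → M) :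
    ∑ P, g P = ∑ Q : Fin (r + 1) → V, ∑ v, g (pre v Q) := by
  rw [← (Fin.consEquiv fun _ : Fin (r + 1 + 1) => V).sum_comp, Fintype.sum_prod_type, sum_comm]
  rfl

/-- The number of sequences of `r + 1` vertices with a given property. -/
noncomputable def cnt {r : ℕ} (p : (Fin (r + 1) → V) → Prop) : ℝ :=
  ((univ.filter p).card : ℝ)

lemma cnt_nonneg {r : ℕ} (p : (Fin (r + 1) → V) → Prop) : 0 ≤ cnt p := Nat.cast_nonneg _

lemma cnt_mono {r : ℕ} {p q : (Fin (r + 1) → V) → Prop} (h : ∀ P, p P → q P) : cnt p ≤ cnt q := by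
  unfold cnt
  exact_mod_cast card_le_card fun P hP => by simp at hP ⊢; exact h P hP

lemma cnt_eq_sum {r : ℕ} (p : (Fin (r + 1) → V) → Prop) :
    cnt p = ∑ P, if p P then (1 : ℝ) else 0 := by
  simp [cnt]

lemma cnt_le_one {r : ℕ} {p : (Fin (r + 1) → V) → Prop} (h : ∀ P Q, p P → p Q → P = Q) :
    cnt p ≤ 1 := by
  unfold cnt
  exact_mod_cast card_le_one.2 fun P hP Q hQ => by
    simp at hP hQ; exact h P Q hP hQ

variable (H : SimpleGraph V)

lemma cnt_app_le {Δ : ℝ} (hΔ : ∀ u, degIn H univ u ≤ Δ) {r : ℕ}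
    {p : (Fin (r + 1 + 1) → V) → Prop} {q : (Fin (r + 1) → V) → Prop}
    (h : ∀ Q v, p (app Q v) → q Q ∧ H.Adj (pt Q r) v) : cnt p ≤ Δ * cnt q := by
  rw [cnt_eq_sum, cnt_eq_sum, sum_app, mul_sum]
  refine sum_le_sum fun Q _ => ?_
  by_cases hq : q Q
  · simp only [hq, if_true, mul_one]
    refine le_trans ?_ (hΔ (pt Q r))
    rw [degIn_eq_sum]
    refine sum_le_sum fun v _ => ?_
    split_ifs with h1 h2 <;> first | exact absurd (h Q v h1).2 h2 | norm_num
  · simp only [hq, if_false, mul_zero]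
    refine (sum_eq_zero fun v _ => ?_).le
    rw [if_neg fun h1 => hq (h Q v h1).1]

lemma le_cnt_app {d : ℝ} (hd : ∀ u, d ≤ degIn H univ u) {r : ℕ}
    {p : (Fin (r + 1 + 1) → V) → Prop} {q : (Fin (r + 1) → V) → Prop}
    (h : ∀ Q v, q Q → H.Adj (pt Q r) v → p (app Q v)) : d * cnt q ≤ cnt p := by
  rw [cnt_eq_sum, cnt_eq_sum, sum_app, mul_sum]
  refine sum_le_sum fun Q _ => ?_
  by_cases hq : q Q
  · simp only [hq, if_true, mul_one]
    refine (hd (pt Q r)).trans ?_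
    rw [degIn_eq_sum]
    refine sum_le_sum fun v _ => ?_
    split_ifs with h1 h2 <;> first | exact absurd (h Q v hq h1) h2 | norm_num
  · simp only [hq, if_false, mul_zero]
    exact sum_nonneg fun v _ => by split_ifs <;> norm_num

lemma cnt_pre_le {Δ : ℝ} (hΔ : ∀ u, degIn H univ u ≤ Δ) {r : ℕ}
    {p : (Fin (r + 1 + 1) → V) → Prop} {q : (Fin (r + 1) → V) → Prop}
    (h : ∀ Q v, p (pre v Q) → q Q ∧ H.Adj v (pt Q 0)) : cnt p ≤ Δ * cnt q := by
  rw [cnt_eq_sum, cnt_eq_sum, sum_pre, mul_sum]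
  refine sum_le_sum fun Q _ => ?_
  by_cases hq : q Q
  · simp only [hq, if_true, mul_one]
    refine le_trans ?_ (hΔ (pt Q 0))
    rw [degIn_eq_sum]
    refine sum_le_sum fun v _ => ?_
    split_ifs with h1 h2 <;> first | exact absurd (h Q v h1).2.symm h2 | norm_num
  · simp only [hq, if_false, mul_zero]
    refine (sum_eq_zero fun v _ => ?_).le
    rw [if_neg fun h1 => hq (h Q v h1).1]

/-- If the last vertex is a function of the rest, it does not contribute to the count. -/
lemma cnt_app_le_of_determined {r : ℕ} {p : (Fin (r + 1 + 1) → V) → Prop}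
    {q : (Fin (r + 1) → V) → Prop} (g : (Fin (r + 1) → V) → V)
    (h : ∀ Q v, p (app Q v) → q Q ∧ v = g Q) : cnt p ≤ cnt q := by
  rw [cnt_eq_sum, cnt_eq_sum, sum_app]
  refine sum_le_sum fun Q _ => ?_
  calc ∑ v, (if p (app Q v) then (1 : ℝ) else 0)
      ≤ ∑ v, if v = g Q then (if q Q then (1 : ℝ) else 0) else 0 := by
        refine sum_le_sum fun v _ => ?_
        by_cases hp : p (app Q v)
        · simp [(h Q v hp).1, (h Q v hp).2]
          split_ifs <;> norm_num
        · simp only [hp, if_false]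
          split_ifs <;> norm_num
    _ = _ := by simp

/-- The number of walks of length `r` between two vertices. -/
noncomputable def walkCount (r : ℕ) (u v : V) : ℝ :=
  cnt fun P : Fin (r + 1) → V => IsWalk H P ∧ pt P 0 = u ∧ pt P r = v

lemma walkCount_nonneg (r : ℕ) (u v : V) : 0 ≤ walkCount H r u v := cnt_nonneg _

lemma walkCount_one_le (u v : V) : walkCount H 1 u v ≤ 1 := by
  refine cnt_le_one fun P Q hP hQ => pt_ext fun i hi => ?_
  interval_cases i
  · rw [hP.2.1, hQ.2.1]
  · rw [hP.2.2, hQ.2.2]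

lemma sum_cnt_fiber {r : ℕ} (p : (Fin (r + 1) → V) → Prop) (i j : ℕ) :
    ∑ x, ∑ y, cnt (fun P => p P ∧ pt P i = x ∧ pt P j = y) = cnt p := by
  have h1 : ∀ x : V, ∑ y, cnt (fun P => p P ∧ pt P i = x ∧ pt P j = y) =
      ∑ P : Fin (r + 1) → V, if pt P i = x then (if p P then (1 : ℝ) else 0) else 0 := by
    intro x
    simp only [cnt_eq_sum]
    rw [sum_comm]
    refine sum_congr rfl fun P _ => ?_
    by_cases h : p P <;> by_cases h' : pt P i = x <;> simp [h, h']
  simp only [h1]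
  rw [sum_comm, cnt_eq_sum]
  refine sum_congr rfl fun P _ => ?_
  simp

lemma sum_walkCount (r : ℕ) : ∑ u, ∑ v, walkCount H r u v =
    cnt fun P : Fin (r + 1) → V => IsWalk H P :=
  sum_cnt_fiber (fun P : Fin (r + 1) → V => IsWalk H P) 0 r

section bounds
variable {H} {d Δ : ℝ}

lemma cnt_true_zero : cnt (fun _ : Fin (0 + 1) → V => True) = Fintype.card V := by
  simp [cnt]

lemma cnt_isWalk_le (hΔ : ∀ u, degIn H univ u ≤ Δ) (hΔ0 : 0 ≤ Δ) (r : ℕ) :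
    cnt (fun P : Fin (r + 1) → V => IsWalk H P) ≤ Fintype.card V * Δ ^ r := by
  induction r with
  | zero => rw [pow_zero, mul_one, ← cnt_true_zero]; exact cnt_mono fun _ _ => trivial
  | succ r ih =>
    calc _ ≤ Δ * cnt (fun P : Fin (r + 1) → V => IsWalk H P) :=
          cnt_app_le H hΔ fun Q v h => (isWalk_app H Q v).1 h
      _ ≤ Δ * (Fintype.card V * Δ ^ r) := by gcongr
      _ = _ := by ring

lemma le_cnt_isWalk (hd : ∀ u, d ≤ degIn H univ u) (hd0 : 0 ≤ d) (r : ℕ) :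
    Fintype.card V * d ^ r ≤ cnt (fun P : Fin (r + 1) → V => IsWalk H P) := by
  induction r with
  | zero =>
    rw [pow_zero, mul_one, ← cnt_true_zero]
    exact cnt_mono fun P _ i hi => absurd hi (Nat.not_lt_zero i)
  | succ r ih =>
    calc (Fintype.card V : ℝ) * d ^ (r + 1) = d * (Fintype.card V * d ^ r) := by ring
      _ ≤ d * cnt (fun P : Fin (r + 1) → V => IsWalk H P) := by gcongr
      _ ≤ _ := le_cnt_app H hd fun Q v h1 h2 => (isWalk_app H Q v).2 ⟨h1, h2⟩

lemma cnt_isWalk_end_le (hΔ : ∀ u, degIn H univ u ≤ Δ) (hΔ0 : 0 ≤ Δ) (r : ℕ) (z : V) :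
    cnt (fun P : Fin (r + 1) → V => IsWalk H P ∧ pt P r = z) ≤ Δ ^ r := by
  induction r with
  | zero =>
    rw [pow_zero]
    refine cnt_le_one fun P Q hP hQ => pt_ext fun i hi => ?_
    rw [Nat.le_zero.1 hi, hP.2, hQ.2]
  | succ r ih =>
    calc _ ≤ Δ * cnt (fun P : Fin (r + 1) → V => IsWalk H P ∧ pt P r = z) :=
          cnt_pre_le H hΔ fun Q v h => by
            rw [isWalk_pre, pt_pre_succ] at h
            exact ⟨⟨h.1.2, h.2⟩, h.1.1⟩
      _ ≤ Δ * Δ ^ r := by gcongr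
      _ = _ := by ring

/-- Prescribing a nonempty set of edges divides the number of walks by at least `Δ` for each
prescribed edge. -/
lemma cnt_isWalk_agree_le (hΔ : ∀ u, degIn H univ u ≤ Δ) (hΔ0 : 1 ≤ Δ) (f g : ℕ → V) (r : ℕ) :
    ∀ S : Finset ℕ, S.Nonempty → S ⊆ range r →
    cnt (fun P : Fin (r + 1) → V => IsWalk H P ∧ ∀ i ∈ S, pt P i = f i ∧ pt P (i + 1) = g i)
      * Δ ^ S.card ≤ Δ ^ r := by
  induction r with
  | zero =>
    intro S hS hS'
    obtain ⟨i, hi⟩ := hS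
    simpa using hS' hi
  | succ r ih =>
    intro S hS hS'
    by_cases hr : r ∈ S
    · by_cases hS0 : (S.erase r).Nonempty
      · have h1 := ih (S.erase r) hS0 fun i hi => by
          have := mem_range.1 (hS' (mem_of_mem_erase hi))
          have := ne_of_mem_erase hi
          simp; omega
        have hcard : S.card = (S.erase r).card + 1 := (card_erase_add_one hr).symm
        have h2 : cnt (fun P : Fin (r + 1 + 1) → V => IsWalk H P ∧
            ∀ i ∈ S, pt P i = f i ∧ pt P (i + 1) = g i) ≤
            cnt (fun P : Fin (r + 1) → V => IsWalk H P ∧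
            ∀ i ∈ S.erase r, pt P i = f i ∧ pt P (i + 1) = g i) := by
          refine cnt_app_le_of_determined (fun _ => g r) fun Q v h => ⟨⟨((isWalk_app H Q v).1 h.1).1,
            fun i hi => ?_⟩, ?_⟩
          · have h3 := h.2 i (mem_of_mem_erase hi)
            have := mem_range.1 (hS' (mem_of_mem_erase hi))
            have := ne_of_mem_erase hi
            rwa [pt_app_of_le _ _ (by omega), pt_app_of_le _ _ (by omega)] at h3
          · have h3 := (h.2 r hr).2
            rwa [pt_app_last] at h3
        calc _ ≤ cnt (fun P : Fin (r + 1) → V => IsWalk H P ∧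
            ∀ i ∈ S.erase r, pt P i = f i ∧ pt P (i + 1) = g i) * Δ ^ S.card := by gcongr
          _ = cnt (fun P : Fin (r + 1) → V => IsWalk H P ∧
            ∀ i ∈ S.erase r, pt P i = f i ∧ pt P (i + 1) = g i) * Δ ^ (S.erase r).card * Δ := by
              rw [hcard]; ring
          _ ≤ Δ ^ r * Δ := by gcongr
          _ = _ := by ring
      · have hSr : S = {r} := by
          rw [not_nonempty_iff_eq_empty] at hS0
          rw [← insert_erase hr, hS0, insert_empty_eq]
        have h2 : cnt (fun P : Fin (r + 1 + 1) → V => IsWalk H P ∧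
            ∀ i ∈ S, pt P i = f i ∧ pt P (i + 1) = g i) ≤
            cnt (fun P : Fin (r + 1) → V => IsWalk H P ∧ pt P r = f r) := by
          refine cnt_app_le_of_determined (fun _ => g r) fun Q v h => ⟨⟨((isWalk_app H Q v).1 h.1).1,
            ?_⟩, ?_⟩
          · have h3 := (h.2 r hr).1
            rwa [pt_app_of_le _ _ le_rfl] at h3
          · have h3 := (h.2 r hr).2
            rwa [pt_app_last] at h3
        rw [hSr] at h2 ⊢
        rw [card_singleton, pow_one, pow_succ]
        gcongr
        exact h2.trans (cnt_isWalk_end_le hΔ (by linarith) r _)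
    · have hS'' : S ⊆ range r := fun i hi => by
        have := mem_range.1 (hS' hi)
        have : i ≠ r := fun h => hr (h ▸ hi)
        simp; omega
      have h1 := ih S hS hS''
      have h2 : cnt (fun P : Fin (r + 1 + 1) → V => IsWalk H P ∧
            ∀ i ∈ S, pt P i = f i ∧ pt P (i + 1) = g i) ≤
            Δ * cnt (fun P : Fin (r + 1) → V => IsWalk H P ∧
            ∀ i ∈ S, pt P i = f i ∧ pt P (i + 1) = g i) := by
        refine cnt_app_le H hΔ fun Q v h => ?_
        have h3 := (isWalk_app H Q v).1 h.1
        refine ⟨⟨h3.1, fun i hi => ?_⟩, h3.2⟩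
        have h4 := h.2 i hi
        have := mem_range.1 (hS'' hi)
        rwa [pt_app_of_le _ _ (by omega), pt_app_of_le _ _ (by omega)] at h4
      calc _ ≤ Δ * cnt (fun P : Fin (r + 1) → V => IsWalk H P ∧
            ∀ i ∈ S, pt P i = f i ∧ pt P (i + 1) = g i) * Δ ^ S.card := by gcongr
        _ = Δ * (cnt (fun P : Fin (r + 1) → V => IsWalk H P ∧
            ∀ i ∈ S, pt P i = f i ∧ pt P (i + 1) = g i) * Δ ^ S.card) := by ring
        _ ≤ Δ * Δ ^ r := by gcongr
        _ = _ := by ring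

/-- Walks whose segment from `i` to `i + l` has its ends in a given relation. -/
lemma cnt_isWalk_segment_le (hΔ : ∀ u, degIn H univ u ≤ Δ) (hΔ0 : 0 ≤ Δ) (R : V → V → Prop)
    (l i j : ℕ) : ∀ r, r = i + l + j →
    cnt (fun P : Fin (r + 1) → V => IsWalk H P ∧ R (pt P i) (pt P (i + l))) ≤
      Δ ^ (i + j) * cnt (fun P : Fin (l + 1) → V => IsWalk H P ∧ R (pt P 0) (pt P l)) := by
  induction j with
  | zero =>
    induction i with
    | zero =>
      intro r hr
      obtain rfl : r = l := by omega
      simp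
    | succ i ih =>
      rintro r hr
      obtain ⟨r, rfl⟩ : ∃ r', r = r' + 1 := ⟨r - 1, by omega⟩
      have e : i + 1 + l = (i + l) + 1 := by omega
      have h1 : cnt (fun P : Fin (r + 1 + 1) → V =>
          IsWalk H P ∧ R (pt P (i + 1)) (pt P (i + 1 + l))) ≤
          Δ * cnt (fun P : Fin (r + 1) → V => IsWalk H P ∧ R (pt P i) (pt P (i + l))) := by
        rw [e]
        refine cnt_pre_le H hΔ fun Q v h => ?_
        rw [isWalk_pre, pt_pre_succ, pt_pre_succ] at h
        exact ⟨⟨h.1.2, h.2⟩, h.1.1⟩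
      calc _ ≤ _ := h1
        _ ≤ Δ * (Δ ^ (i + 0) * cnt (fun P : Fin (l + 1) → V => IsWalk H P ∧ R (pt P 0) (pt P l))) := by
          gcongr
          exact ih r (by omega)
        _ = _ := by ring
  | succ j ih =>
    rintro r hr
    obtain ⟨r, rfl⟩ : ∃ r', r = r' + 1 := ⟨r - 1, by omega⟩
    have h1 : cnt (fun P : Fin (r + 1 + 1) → V =>
          IsWalk H P ∧ R (pt P i) (pt P (i + l))) ≤
          Δ * cnt (fun P : Fin (r + 1) → V => IsWalk H P ∧ R (pt P i) (pt P (i + l))) := by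
      refine cnt_app_le H hΔ fun Q v h => ?_
      have h3 := (isWalk_app H Q v).1 h.1
      have h4 := h.2
      rw [pt_app_of_le _ _ (by omega), pt_app_of_le _ _ (by omega)] at h4
      exact ⟨⟨h3.1, h4⟩, h3.2⟩
    calc _ ≤ _ := h1
      _ ≤ Δ * (Δ ^ (i + j) * cnt (fun P : Fin (l + 1) → V => IsWalk H P ∧ R (pt P 0) (pt P l))) := by
        gcongr
        exact ih r (by omega)
      _ = _ := by ring

lemma cnt_isWalk_segment_le' (hΔ : ∀ u, degIn H univ u ≤ Δ) (hΔ0 : 0 ≤ Δ) (R : V → V → Prop)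
    {r i j : ℕ} (hij : i ≤ j) (hj : j ≤ r) :
    cnt (fun P : Fin (r + 1) → V => IsWalk H P ∧ R (pt P i) (pt P j)) ≤
      Δ ^ (r - (j - i)) *
        cnt (fun P : Fin (j - i + 1) → V => IsWalk H P ∧ R (pt P 0) (pt P (j - i))) := by
  obtain ⟨l, rfl⟩ := Nat.exists_eq_add_of_le hij
  obtain ⟨k, rfl⟩ := Nat.exists_eq_add_of_le hj
  have e1 : i + l - i = l := by omega
  have e2 : i + l + k - (i + l - i) = i + k := by omega
  rw [e2]
  rw [e1]
  exact cnt_isWalk_segment_le hΔ hΔ0 R l i k _ rfl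

/-- Few walks return to a vertex. -/
lemma cnt_isWalk_repeat_le (hΔ : ∀ u, degIn H univ u ≤ Δ) (hΔ0 : 0 ≤ Δ)
    {r i j : ℕ} (hij : i < j) (hj : j ≤ r) :
    cnt (fun P : Fin (r + 1) → V => IsWalk H P ∧ pt P i = pt P j) ≤
      Fintype.card V * Δ ^ (r - 1) := by
  have h1 := cnt_isWalk_segment_le' hΔ hΔ0 (· = ·) hij.le hj
  obtain ⟨l, hl⟩ : ∃ l, j - i = l + 1 := ⟨j - i - 1, by omega⟩
  have h2 : cnt (fun P : Fin (l + 1 + 1) → V => IsWalk H P ∧ pt P 0 = pt P (l + 1)) ≤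
      cnt (fun P : Fin (l + 1) → V => IsWalk H P) := by
    refine cnt_app_le_of_determined (fun Q => pt Q 0) fun Q v h => ⟨((isWalk_app H Q v).1 h.1).1, ?_⟩
    have h3 := h.2
    rw [pt_app_of_le _ _ (by omega), pt_app_last] at h3
    exact h3.symm
  have h3 := cnt_isWalk_le hΔ hΔ0 l
  rw [hl] at h1
  calc _ ≤ _ := h1
    _ ≤ Δ ^ (r - (l + 1)) * (Fintype.card V * Δ ^ l) := by gcongr; exact h2.trans h3
    _ = Fintype.card V * (Δ ^ (r - (l + 1)) * Δ ^ l) := by ring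
    _ = _ := by rw [← pow_add]; congr 2; omega

end bounds

/-- If all proper segments of length less than `t` are light, in the sense that the number of walks
of length `l` between their ends is at most `lam ^ (l - 1)`, then prescribing internal vertices
divides the bound `lam ^ (r - 1)` by `lam` for each of them. -/
lemma cnt_light_agree_le {lam : ℝ} (hlam : 0 < lam) {t : ℕ} (f : ℕ → V) (r : ℕ) :
    ∀ (S : Finset ℕ) (x z : V), S ⊆ Ioo 0 r → 1 ≤ r → r ≤ t → (S.Nonempty ∨ r < t) →
    cnt (fun P : Fin (r + 1) → V => (IsWalk H P ∧ ∀ i j, i < j → j ≤ r → j - i < t →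
        walkCount H (j - i) (pt P i) (pt P j) ≤ lam ^ (j - i - 1)) ∧
        pt P 0 = x ∧ pt P r = z ∧ ∀ i ∈ S, pt P i = f i) * lam ^ S.card ≤ lam ^ (r - 1) := by
  induction r using Nat.strong_induction_on with
  | _ r ih =>
    intro S x z hS hr hrt hor
    set p : (Fin (r + 1) → V) → Prop := fun P => (IsWalk H P ∧ ∀ i j, i < j → j ≤ r → j - i < t →
        walkCount H (j - i) (pt P i) (pt P j) ≤ lam ^ (j - i - 1)) ∧
        pt P 0 = x ∧ pt P r = z ∧ ∀ i ∈ S, pt P i = f i with hp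
    by_cases hex : ∃ P, p P
    swap
    · have : cnt p = 0 := by
        rw [cnt_eq_sum]
        exact sum_eq_zero fun P _ => if_neg fun h => hex ⟨P, h⟩
      rw [this, zero_mul]; positivity
    obtain ⟨P₀, hP₀⟩ := hex
    rcases S.eq_empty_or_nonempty with rfl | hSne
    · have hrt' : r < t := by rcases hor with h | h; · simp at h
                              · exact h
      have h1 := hP₀.1.2 0 r (by omega) le_rfl (by omega)
      rw [hP₀.2.1, hP₀.2.2.1, Nat.sub_zero] at h1
      simp only [card_empty, pow_zero, mul_one]
      refine le_trans (cnt_mono fun P hP => ?_) h1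
      exact ⟨hP.1.1, hP.2.1, hP.2.2.1⟩
    · -- split the walk at the last prescribed vertex
      set s := S.max' hSne with hs
      have hsS : s ∈ S := max'_mem S hSne
      have hsr := mem_Ioo.1 (hS hsS)
      set q : (Fin (s + 1) → V) → Prop := fun P => (IsWalk H P ∧ ∀ i j, i < j → j ≤ s → j - i < t →
        walkCount H (j - i) (pt P i) (pt P j) ≤ lam ^ (j - i - 1)) ∧
        pt P 0 = x ∧ pt P s = f s ∧ ∀ i ∈ S.erase s, pt P i = f i with hq
      have h1 : cnt q * lam ^ (S.erase s).card ≤ lam ^ (s - 1) := by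
        refine ih s hsr.2 (S.erase s) x (f s) (fun i hi => ?_) hsr.1 (by omega) (Or.inr (by omega))
        have h2 := mem_Ioo.1 (hS (mem_of_mem_erase hi))
        have h3 := S.le_max' i (mem_of_mem_erase hi)
        have h4 := ne_of_mem_erase hi
        rw [mem_Ioo]; omega
      have h2 : walkCount H (r - s) (f s) z ≤ lam ^ (r - s - 1) := by
        have h3 := hP₀.1.2 s r hsr.2 le_rfl (by omega)
        rwa [hP₀.2.2.1, hP₀.2.2.2 s hsS] at h3
      have h3 : cnt p ≤ cnt q * walkCount H (r - s) (f s) z := by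
        unfold walkCount cnt
        rw [← Nat.cast_mul, ← card_product]
        norm_cast
        refine card_le_card_of_injOn (fun P => (seg P 0 s, seg P s (r - s))) ?_ ?_
        · intro P hP
          have hP : p P := by simpa using hP
          simp only [coe_product, Set.mem_prod, mem_coe, mem_filter, mem_univ, true_and]
          refine ⟨⟨⟨hP.1.1.seg H (by omega), fun i j h1 h2 h3 => ?_⟩, ?_, ?_, fun i hi => ?_⟩,
            hP.1.1.seg H (by omega), ?_, ?_⟩
          · rw [pt_seg _ _ _ (by omega), pt_seg _ _ _ (by omega), zero_add, zero_add]
            exact hP.1.2 i j h1 (by omega) h3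
          · rw [pt_seg _ _ _ (by omega)]; exact hP.2.1
          · rw [pt_seg _ _ _ (by omega), zero_add]; exact hP.2.2.2 s hsS
          · have h3 := S.le_max' i (mem_of_mem_erase hi)
            rw [pt_seg _ _ _ (by omega), zero_add]
            exact hP.2.2.2 i (mem_of_mem_erase hi)
          · rw [pt_seg _ _ _ (by omega), add_zero]; exact hP.2.2.2 s hsS
          · rw [pt_seg _ _ _ (by omega), Nat.add_sub_cancel' hsr.2.le]; exact hP.2.2.1
        · intro P _ Q _ hPQ
          simp only [Prod.mk.injEq] at hPQ
          refine pt_ext fun i hi => ?_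
          by_cases his : i ≤ s
          · have := congrArg (fun R => pt R i) hPQ.1
            simpa [pt_seg _ _ _ his] using this
          · have := congrArg (fun R => pt R (i - s)) hPQ.2
            rwa [pt_seg _ _ _ (by omega), pt_seg _ _ _ (by omega),
              Nat.add_sub_cancel' (by omega)] at this
      have hcard : S.card = (S.erase s).card + 1 := (card_erase_add_one hsS).symm
      calc cnt p * lam ^ S.card ≤ (cnt q * walkCount H (r - s) (f s) z) * lam ^ S.card := by gcongr
        _ = (cnt q * lam ^ (S.erase s).card) * (walkCount H (r - s) (f s) z * lam) := by
          rw [hcard]; ring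
        _ ≤ lam ^ (s - 1) * (lam ^ (r - s - 1) * lam) := by
          have := walkCount_nonneg H (r - s) (f s) z
          gcongr
        _ = lam ^ (r - 1) := by
          rw [← pow_succ, ← pow_add]; congr 1; omega

end

/-! ### A spread family of paths -/

section
variable {V : Type*} [Fintype V]

lemma cnt_le_add {r : ℕ} {p q s : (Fin (r + 1) → V) → Prop} (h : ∀ P, p P → q P ∨ s P) :
    cnt p ≤ cnt q + cnt s := by
  simp only [cnt_eq_sum, ← sum_add_distrib]
  refine sum_le_sum fun P _ => ?_
  by_cases h1 : p P
  · rcases h P h1 with h2 | h2 <;> simp [h1, h2] <;> split_ifs <;> norm_num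
  · simp only [h1, if_false]
    split_ifs <;> norm_num

lemma cnt_le_sum {r : ℕ} {ι : Type*} (I : Finset ι) {p : (Fin (r + 1) → V) → Prop}
    {q : ι → (Fin (r + 1) → V) → Prop} (h : ∀ P, p P → ∃ i ∈ I, q i P) :
    cnt p ≤ ∑ i ∈ I, cnt (q i) := by
  simp only [cnt_eq_sum]
  rw [sum_comm]
  refine sum_le_sum fun P _ => ?_
  have hnn : ∀ i ∈ I, (0 : ℝ) ≤ if q i P then 1 else 0 := fun i _ => by split_ifs <;> norm_num
  by_cases h1 : p P
  · obtain ⟨i, hi, hq⟩ := h P h1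
    have := single_le_sum hnn hi
    simpa [h1, hq] using this
  · simp only [h1, if_false]
    exact sum_nonneg hnn

lemma cnt_eq_zero {r : ℕ} {p : (Fin (r + 1) → V) → Prop} (h : ∀ P, ¬ p P) : cnt p = 0 := by
  rw [cnt_eq_sum]
  exact sum_eq_zero fun P _ => if_neg (h P)

lemma card_filter_eq_cnt {r : ℕ} (T : Finset (Fin (r + 1) → V)) (p : (Fin (r + 1) → V) → Prop) :
    ((T.filter p).card : ℝ) = cnt fun P => P ∈ T ∧ p P := by
  unfold cnt
  congr 2
  ext P; simp

lemma card_eq_cnt {r : ℕ} (T : Finset (Fin (r + 1) → V)) : (T.card : ℝ) = cnt fun P => P ∈ T := by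
  unfold cnt
  congr 2
  ext P; simp

/-- A family `T` of paths of length `t` in an almost regular graph with degrees of order `d`, such
that prescribing vertices or edges of a member of `T` costs what it would cost in a random graph:
up to the constant `A`, a factor `lam` for each internal vertex if both ends are given, and, if no
vertex is given, a factor `|V| * d` for the first edge and `lam` for each further edge. In addition
a member of `T` has many continuations in `T` when its last vertex is removed. -/
structure IsSpreadFamily (H : SimpleGraph V) (d lam A : ℝ) (t : ℕ)
    (T : Finset (Fin (t + 1) → V)) : Prop where
  walk : ∀ P ∈ T, IsWalk H P
  inj : ∀ P ∈ T, ∀ i j, i < j → j ≤ t → pt P i ≠ pt P j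
  vertices : ∀ S ⊆ Ioo 0 t, ∀ (x z : V) (f : ℕ → V),
    cnt (fun P => P ∈ T ∧ pt P 0 = x ∧ pt P t = z ∧ ∀ i ∈ S, pt P i = f i) * lam ^ S.card ≤
      A * cnt (fun P => P ∈ T ∧ pt P 0 = x ∧ pt P t = z)
  edges : ∀ S ⊆ range t, S.Nonempty → ∀ f g : ℕ → V,
    cnt (fun P => P ∈ T ∧ ∀ i ∈ S, pt P i = f i ∧ pt P (i + 1) = g i) *
      (Fintype.card V * d * lam ^ (S.card - 1)) ≤ A * cnt (fun P => P ∈ T)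
  forward : ∀ x w v : V,
    cnt (fun P => P ∈ T ∧ pt P 0 = x ∧ pt P (t - 1) = w ∧ pt P t = v) * d ≤
      A * cnt (fun P => P ∈ T ∧ pt P 0 = x ∧ pt P (t - 1) = w)
  large : Fintype.card V * d ^ t ≤ A * cnt (fun P => P ∈ T)

end

/-- A path whose ends are joined by many walks of its length, while the ends of each proper segment
are joined by few walks of the length of the segment. -/
def IsLightHeavy {V : Type*} [Fintype V] (H : SimpleGraph V) (lam : ℝ) {t : ℕ}
    (P : Fin (t + 1) → V) : Prop :=
  IsWalk H P ∧ lam ^ (t - 1) / 2 ≤ walkCount H t (pt P 0) (pt P t) ∧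
    (∀ i j, i < j → j ≤ t → pt P i ≠ pt P j) ∧
    ∀ i j, i < j → j ≤ t → 2 ≤ j - i → j - i < t →
      walkCount H (j - i) (pt P i) (pt P j) < lam ^ (j - i - 1) / 2

/-- In an almost regular graph of degree about `d` with `lam ^ (b - 1) = d ^ b / |V|`, a positive
proportion of the walks of some length `t ≤ b` are paths with heavy ends and light proper segments.
Call two vertices `l`-heavy if at least `lam ^ (l - 1) / 2` walks of length `l` join them. By
averaging, at least half of the walks of length `b` have heavy ends. Let `t` be the least length for
which a positive proportion of the walks have heavy ends, the proportions for different lengths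
being of different orders. Then most of the walks of length `t` with heavy ends have no heavy proper
segment. -/
lemma exists_isLightHeavy (b : ℕ) (hb : 2 ≤ b) (K : ℝ) (hK : 1 ≤ K) :
    ∃ e₀ lam₀ : ℝ, 0 < e₀ ∧ e₀ ≤ 1 ∧ 1 ≤ lam₀ ∧
      ∀ {V : Type*} [Fintype V] [Nonempty V] (H : SimpleGraph V) (d lam : ℝ), lam₀ ≤ lam → lam ≤ d →
      (∀ u, d ≤ degIn H univ u) → (∀ u, degIn H univ u ≤ K * d) →
      lam ^ (b - 1) * Fintype.card V = d ^ b →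
      ∃ t, 2 ≤ t ∧ t ≤ b ∧ e₀ / 2 * (Fintype.card V * d ^ t) ≤
        cnt (fun P : Fin (t + 1) → V => IsLightHeavy H lam P) := by
  set M : ℝ := 4 * (b + 1) ^ 2 * K ^ b with hM
  have hKb : 1 ≤ K ^ b := one_le_pow₀ hK
  have hM1 : 1 ≤ M := by
    have : (0 : ℝ) ≤ b := by positivity
    nlinarith
  set e₀ : ℝ := 1 / (2 * M ^ b) with he₀
  have he₀pos : 0 < e₀ := by positivity
  have he₀1 : e₀ ≤ 1 := by
    rw [he₀, div_le_one (by positivity)]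
    have := one_le_pow₀ (n := b) hM1
    linarith
  refine ⟨e₀, M / e₀, he₀pos, he₀1, ?_, ?_⟩
  · rw [le_div_iff₀ he₀pos]; linarith
  intro V _ _ H d lam hlam hlamd hd hΔ hlamb
  have hlam1 : 1 ≤ lam := by
    refine le_trans ?_ hlam
    rw [le_div_iff₀ he₀pos]; linarith
  have hd1 : 1 ≤ d := by linarith
  have hKd1 : 1 ≤ K * d := by nlinarith
  have hKd0 : 0 ≤ K * d := by linarith
  set m : ℝ := (Fintype.card V : ℝ) with hm
  have hmpos : 0 < m := by rw [hm]; exact_mod_cast Fintype.card_pos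
  set ε : ℕ → ℝ := fun l => 1 / (2 * M ^ (b - l)) with hε
  -- a positive proportion of the walks of length `l` has heavy ends
  set good : ℕ → Prop := fun l => 2 ≤ l ∧ ε l * (m * d ^ l) ≤
    cnt (fun P : Fin (l + 1) → V => IsWalk H P ∧
      lam ^ (l - 1) / 2 ≤ walkCount H l (pt P 0) (pt P l)) with hgood
  have hgoodb : good b := by
    refine ⟨hb, ?_⟩
    have h1 := le_cnt_isWalk hd (by linarith) b
    have h2 : cnt (fun P : Fin (b + 1) → V => IsWalk H P) ≤
        cnt (fun P : Fin (b + 1) → V => IsWalk H P ∧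
          lam ^ (b - 1) / 2 ≤ walkCount H b (pt P 0) (pt P b)) +
        cnt (fun P : Fin (b + 1) → V => IsWalk H P ∧
          ¬ lam ^ (b - 1) / 2 ≤ walkCount H b (pt P 0) (pt P b)) :=
      cnt_le_add fun P hP => by
        by_cases h : lam ^ (b - 1) / 2 ≤ walkCount H b (pt P 0) (pt P b)
        · exact Or.inl ⟨hP, h⟩
        · exact Or.inr ⟨hP, h⟩
    have h3 : cnt (fun P : Fin (b + 1) → V => IsWalk H P ∧
          ¬ lam ^ (b - 1) / 2 ≤ walkCount H b (pt P 0) (pt P b)) ≤ m * d ^ b / 2 := by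
      rw [← sum_cnt_fiber _ 0 b]
      calc _ ≤ ∑ _x : V, ∑ _y : V, lam ^ (b - 1) / 2 := by
            refine sum_le_sum fun x _ => sum_le_sum fun y _ => ?_
            by_cases h : lam ^ (b - 1) / 2 ≤ walkCount H b x y
            · rw [cnt_eq_zero]
              · positivity
              · rintro P ⟨⟨_, h2⟩, rfl, rfl⟩
                exact h2 h
            · refine le_trans (cnt_mono ?_) (not_le.1 h).le
              rintro P ⟨⟨h1, _⟩, h2⟩
              exact ⟨h1, h2⟩
        _ = m * d ^ b / 2 := by
            simp only [sum_const, card_univ, nsmul_eq_mul]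
            rw [← hlamb]; ring
    have h4 : ε b = 1 / 2 := by simp [hε]
    rw [h4]
    linarith
  have hex : ∃ l, good l := ⟨b, hgoodb⟩
  set t := Nat.find hex with ht
  have htgood : good t := Nat.find_spec hex
  have htmin : ∀ l, l < t → ¬ good l := fun l hl => Nat.find_min hex hl
  have htb : t ≤ b := Nat.find_min' hex hgoodb
  have ht2 : 2 ≤ t := htgood.1
  have hεt : e₀ ≤ ε t := by
    simp only [hε, he₀]
    have : M ^ (b - t) ≤ M ^ b := pow_le_pow_right₀ hM1 (by omega)
    gcongr
  have hεtpos : 0 < ε t := by linarith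
  have hKpow : ∀ s, s ≤ b → (K * d) ^ s ≤ K ^ b * d ^ s := by
    intro s hs
    rw [mul_pow]
    have : K ^ s ≤ K ^ b := pow_le_pow_right₀ hK hs
    gcongr
  refine ⟨t, ht2, htb, ?_⟩
  set p₀ : (Fin (t + 1) → V) → Prop := fun P => IsLightHeavy H lam P with hp₀
  set I := range (t + 1) ×ˢ range (t + 1) with hI
  have hIcard : (I.card : ℝ) ≤ (b + 1) ^ 2 := by
    rw [hI, card_product, card_range]
    push_cast
    have : (t : ℝ) ≤ b := by exact_mod_cast htb
    have : (0 : ℝ) ≤ t := by positivity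
    nlinarith
  set q₁ : ℕ × ℕ → (Fin (t + 1) → V) → Prop := fun ij P => (ij.1 < ij.2 ∧ ij.2 ≤ t) ∧
    IsWalk H P ∧ pt P ij.1 = pt P ij.2 with hq₁
  set q₂ : ℕ × ℕ → (Fin (t + 1) → V) → Prop := fun ij P =>
    (ij.1 < ij.2 ∧ ij.2 ≤ t ∧ 2 ≤ ij.2 - ij.1 ∧ ij.2 - ij.1 < t) ∧ IsWalk H P ∧
    lam ^ (ij.2 - ij.1 - 1) / 2 ≤ walkCount H (ij.2 - ij.1) (pt P ij.1) (pt P ij.2) with hq₂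
  have hb1 : ∀ ij ∈ I, cnt (q₁ ij) ≤ m * (K ^ b * d ^ (t - 1)) := by
    intro ij _
    by_cases hc : ij.1 < ij.2 ∧ ij.2 ≤ t
    · calc cnt (q₁ ij) ≤ cnt (fun P : Fin (t + 1) → V => IsWalk H P ∧ pt P ij.1 = pt P ij.2) :=
            cnt_mono fun P hP => hP.2
        _ ≤ m * (K * d) ^ (t - 1) := cnt_isWalk_repeat_le hΔ hKd0 hc.1 hc.2
        _ ≤ _ := by
          have := hKpow (t - 1) (by omega)
          gcongr
    · rw [cnt_eq_zero fun P hP => hc hP.1]; positivity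
  have hb2 : ∀ ij ∈ I, cnt (q₂ ij) ≤ K ^ b * (ε t / M) * (m * d ^ t) := by
    intro ij _
    by_cases hc : ij.1 < ij.2 ∧ ij.2 ≤ t ∧ 2 ≤ ij.2 - ij.1 ∧ ij.2 - ij.1 < t
    · set l := ij.2 - ij.1 with hl
      have hnot := htmin l hc.2.2.2
      have hlt : cnt (fun P : Fin (l + 1) → V => IsWalk H P ∧
          lam ^ (l - 1) / 2 ≤ walkCount H l (pt P 0) (pt P l)) ≤ ε l * (m * d ^ l) := by
        by_contra h
        exact hnot ⟨hc.2.2.1, (not_le.1 h).le⟩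
      have hεl : ε l ≤ ε t / M := by
        simp only [hε]
        rw [div_div, mul_assoc, ← pow_succ]
        have : M ^ (b - t + 1) ≤ M ^ (b - l) := pow_le_pow_right₀ hM1 (by omega)
        gcongr
      calc cnt (q₂ ij) ≤ cnt (fun P : Fin (t + 1) → V => IsWalk H P ∧
            lam ^ (l - 1) / 2 ≤ walkCount H l (pt P ij.1) (pt P ij.2)) :=
            cnt_mono fun P hP => hP.2
        _ ≤ (K * d) ^ (t - l) * cnt (fun P : Fin (l + 1) → V => IsWalk H P ∧
            lam ^ (l - 1) / 2 ≤ walkCount H l (pt P 0) (pt P l)) :=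
            cnt_isWalk_segment_le' hΔ hKd0
              (fun u v => lam ^ (l - 1) / 2 ≤ walkCount H l u v) hc.1.le hc.2.1
        _ ≤ (K ^ b * d ^ (t - l)) * ((ε t / M) * (m * d ^ l)) := by
            have := hKpow (t - l) (by omega)
            exact mul_le_mul this (hlt.trans (by gcongr)) (cnt_nonneg _) (by positivity)
        _ = K ^ b * (ε t / M) * (m * (d ^ (t - l) * d ^ l)) := by ring
        _ = _ := by rw [← pow_add, Nat.sub_add_cancel hc.2.2.2.le]
    · rw [cnt_eq_zero fun P hP => hc hP.1]; positivity
  have h1 : cnt (fun P : Fin (t + 1) → V => IsWalk H P ∧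
      lam ^ (t - 1) / 2 ≤ walkCount H t (pt P 0) (pt P t)) ≤
      cnt p₀ + cnt (fun P => ∃ ij ∈ I, q₁ ij P ∨ q₂ ij P) := by
    refine cnt_le_add fun P hP => ?_
    by_contra hcon
    rw [not_or] at hcon
    apply hcon.1
    refine ⟨hP.1, hP.2, fun i j hij hj heq => hcon.2 ⟨(i, j), ?_, Or.inl ⟨⟨hij, hj⟩, hP.1, heq⟩⟩,
      fun i j hij hj h2 h3 => not_le.1 fun h4 =>
        hcon.2 ⟨(i, j), ?_, Or.inr ⟨⟨hij, hj, h2, h3⟩, hP.1, h4⟩⟩⟩ <;>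
    · simp only [hI, mem_product, mem_range]; omega
  have h2 : cnt (fun P => ∃ ij ∈ I, q₁ ij P ∨ q₂ ij P) ≤
      ∑ ij ∈ I, (m * (K ^ b * d ^ (t - 1)) + K ^ b * (ε t / M) * (m * d ^ t)) := by
    refine (cnt_le_sum I fun P hP => hP).trans (sum_le_sum fun ij hij => ?_)
    exact (cnt_le_add fun P hP => hP).trans (add_le_add (hb1 ij hij) (hb2 ij hij))
  rw [sum_const, nsmul_eq_mul] at h2
  have h3 : (I.card : ℝ) * (m * (K ^ b * d ^ (t - 1)) + K ^ b * (ε t / M) * (m * d ^ t)) ≤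
      ε t / 2 * (m * d ^ t) := by
    have h4 : m * (K ^ b * d ^ (t - 1)) ≤ K ^ b * (ε t / M) * (m * d ^ t) := by
      have h5 : 1 ≤ ε t / M * d := by
        rw [div_mul_eq_mul_div, le_div_iff₀ (by linarith)]
        have h6 : M ≤ lam * e₀ := by rwa [div_le_iff₀ he₀pos] at hlam
        nlinarith
      have h6 : d ^ t = d ^ (t - 1) * d := by rw [← pow_succ]; congr 1; omega
      rw [h6]
      calc m * (K ^ b * d ^ (t - 1)) = m * (K ^ b * d ^ (t - 1)) * 1 := by ring
        _ ≤ m * (K ^ b * d ^ (t - 1)) * (ε t / M * d) := by gcongr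
        _ = _ := by ring
    calc (I.card : ℝ) * (m * (K ^ b * d ^ (t - 1)) + K ^ b * (ε t / M) * (m * d ^ t))
        ≤ (b + 1) ^ 2 * (K ^ b * (ε t / M) * (m * d ^ t) + K ^ b * (ε t / M) * (m * d ^ t)) := by
          gcongr
      _ = ε t / 2 * (m * d ^ t) * (4 * (b + 1) ^ 2 * K ^ b / M) := by ring
      _ = ε t / 2 * (m * d ^ t) := by rw [← hM, div_self (by positivity), mul_one]
  have h4 := htgood.2
  have h5 : e₀ / 2 * (m * d ^ t) ≤ ε t / 2 * (m * d ^ t) := by gcongr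
  linarith

/-- In an almost regular graph of degree about `d` with `lam ^ (b - 1) = d ^ b / |V|` there is a
spread family of paths of some length `t ≤ b`: the paths with heavy ends and light proper segments,
except for those whose ends, or whose first and last but one vertices, are joined by few of them. -/
lemma exists_isSpreadFamily (b : ℕ) (hb : 2 ≤ b) (K : ℝ) (hK : 1 ≤ K) :
    ∃ A lam₀ : ℝ, 1 ≤ A ∧ 1 ≤ lam₀ ∧ ∀ {V : Type*} [Fintype V] [Nonempty V] (H : SimpleGraph V)
      (d lam : ℝ), lam₀ ≤ lam → lam ≤ d →
      (∀ u, d ≤ degIn H univ u) → (∀ u, degIn H univ u ≤ K * d) →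
      lam ^ (b - 1) * Fintype.card V = d ^ b →
      ∃ t, 2 ≤ t ∧ t ≤ b ∧ ∃ T : Finset (Fin (t + 1) → V), IsSpreadFamily H d lam A t T := by
  obtain ⟨e₀, lam₀, he₀pos, he₀1, hlam₀, hmain⟩ := exists_isLightHeavy b hb K hK
  have hKb : 1 ≤ K ^ b := one_le_pow₀ hK
  set A : ℝ := 16 * K ^ b / e₀ with hA
  have hA1 : 16 * K ^ b ≤ A := by
    rw [hA, le_div_iff₀ he₀pos]; nlinarith
  refine ⟨A, lam₀, by linarith, hlam₀, ?_⟩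
  intro V _ _ H d lam hlam hlamd hd hΔ hlamb
  have hlam1 : 1 ≤ lam := hlam₀.trans hlam
  have hd1 : 1 ≤ d := by linarith
  have hKd1 : 1 ≤ K * d := by nlinarith
  have hKd0 : 0 ≤ K * d := by linarith
  obtain ⟨t, ht2, htb, hp₀large⟩ := hmain H d lam hlam hlamd hd hΔ hlamb
  set m : ℝ := (Fintype.card V : ℝ) with hm
  have hmpos : 0 < m := by rw [hm]; exact_mod_cast Fintype.card_pos
  have hKpow : ∀ s, s ≤ b → (K * d) ^ s ≤ K ^ b * d ^ s := by
    intro s hs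
    rw [mul_pow]
    have : K ^ s ≤ K ^ b := pow_le_pow_right₀ hK hs
    gcongr
  set p₀ : (Fin (t + 1) → V) → Prop := fun P => IsLightHeavy H lam P with hp₀
  -- discard ends and last edges that few of the remaining walks use
  set η : ℝ := e₀ / (8 * K ^ b) with hη
  have hηpos : 0 < η := by positivity
  set R : (Fin (t + 1) → V) → (V × V) ⊕ (V × V) → Prop := fun P c =>
    Sum.elim (fun c => pt P 0 = c.1 ∧ pt P t = c.2) (fun c => pt P 0 = c.1 ∧ pt P (t - 1) = c.2) c
    with hR
  set h : (V × V) ⊕ (V × V) → ℝ := Sum.elim (fun c => η * walkCount H t c.1 c.2)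
    (fun c => η * d * walkCount H (t - 1) c.1 c.2) with hh
  have hhnn : ∀ c, 0 ≤ h c := by
    rintro (c | c) <;> simp only [hh, Sum.elim_inl, Sum.elim_inr]
    · have := walkCount_nonneg H t c.1 c.2; positivity
    · have := walkCount_nonneg H (t - 1) c.1 c.2; positivity
  obtain ⟨T, hT0, hTcard, hTclean⟩ := exists_clean_subset (univ.filter p₀) R h hhnn
  have hTp : ∀ P ∈ T, p₀ P := fun P hP => by simpa using hT0 hP
  have hTends : ∀ P ∈ T, η * walkCount H t (pt P 0) (pt P t) ≤
      cnt (fun P' => P' ∈ T ∧ pt P' 0 = pt P 0 ∧ pt P' t = pt P t) := by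
    intro P hP
    have := hTclean (Sum.inl (pt P 0, pt P t)) ⟨P, hP, rfl, rfl⟩
    rwa [card_filter_eq_cnt] at this
  have hTpen : ∀ P ∈ T, η * d * walkCount H (t - 1) (pt P 0) (pt P (t - 1)) ≤
      cnt (fun P' => P' ∈ T ∧ pt P' 0 = pt P 0 ∧ pt P' (t - 1) = pt P (t - 1)) := by
    intro P hP
    have := hTclean (Sum.inr (pt P 0, pt P (t - 1))) ⟨P, hP, rfl, rfl⟩
    rwa [card_filter_eq_cnt] at this
  have hTlarge : e₀ / 4 * (m * d ^ t) ≤ cnt (fun P => P ∈ T) := by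
    rw [← card_eq_cnt]
    have h1 : ∑ c, h c ≤ e₀ / 4 * (m * d ^ t) := by
      simp only [hh, Fintype.sum_sum_type, Sum.elim_inl, Sum.elim_inr, Fintype.sum_prod_type,
        ← mul_sum, sum_walkCount]
      have h2 := cnt_isWalk_le hΔ hKd0 t
      have h3 := cnt_isWalk_le hΔ hKd0 (t - 1)
      calc _ ≤ η * (m * (K ^ b * d ^ t)) + η * d * (m * (K ^ b * d ^ (t - 1))) := by
            gcongr
            · exact h2.trans (by gcongr; exact hKpow t htb)
            · exact h3.trans (by gcongr; exact hKpow (t - 1) (by omega))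
        _ = η * (m * (K ^ b * d ^ t)) + η * (m * (K ^ b * (d ^ (t - 1) * d))) := by ring
        _ = e₀ / 4 * (m * d ^ t) := by
            rw [← pow_succ, Nat.sub_add_cancel (by omega), hη]
            field_simp; ring
    have h2 : ((univ.filter p₀).card : ℝ) = cnt p₀ := by simp [cnt]
    rw [h2] at hTcard
    linarith
  have hηA : 1 ≤ A * η := by
    rw [hA, hη]; field_simp; norm_num
  have hηA2 : 2 ≤ A * η := by
    rw [hA, hη]; field_simp; norm_num
  refine ⟨t, ht2, htb, T, ⟨fun P hP => (hTp P hP).1, fun P hP => (hTp P hP).2.2.1, ?_, ?_, ?_, ?_⟩⟩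
  -- light segments bound the number of paths through the vertices, while heavy ends and cleaning
  -- bound the number of all paths with these ends from below
  · intro S hS x z f
    rcases S.eq_empty_or_nonempty with rfl | hSne
    · simp only [card_empty, pow_zero, mul_one]
      have h1 : cnt (fun P => P ∈ T ∧ pt P 0 = x ∧ pt P t = z ∧ ∀ i ∈ (∅ : Finset ℕ), pt P i = f i) ≤
          cnt (fun P => P ∈ T ∧ pt P 0 = x ∧ pt P t = z) :=
        cnt_mono fun P hP => ⟨hP.1, hP.2.1, hP.2.2.1⟩
      have h2 := cnt_nonneg (fun P => P ∈ T ∧ pt P 0 = x ∧ pt P t = z)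
      nlinarith
    by_cases hex : ∃ P ∈ T, pt P 0 = x ∧ pt P t = z
    · obtain ⟨P, hP, rfl, rfl⟩ := hex
      have h1 := cnt_light_agree_le H (by linarith : 0 < lam) (t := t) f t S (pt P 0) (pt P t) hS
        (by omega) le_rfl (Or.inl hSne)
      have h2 : cnt (fun P' => P' ∈ T ∧ pt P' 0 = pt P 0 ∧ pt P' t = pt P t ∧
          ∀ i ∈ S, pt P' i = f i) ≤ cnt (fun P' : Fin (t + 1) → V =>
          (IsWalk H P' ∧ ∀ i j, i < j → j ≤ t → j - i < t →
            walkCount H (j - i) (pt P' i) (pt P' j) ≤ lam ^ (j - i - 1)) ∧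
          pt P' 0 = pt P 0 ∧ pt P' t = pt P t ∧ ∀ i ∈ S, pt P' i = f i) := by
        refine cnt_mono fun P' hP' => ⟨⟨(hTp _ hP'.1).1, fun i j hij hj hlt => ?_⟩, hP'.2⟩
        by_cases h2 : 2 ≤ j - i
        · have h3 := (hTp _ hP'.1).2.2.2 i j hij hj h2 hlt
          have : 0 ≤ lam ^ (j - i - 1) := by positivity
          linarith
        · have h3 : j - i = 1 := by omega
          rw [h3]
          simpa using walkCount_one_le H _ _
      have h3 := hTends P hP
      have h4 := (hTp P hP).2.1
      calc _ ≤ _ := mul_le_mul_of_nonneg_right h2 (by positivity)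
        _ ≤ lam ^ (t - 1) := h1
        _ ≤ 2 * walkCount H t (pt P 0) (pt P t) := by linarith
        _ ≤ A * η * walkCount H t (pt P 0) (pt P t) := by
            have := walkCount_nonneg H t (pt P 0) (pt P t)
            gcongr
        _ = A * (η * walkCount H t (pt P 0) (pt P t)) := by ring
        _ ≤ _ := by gcongr
    · rw [cnt_eq_zero fun P hP => hex ⟨P, hP.1, hP.2.1, hP.2.2.1⟩, zero_mul]
      have := cnt_nonneg (fun P => P ∈ T ∧ pt P 0 = x ∧ pt P t = z)
      positivity
  · intro S hS hSne f g
    have h1 := cnt_isWalk_agree_le hΔ hKd1 f g t S hSne hS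
    have h2 : cnt (fun P => P ∈ T ∧ ∀ i ∈ S, pt P i = f i ∧ pt P (i + 1) = g i) ≤
        cnt (fun P : Fin (t + 1) → V => IsWalk H P ∧ ∀ i ∈ S, pt P i = f i ∧ pt P (i + 1) = g i) :=
      cnt_mono fun P hP => ⟨(hTp P hP.1).1, hP.2⟩
    have hcard : S.card = S.card - 1 + 1 := by
      have := hSne.card_pos; omega
    have h3 : d * lam ^ (S.card - 1) ≤ (K * d) ^ S.card := by
      calc d * lam ^ (S.card - 1) ≤ (K * d) * (K * d) ^ (S.card - 1) := by
            have h4 : lam ≤ K * d := by nlinarith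
            have h5 : d ≤ K * d := by nlinarith
            gcongr
        _ = (K * d) ^ S.card := by rw [← pow_succ', ← hcard]
    have h4 := cnt_nonneg
      (fun P : Fin (t + 1) → V => IsWalk H P ∧ ∀ i ∈ S, pt P i = f i ∧ pt P (i + 1) = g i)
    calc _ ≤ cnt (fun P : Fin (t + 1) → V => IsWalk H P ∧
            ∀ i ∈ S, pt P i = f i ∧ pt P (i + 1) = g i) * (m * (K * d) ^ S.card) := by
          rw [mul_assoc m]
          gcongr
      _ = m * (cnt (fun P : Fin (t + 1) → V => IsWalk H P ∧
            ∀ i ∈ S, pt P i = f i ∧ pt P (i + 1) = g i) * (K * d) ^ S.card) := by ring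
      _ ≤ m * (K * d) ^ t := by gcongr
      _ ≤ m * (K ^ b * d ^ t) := by gcongr; exact hKpow t htb
      _ = 4 * K ^ b / e₀ * (e₀ / 4 * (m * d ^ t)) := by field_simp
      _ ≤ A * cnt (fun P => P ∈ T) := by
          have : 4 * K ^ b / e₀ ≤ A := by rw [hA]; gcongr; norm_num
          gcongr
  · intro x w v
    by_cases hex : ∃ P ∈ T, pt P 0 = x ∧ pt P (t - 1) = w
    · obtain ⟨P, hP, rfl, rfl⟩ := hex
      have h1 : cnt (fun P' => P' ∈ T ∧ pt P' 0 = pt P 0 ∧ pt P' (t - 1) = pt P (t - 1) ∧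
          pt P' t = v) ≤ walkCount H (t - 1) (pt P 0) (pt P (t - 1)) := by
        obtain ⟨s, hs⟩ : ∃ s, t = s + 1 := ⟨t - 1, by omega⟩
        subst hs
        refine cnt_app_le_of_determined (fun _ => v) fun Q u hQ => ⟨⟨?_, ?_, ?_⟩, ?_⟩
        · exact ((isWalk_app H Q u).1 (hTp _ hQ.1).1).1
        · have := hQ.2.1
          rwa [pt_app_of_le _ _ (by omega)] at this
        · have := hQ.2.2.1
          rwa [pt_app_of_le _ _ (by omega)] at this
        · have := hQ.2.2.2
          rwa [pt_app_last] at this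
      have h2 := hTpen P hP
      have h3 := walkCount_nonneg H (t - 1) (pt P 0) (pt P (t - 1))
      calc _ ≤ walkCount H (t - 1) (pt P 0) (pt P (t - 1)) * d := by gcongr
        _ ≤ (A * η) * (walkCount H (t - 1) (pt P 0) (pt P (t - 1)) * d) :=
            le_mul_of_one_le_left (by positivity) hηA
        _ = A * (η * d * walkCount H (t - 1) (pt P 0) (pt P (t - 1))) := by ring
        _ ≤ _ := by gcongr
    · rw [cnt_eq_zero fun P hP => hex ⟨P, hP.1, hP.2.1, hP.2.2.1⟩, zero_mul]
      have := cnt_nonneg (fun P => P ∈ T ∧ pt P 0 = x ∧ pt P (t - 1) = w)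
      positivity
  · calc m * d ^ t = 4 / e₀ * (e₀ / 4 * (m * d ^ t)) := by field_simp
      _ ≤ A * cnt (fun P => P ∈ T) := by
        have : 4 / e₀ ≤ A := by rw [hA]; gcongr; linarith
        gcongr

/-! ### Extending a spread family to a measure on walks of length `b` -/

section mass
variable {V : Type*} [Fintype V]

/-- The total weight of the sequences with property `p`. -/
noncomputable def mass {r : ℕ} (F : (Fin (r + 1) → V) → ℝ) (p : (Fin (r + 1) → V) → Prop) : ℝ :=
  ∑ P, if p P then F P else 0

variable {r : ℕ} {F : (Fin (r + 1) → V) → ℝ}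

lemma mass_nonneg (hF : ∀ P, 0 ≤ F P) (p : (Fin (r + 1) → V) → Prop) : 0 ≤ mass F p :=
  sum_nonneg fun P _ => by split_ifs <;> simp [hF]

lemma mass_mono (hF : ∀ P, 0 ≤ F P) {p q : (Fin (r + 1) → V) → Prop} (h : ∀ P, p P → q P) :
    mass F p ≤ mass F q := by
  refine sum_le_sum fun P _ => ?_
  by_cases h1 : p P
  · simp [h1, h P h1]
  · simp only [h1, if_false]
    split_ifs <;> simp [hF]

lemma mass_congr {p q : (Fin (r + 1) → V) → Prop} (h : ∀ P, p P ↔ q P) :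
    mass F p = mass F q := by
  congr 1; funext P; exact propext (h P)

lemma mass_eq_zero {p : (Fin (r + 1) → V) → Prop} (h : ∀ P, ¬ p P) : mass F p = 0 :=
  sum_eq_zero fun P _ => if_neg (h P)

lemma le_mass (hF : ∀ P, 0 ≤ F P) {p : (Fin (r + 1) → V) → Prop} {P : Fin (r + 1) → V} (h : p P) :
    F P ≤ mass F p := by
  have := single_le_sum (f := fun P => if p P then F P else 0)
    (fun P _ => by split_ifs <;> simp [hF]) (mem_univ P)
  simp only [h, if_true] at this
  exact this

lemma sum_mass_fiber {α : Type*} [Fintype α] (p : (Fin (r + 1) → V) → Prop)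
    (e : (Fin (r + 1) → V) → α) : ∑ a, mass F (fun P => p P ∧ e P = a) = mass F p := by
  unfold mass
  rw [sum_comm]
  refine sum_congr rfl fun P _ => ?_
  by_cases h : p P <;> simp [h]

lemma sum_cnt_fiber_one {α : Type*} [Fintype α] (p : (Fin (r + 1) → V) → Prop)
    (e : (Fin (r + 1) → V) → α) : ∑ a, cnt (fun P => p P ∧ e P = a) = cnt p := by
  simp only [cnt_eq_sum]
  exact sum_mass_fiber p e

end mass

section
variable {V : Type*} [Fintype V] {t : ℕ} (T : Finset (Fin (t + 1) → V))

/-- The number of members of `T` that start at `x` and whose last edge leads from `w` to `v`. -/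
noncomputable def lastEdge (x w v : V) : ℝ :=
  cnt fun P => P ∈ T ∧ pt P 0 = x ∧ pt P (t - 1) = w ∧ pt P t = v

/-- For a fixed start `x`, the weights of the edges between the last two layers of `T`. The even steps
of the zigzag walk lead back from the last layer, the odd steps lead forward to it. -/
noncomputable def zig (x : V) (j : ℕ) (u v : V) : ℝ :=
  if Even j then lastEdge T x v u else lastEdge T x u v

/-- The sum of the weights of the edges available for the `j`-th step of the zigzag walk. -/
noncomputable def zigDeg (x : V) (j : ℕ) (u : V) : ℝ := ∑ v, zig T x j u v

/-- The transition probability of the `j`-th step of the zigzag walk. -/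
noncomputable def zigStep (x : V) (j : ℕ) (u v : V) : ℝ := zig T x j u v / zigDeg T x j u

/-- The distribution of a uniformly random member of `T` followed by `j` steps of the random walk
between the last two layers of the members of `T` with the same start. -/
noncomputable def pathWeight : (j : ℕ) → (Fin (t + j + 1) → V) → ℝ
  | 0, P => if P ∈ T then 1 / (cnt fun P => P ∈ T) else 0
  | j + 1, P => pathWeight j (fun i => P (Fin.castSucc i)) *
      zigStep T (pt P 0) j (pt P (t + j)) (pt P (t + j + 1))

lemma pathWeight_app (j : ℕ) (Q : Fin (t + j + 1) → V) (v : V) :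
    pathWeight T (j + 1) (app Q v) =
      pathWeight T j Q * zigStep T (pt Q 0) j (pt Q (t + j)) v := by
  have h1 : (fun i => app Q v (Fin.castSucc i)) = Q := by
    funext i
    exact Fin.snoc_castSucc (α := fun _ => V) v Q i
  have h2 := pt_app_of_le Q v (Nat.zero_le (t + j))
  have h3 := pt_app_of_le Q v (le_refl (t + j))
  have h4 := pt_app_last Q v
  conv_lhs => unfold pathWeight
  rw [h1]
  erw [h2, h3, h4]

lemma lastEdge_nonneg (x w v : V) : 0 ≤ lastEdge T x w v := cnt_nonneg _

lemma zig_nonneg (x : V) (j : ℕ) (u v : V) : 0 ≤ zig T x j u v := by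
  unfold zig; split_ifs <;> exact lastEdge_nonneg _ _ _ _

lemma zigDeg_nonneg (x : V) (j : ℕ) (u : V) : 0 ≤ zigDeg T x j u :=
  sum_nonneg fun _ _ => zig_nonneg _ _ _ _ _

lemma zigStep_nonneg (x : V) (j : ℕ) (u v : V) : 0 ≤ zigStep T x j u v :=
  div_nonneg (zig_nonneg _ _ _ _ _) (zigDeg_nonneg _ _ _ _)

lemma zig_succ (x : V) (j : ℕ) (u v : V) : zig T x (j + 1) u v = zig T x j v u := by
  unfold zig
  by_cases h : Even j
  · simp [h, Nat.even_add_one]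
  · simp [h, Nat.even_add_one]

lemma zig_le_zigDeg (x : V) (j : ℕ) (u v : V) : zig T x j u v ≤ zigDeg T x j u :=
  single_le_sum (f := fun v => zig T x j u v) (fun _ _ => zig_nonneg _ _ _ _ _) (mem_univ v)

lemma zigDeg_mul_zigStep (x : V) (j : ℕ) (u v : V) :
    zigDeg T x j u * zigStep T x j u v = zig T x j u v := by
  unfold zigStep
  by_cases h : zigDeg T x j u = 0
  · have h1 := zig_le_zigDeg T x j u v
    have h2 := zig_nonneg T x j u v
    rw [h] at h1
    rw [h, zero_mul]; linarith
  · field_simp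

lemma sum_zigStep_le (x : V) (j : ℕ) (u : V) : ∑ v, zigStep T x j u v ≤ 1 := by
  unfold zigStep
  rw [← sum_div]
  exact div_self_le_one _

lemma sum_zigStep (x : V) (j : ℕ) (u : V) (h : zigDeg T x j u ≠ 0) :
    ∑ v, zigStep T x j u v = 1 := by
  unfold zigStep
  rw [← sum_div]
  exact div_self h

lemma pathWeight_nonneg : ∀ (j : ℕ) (P : Fin (t + j + 1) → V), 0 ≤ pathWeight T j P
  | 0, P => by
    unfold pathWeight
    split_ifs
    · exact div_nonneg zero_le_one (cnt_nonneg _)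
    · exact le_rfl
  | j + 1, P => by
    unfold pathWeight
    exact mul_nonneg (pathWeight_nonneg j _) (zigStep_nonneg _ _ _ _ _)

lemma mass_pathWeight_zero (p : (Fin (t + 1) → V) → Prop) :
    mass (pathWeight T 0) p = cnt (fun P => P ∈ T ∧ p P) / cnt (fun P => P ∈ T) := by
  rw [cnt_eq_sum (fun P => P ∈ T ∧ p P), sum_div]
  refine sum_congr rfl fun P _ => ?_
  unfold pathWeight
  by_cases h1 : p P <;> by_cases h2 : P ∈ T <;> simp [h1, h2]

lemma mass_succ (j : ℕ) (p : (Fin (t + j + 1 + 1) → V) → Prop) :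
    mass (pathWeight T (j + 1)) p = ∑ Q, pathWeight T j Q *
      ∑ v, if p (app Q v) then zigStep T (pt Q 0) j (pt Q (t + j)) v else 0 := by
  refine (sum_app (r := t + j) _).trans ?_
  refine sum_congr rfl fun Q _ => ?_
  rw [mul_sum]
  refine sum_congr rfl fun v _ => ?_
  rw [pathWeight_app]
  split_ifs <;> simp

lemma mass_succ_le (j : ℕ) {p : (Fin (t + j + 1 + 1) → V) → Prop}
    {q : (Fin (t + j + 1) → V) → Prop} (h : ∀ Q v, p (app Q v) → q Q) :
    mass (pathWeight T (j + 1)) p ≤ mass (pathWeight T j) q := by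
  rw [mass_succ]
  refine sum_le_sum fun Q _ => ?_
  by_cases hq : q Q
  · simp only [hq, if_true]
    refine mul_le_of_le_one_right (pathWeight_nonneg T j Q) ?_
    refine le_trans (sum_le_sum fun v _ => ?_) (sum_zigStep_le T (pt Q 0) j (pt Q (t + j)))
    split_ifs
    · exact le_rfl
    · exact zigStep_nonneg _ _ _ _ _
  · simp only [hq, if_false]
    rw [sum_eq_zero, mul_zero]
    intro v _
    rw [if_neg fun h1 => hq (h Q v h1)]

lemma mass_succ_le_of_determined (j : ℕ) {τ : ℝ} (hτ : ∀ x u v, zigStep T x j u v ≤ τ)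
    {p : (Fin (t + j + 1 + 1) → V) → Prop}
    {q : (Fin (t + j + 1) → V) → Prop} (g : (Fin (t + j + 1) → V) → V)
    (h : ∀ Q v, p (app Q v) → q Q ∧ v = g Q) :
    mass (pathWeight T (j + 1)) p ≤ τ * mass (pathWeight T j) q := by
  rw [mass_succ]
  unfold mass
  rw [mul_sum]
  refine sum_le_sum fun Q _ => ?_
  have hF := pathWeight_nonneg T j Q
  by_cases hq : q Q
  · simp only [hq, if_true]
    rw [mul_comm τ]
    refine mul_le_mul_of_nonneg_left ?_ hF
    calc _ ≤ ∑ v, if v = g Q then zigStep T (pt Q 0) j (pt Q (t + j)) v else 0 := by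
          refine sum_le_sum fun v _ => ?_
          by_cases hp : p (app Q v)
          · have h1 := (h Q v hp).2
            simp only [hp, if_true]
            rw [if_pos h1]
          · simp only [hp, if_false]
            split_ifs
            · exact zigStep_nonneg _ _ _ _ _
            · exact le_rfl
      _ ≤ τ := by rw [sum_ite_eq' univ (g Q)]; simp [hτ]
  · simp only [hq, if_false, mul_zero]
    rw [sum_eq_zero, mul_zero]
    intro v _
    rw [if_neg fun h1 => hq (h Q v h1).1]

/-- The last step, given the start of the walk. -/
lemma mass_succ_ends (j : ℕ) (p : (Fin (t + j + 1) → V) → Prop)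
    {q : (Fin (t + j + 1 + 1) → V) → Prop} (x z : V)
    (h : ∀ Q v, q (app Q v) ↔ (p Q ∧ pt Q 0 = x) ∧ v = z) :
    mass (pathWeight T (j + 1)) q = ∑ u,
      mass (pathWeight T j) (fun P => (p P ∧ pt P 0 = x) ∧ pt P (t + j) = u) * zigStep T x j u z := by
  rw [mass_succ]
  unfold mass
  simp only [sum_mul]
  rw [sum_comm]
  refine sum_congr rfl fun Q _ => ?_
  simp only [h]
  by_cases h1 : p Q ∧ pt Q 0 = x
  · simp [h1]
  · simp [h1]

/-- The zigzag walk is stationary: its position after `j` steps has a distribution proportional to the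
edge weight at the position. -/
lemma mass_pathWeight_ends (j : ℕ) (x z : V) :
    mass (pathWeight T j) (fun P => pt P 0 = x ∧ pt P (t + j) = z) =
      zigDeg T x j z / cnt (fun P => P ∈ T) := by
  induction j generalizing z with
  | zero =>
    rw [mass_pathWeight_zero]
    congr 1
    unfold zigDeg zig lastEdge
    simp only [Even.zero, if_true]
    rw [← sum_cnt_fiber_one _ (fun P => pt P (t - 1))]
    refine sum_congr rfl fun w _ => ?_
    congr 1; funext P
    simp only [Nat.add_zero, eq_iff_iff]
    tauto
  | succ j ih =>
    rw [mass_succ_ends T j (fun _ => True) x z fun Q v => by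
      erw [pt_app_of_le _ _ (Nat.zero_le _), pt_app_last]
      simp]
    have h1 : ∀ u, mass (pathWeight T j) (fun P => (True ∧ pt P 0 = x) ∧ pt P (t + j) = u) *
        zigStep T x j u z = zig T x j u z / cnt (fun P => P ∈ T) := by
      intro u
      rw [← zigDeg_mul_zigStep, mul_div_right_comm, ← ih u]
      congr 1
      exact mass_congr fun P => by simp
    simp only [h1]
    rw [← sum_div]
    congr 1
    exact sum_congr rfl fun u _ => (zig_succ T x j z u).symm

lemma zigDeg_ne_zero {j : ℕ} {P : Fin (t + j + 1) → V} (h : pathWeight T j P ≠ 0) :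
    zigDeg T (pt P 0) j (pt P (t + j)) ≠ 0 := by
  intro h0
  have h1 := mass_pathWeight_ends T j (pt P 0) (pt P (t + j))
  rw [h0, zero_div] at h1
  have h2 := le_mass (pathWeight_nonneg T j)
    (p := fun P' => pt P' 0 = pt P 0 ∧ pt P' (t + j) = pt P (t + j)) (P := P) ⟨rfl, rfl⟩
  have h3 := pathWeight_nonneg T j P
  exact h (by linarith)

lemma mass_pathWeight_true (hT : cnt (fun P => P ∈ T) ≠ 0) (j : ℕ) :
    mass (pathWeight T j) (fun _ => True) = 1 := by
  induction j with
  | zero =>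
    rw [mass_pathWeight_zero]
    simp only [and_true]
    exact div_self hT
  | succ j ih =>
    rw [mass_succ, ← ih]
    refine sum_congr rfl fun Q _ => ?_
    simp only [if_true]
    by_cases h : pathWeight T j Q = 0
    · simp [h]
    · rw [sum_zigStep _ _ _ _ (zigDeg_ne_zero T h), mul_one]

end

/-- A distribution `F` on walks of length `b` such that prescribing vertices or edges, or two vertices
coinciding, costs what it would cost in a random graph, up to the constant `A`; compare
`IsSpreadFamily`. The last field bounds the weight of a pair of walks with the same ends, when the
second walk is drawn conditionally on its ends. -/
structure IsPathMeasure {V : Type*} [Fintype V] (H : SimpleGraph V) (d lam A : ℝ) (b : ℕ)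
    (F : (Fin (b + 1) → V) → ℝ) : Prop where
  nonneg : ∀ P, 0 ≤ F P
  total : mass F (fun _ => True) = 1
  walk : ∀ P, F P ≠ 0 → IsWalk H P
  vertices : ∀ S ⊆ Ioo 0 b, ∀ (x z : V) (f : ℕ → V),
    mass F (fun P => (pt P 0 = x ∧ pt P b = z) ∧ ∀ i ∈ S, pt P i = f i) * lam ^ S.card ≤
      A * mass F (fun P => pt P 0 = x ∧ pt P b = z)
  edges : ∀ S ⊆ range b, S.Nonempty → ∀ f g : ℕ → V,
    mass F (fun P => ∀ i ∈ S, pt P i = f i ∧ pt P (i + 1) = g i) *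
      (Fintype.card V * d * lam ^ (S.card - 1)) ≤ A
  repeats : ∀ i j, i < j → j ≤ b → mass F (fun P => pt P i = pt P j) * lam ≤ A
  pair : ∀ P P' : Fin (b + 1) → V, pt P' 0 = pt P 0 → pt P' b = pt P b →
    F P * F P' * (Fintype.card V * d ^ b * lam ^ (b - 1)) ≤
      A * mass F (fun Q => pt Q 0 = pt P 0 ∧ pt Q b = pt P b)

section
variable {V : Type*} [Fintype V] {H : SimpleGraph V} {d lam A : ℝ} {t : ℕ}
  {T : Finset (Fin (t + 1) → V)}

lemma IsSpreadFamily.zig_even_le (hT : IsSpreadFamily H d lam A t T) (ht : 2 ≤ t) {j : ℕ}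
    (hj : Even j) (x u v : V) : zig T x j u v * lam ≤ A * zigDeg T x j u := by
  have h1 := hT.vertices {t - 1} (by intro i hi; simp at hi ⊢; omega) x u (fun _ => v)
  simp only [card_singleton, pow_one] at h1
  have h2 : zig T x j u v =
      cnt (fun P => P ∈ T ∧ pt P 0 = x ∧ pt P t = u ∧ ∀ i ∈ ({t - 1} : Finset ℕ), pt P i = v) := by
    unfold zig lastEdge
    rw [if_pos hj]
    congr 1; funext P
    simp only [mem_singleton, forall_eq, eq_iff_iff]
    tauto
  have h3 : zigDeg T x j u = cnt (fun P => P ∈ T ∧ pt P 0 = x ∧ pt P t = u) := by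
    unfold zigDeg zig lastEdge
    simp only [hj, if_true]
    rw [← sum_cnt_fiber_one _ (fun P => pt P (t - 1))]
    refine sum_congr rfl fun w _ => ?_
    congr 1; funext P
    simp only [eq_iff_iff]
    tauto
  rw [h2, h3]
  exact h1

lemma IsSpreadFamily.zig_odd_le (hT : IsSpreadFamily H d lam A t T) {j : ℕ}
    (hj : ¬ Even j) (x u v : V) : zig T x j u v * d ≤ A * zigDeg T x j u := by
  have h3 : zigDeg T x j u = cnt (fun P => P ∈ T ∧ pt P 0 = x ∧ pt P (t - 1) = u) := by
    unfold zigDeg zig lastEdge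
    simp only [hj, if_false]
    rw [← sum_cnt_fiber_one _ (fun P => pt P t)]
    refine sum_congr rfl fun w _ => ?_
    congr 1; funext P
    simp only [eq_iff_iff]
    tauto
  rw [h3]
  unfold zig lastEdge
  rw [if_neg hj]
  exact hT.forward x u v

lemma IsSpreadFamily.zig_le (hT : IsSpreadFamily H d lam A t T) (ht : 2 ≤ t) (hlamd : lam ≤ d)
    (j : ℕ) (x u v : V) : zig T x j u v * lam ≤ A * zigDeg T x j u := by
  by_cases hj : Even j
  · exact hT.zig_even_le ht hj x u v
  · exact (mul_le_mul_of_nonneg_left hlamd (zig_nonneg _ _ _ _ _)).trans (hT.zig_odd_le hj x u v)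

lemma IsSpreadFamily.zigStep_le (hT : IsSpreadFamily H d lam A t T) (ht : 2 ≤ t) (hlamd : lam ≤ d)
    (hA : 1 ≤ A) (hlam : 0 < lam) (j : ℕ) (x u v : V) : zigStep T x j u v ≤ A / lam := by
  unfold zigStep
  rw [le_div_iff₀ hlam, div_mul_eq_mul_div]
  exact div_le_of_le_mul₀ (zigDeg_nonneg _ _ _ _) (by linarith) (hT.zig_le ht hlamd j x u v)

/-- The cost of prescribing inner vertices. If the vertex `v` before the end `z` of a zigzag step is
prescribed, stationarity and reversibility exchange the step from `v` to `z` for the step from `z` to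
`v`, whose probability is `O(1 / lam)`; the total weight of the walks that end at `z` splits off. -/
lemma IsSpreadFamily.pathWeight_vertices (hT : IsSpreadFamily H d lam A t T) (ht : 2 ≤ t)
    (hlamd : lam ≤ d) (hA : 1 ≤ A) (hlam : 0 < lam) (f : ℕ → V) (j : ℕ) :
    ∀ S ⊆ Ioo 0 (t + j), ∀ x z : V,
    mass (pathWeight T j) (fun P => (pt P 0 = x ∧ pt P (t + j) = z) ∧ ∀ i ∈ S, pt P i = f i) *
      lam ^ S.card ≤ A ^ (j + 1) * mass (pathWeight T j) (fun P => pt P 0 = x ∧ pt P (t + j) = z) := by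
  induction j with
  | zero =>
    intro S hS x z
    rw [mass_pathWeight_zero, mass_pathWeight_zero, div_mul_eq_mul_div, zero_add, pow_one,
      ← mul_div_assoc]
    refine div_le_div_of_nonneg_right ?_ (cnt_nonneg _)
    have := hT.vertices S hS x z f
    simp only [and_assoc]
    exact this
  | succ j ih =>
    intro S hS x z
    have hA' : A ^ (j + 1) ≤ A ^ (j + 1 + 1) := pow_le_pow_right₀ hA (by omega)
    have hstep : mass (pathWeight T (j + 1)) (fun P => pt P 0 = x ∧ pt P (t + (j + 1)) = z) =
        ∑ u, mass (pathWeight T j) (fun P => (True ∧ pt P 0 = x) ∧ pt P (t + j) = u) *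
          zigStep T x j u z :=
      mass_succ_ends T j (fun _ => True) x z fun Q v => by
        erw [pt_app_of_le _ _ (Nat.zero_le _), pt_app_last]
        simp
    by_cases hr : t + j ∈ S
    · -- the last internal vertex is prescribed
      have h1 := ih (S.erase (t + j)) (fun i hi => by
        have := mem_Ioo.1 (hS (mem_of_mem_erase hi))
        have := ne_of_mem_erase hi
        rw [mem_Ioo]; omega) x (f (t + j))
      have hcard : S.card = (S.erase (t + j)).card + 1 := (card_erase_add_one hr).symm
      rw [mass_succ_ends T j (fun Q => ∀ i ∈ S, pt Q i = f i) x z fun Q v => by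
        erw [pt_app_of_le _ _ (Nat.zero_le _), pt_app_last]
        have h2 : (∀ i ∈ S, pt (app Q v) i = f i) ↔ ∀ i ∈ S, pt Q i = f i := by
          refine forall₂_congr fun i hi => ?_
          have := mem_Ioo.1 (hS hi)
          rw [pt_app_of_le _ _ (by omega)]
        erw [h2]
        tauto]
      rw [sum_eq_single (f (t + j)) (fun u _ hu => by
        rw [mass_eq_zero, zero_mul]
        rintro P ⟨⟨h2, _⟩, h3⟩
        exact hu (h3.symm.trans (h2 _ hr))) (fun h => absurd (mem_univ _) h)]
      have h2 : mass (pathWeight T j) (fun P => ((∀ i ∈ S, pt P i = f i) ∧ pt P 0 = x) ∧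
          pt P (t + j) = f (t + j)) ≤ mass (pathWeight T j) (fun P => (pt P 0 = x ∧
          pt P (t + j) = f (t + j)) ∧ ∀ i ∈ S.erase (t + j), pt P i = f i) :=
        mass_mono (pathWeight_nonneg T j) fun P hP =>
          ⟨⟨hP.1.2, hP.2⟩, fun i hi => hP.1.1 i (mem_of_mem_erase hi)⟩
      have h3 := zigStep_nonneg T x j (f (t + j)) z
      -- the mass at the prescribed vertex times the step probability is the symmetric edge weight
      calc _ ≤ (mass (pathWeight T j) (fun P => (pt P 0 = x ∧
            pt P (t + j) = f (t + j)) ∧ ∀ i ∈ S.erase (t + j), pt P i = f i) *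
            zigStep T x j (f (t + j)) z) * lam ^ S.card := by gcongr
        _ = (mass (pathWeight T j) (fun P => (pt P 0 = x ∧
            pt P (t + j) = f (t + j)) ∧ ∀ i ∈ S.erase (t + j), pt P i = f i) *
            lam ^ (S.erase (t + j)).card) * zigStep T x j (f (t + j)) z * lam := by
            rw [hcard]; ring
        _ ≤ (A ^ (j + 1) * mass (pathWeight T j) (fun P => pt P 0 = x ∧
            pt P (t + j) = f (t + j))) * zigStep T x j (f (t + j)) z * lam := by gcongr
        _ = A ^ (j + 1) * ((zigDeg T x j (f (t + j)) * zigStep T x j (f (t + j)) z) * lam /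
              cnt (fun P => P ∈ T)) := by
            rw [mass_pathWeight_ends]; ring
        _ ≤ A ^ (j + 1) * (A * zigDeg T x (j + 1) z / cnt (fun P => P ∈ T)) := by
            rw [zigDeg_mul_zigStep, ← zig_succ]
            have := hT.zig_le ht hlamd (j + 1) x z (f (t + j))
            have := cnt_nonneg fun P => P ∈ T
            gcongr
        _ = _ := by rw [mass_pathWeight_ends]; ring
    · have hS' : S ⊆ Ioo 0 (t + j) := fun i hi => by
        have := mem_Ioo.1 (hS hi)
        have : i ≠ t + j := fun h => hr (h ▸ hi)
        rw [mem_Ioo]; omega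
      rw [mass_succ_ends T j (fun Q => ∀ i ∈ S, pt Q i = f i) x z fun Q v => by
        erw [pt_app_of_le _ _ (Nat.zero_le _), pt_app_last]
        have h2 : (∀ i ∈ S, pt (app Q v) i = f i) ↔ ∀ i ∈ S, pt Q i = f i := by
          refine forall₂_congr fun i hi => ?_
          have := mem_Ioo.1 (hS hi)
          rw [pt_app_of_le _ _ (by omega)]
        erw [h2]
        tauto]
      rw [hstep, sum_mul, mul_sum]
      refine sum_le_sum fun u _ => ?_
      have h1 := ih S hS' x u
      have h2 : mass (pathWeight T j) (fun P => ((∀ i ∈ S, pt P i = f i) ∧ pt P 0 = x) ∧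
          pt P (t + j) = u) = mass (pathWeight T j) (fun P => (pt P 0 = x ∧
          pt P (t + j) = u) ∧ ∀ i ∈ S, pt P i = f i) :=
        mass_congr fun P => by tauto
      have h3 : mass (pathWeight T j) (fun P => (True ∧ pt P 0 = x) ∧ pt P (t + j) = u) =
          mass (pathWeight T j) (fun P => pt P 0 = x ∧ pt P (t + j) = u) :=
        mass_congr fun P => by tauto
      rw [h2, h3]
      have h4 := zigStep_nonneg T x j u z
      have h5 := mass_nonneg (pathWeight_nonneg T j) fun P => pt P 0 = x ∧ pt P (t + j) = u
      calc _ = (mass (pathWeight T j) (fun P => (pt P 0 = x ∧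
          pt P (t + j) = u) ∧ ∀ i ∈ S, pt P i = f i) * lam ^ S.card) * zigStep T x j u z := by ring
        _ ≤ (A ^ (j + 1) * mass (pathWeight T j) (fun P => pt P 0 = x ∧ pt P (t + j) = u)) *
          zigStep T x j u z := by gcongr
        _ ≤ (A ^ (j + 1 + 1) * mass (pathWeight T j) (fun P => pt P 0 = x ∧ pt P (t + j) = u)) *
          zigStep T x j u z := by gcongr
        _ = _ := by ring

/-- The cost of prescribing edges. Each prescribed zigzag step costs a factor `lam`, except for the
first prescribed edge, which is weighted like a last edge of a member of `T`. -/
lemma IsSpreadFamily.pathWeight_edges (hT : IsSpreadFamily H d lam A t T) (ht : 2 ≤ t)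
    (hlamd : lam ≤ d) (hA : 1 ≤ A) (hlam : 0 < lam) (hpos : 0 < cnt (fun P => P ∈ T))
    (f g : ℕ → V) (j : ℕ) :
    ∀ S ⊆ range (t + j), S.Nonempty →
    mass (pathWeight T j) (fun P => ∀ i ∈ S, pt P i = f i ∧ pt P (i + 1) = g i) *
      (Fintype.card V * d * lam ^ (S.card - 1)) ≤ A ^ (j + 1) := by
  have hd : 0 < d := by linarith
  induction j with
  | zero =>
    intro S hS hSne
    rw [mass_pathWeight_zero, div_mul_eq_mul_div, zero_add, pow_one, div_le_iff₀ hpos]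
    exact hT.edges S hS hSne f g
  | succ j ih =>
    intro S hS hSne
    have hA' : A ^ (j + 1) ≤ A ^ (j + 1 + 1) := pow_le_pow_right₀ hA (by omega)
    by_cases hr : t + j ∈ S
    · have hcard : S.card = (S.erase (t + j)).card + 1 := (card_erase_add_one hr).symm
      by_cases hS0 : (S.erase (t + j)).Nonempty
      · have hlt : ∀ i ∈ S.erase (t + j), i < t + j := fun i hi => by
          have := mem_range.1 (hS (mem_of_mem_erase hi))
          have := ne_of_mem_erase hi
          omega
        have h1 := ih (S.erase (t + j)) (fun i hi => mem_range.2 (hlt i hi)) hS0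
        have h2 : mass (pathWeight T (j + 1))
            (fun P => ∀ i ∈ S, pt P i = f i ∧ pt P (i + 1) = g i) ≤ A / lam *
            mass (pathWeight T j)
            (fun P => ∀ i ∈ S.erase (t + j), pt P i = f i ∧ pt P (i + 1) = g i) := by
          refine mass_succ_le_of_determined T j (hT.zigStep_le ht hlamd hA hlam j)
            (fun _ => g (t + j)) fun Q v h => ⟨fun i hi => ?_, ?_⟩
          · have h3 := h i (mem_of_mem_erase hi)
            have := hlt i hi
            rwa [pt_app_of_le _ _ (by omega), pt_app_of_le _ _ (by omega)] at h3
          · have h3 := (h _ hr).2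
            rwa [pt_app_last] at h3
        have h3 : lam ^ (S.card - 1) = lam ^ ((S.erase (t + j)).card - 1) * lam := by
          rw [← pow_succ]
          have := hS0.card_pos
          congr 1; omega
        calc _ ≤ (A / lam * mass (pathWeight T j)
            (fun P => ∀ i ∈ S.erase (t + j), pt P i = f i ∧ pt P (i + 1) = g i)) *
            (Fintype.card V * d * lam ^ (S.card - 1)) := by gcongr
          _ = A * (mass (pathWeight T j)
            (fun P => ∀ i ∈ S.erase (t + j), pt P i = f i ∧ pt P (i + 1) = g i) *
            (Fintype.card V * d * lam ^ ((S.erase (t + j)).card - 1))) := by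
              rw [h3]; field_simp
          _ ≤ A * A ^ (j + 1) := by gcongr
          _ = _ := by ring
      · -- a single edge of the zigzag walk: sum the stationary distributions over all starts
        have hSr : S = {t + j} := by
          rw [not_nonempty_iff_eq_empty] at hS0
          rw [← insert_erase hr, hS0, insert_empty_eq]
        rw [hSr, card_singleton, Nat.sub_self, pow_zero, mul_one]
        have h1 : mass (pathWeight T (j + 1))
            (fun P => ∀ i ∈ ({t + j} : Finset ℕ), pt P i = f i ∧ pt P (i + 1) = g i) =
            ∑ x, zig T x j (f (t + j)) (g (t + j)) / cnt (fun P => P ∈ T) := by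
          rw [← sum_mass_fiber _ (fun P => pt P 0)]
          refine sum_congr rfl fun x _ => ?_
          rw [mass_succ_ends T j (fun Q => pt Q (t + j) = f (t + j)) x (g (t + j)) fun Q v => by
            simp only [mem_singleton, forall_eq]
            rw [pt_app_of_le _ _ (Nat.zero_le _), pt_app_last, pt_app_of_le _ _ le_rfl]
            tauto]
          rw [sum_eq_single (f (t + j)) (fun u _ hu => by
            rw [mass_eq_zero, zero_mul]
            rintro P ⟨⟨h2, _⟩, h3⟩
            exact hu (h3.symm.trans h2)) (fun h => absurd (mem_univ _) h)]
          rw [← zigDeg_mul_zigStep, mul_div_right_comm, ← mass_pathWeight_ends]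
          congr 1
          exact mass_congr fun P => by tauto
        have h2 : ∀ w v : V, ∑ x, lastEdge T x w v =
            cnt (fun P => P ∈ T ∧ ∀ i ∈ ({t - 1} : Finset ℕ), pt P i = w ∧ pt P (i + 1) = v) := by
          intro w v
          rw [← sum_cnt_fiber_one _ (fun P => pt P 0)]
          refine sum_congr rfl fun x _ => ?_
          unfold lastEdge
          congr 1; funext P
          simp only [mem_singleton, forall_eq, eq_iff_iff, Nat.sub_add_cancel (by omega : 1 ≤ t)]
          tauto
        have h3 : ∀ w v : V, (∑ x, lastEdge T x w v) * (Fintype.card V * d) ≤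
            A * cnt (fun P => P ∈ T) := by
          intro w v
          have h4 := hT.edges {t - 1} (by intro i hi; simp at hi ⊢; omega) (by simp)
            (fun _ => w) (fun _ => v)
          rw [h2]
          simpa using h4
        have h5 : (∑ x, zig T x j (f (t + j)) (g (t + j))) * (Fintype.card V * d) ≤
            A * cnt (fun P => P ∈ T) := by
          unfold zig
          split_ifs
          · exact h3 _ _
          · exact h3 _ _
        rw [h1, ← sum_div, div_mul_eq_mul_div]
        calc _ ≤ A := by rwa [div_le_iff₀ hpos]
          _ = A ^ 1 := (pow_one A).symm
          _ ≤ _ := pow_le_pow_right₀ hA (by omega)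
    · have hlt : ∀ i ∈ S, i < t + j := fun i hi => by
        have := mem_range.1 (hS hi)
        have : i ≠ t + j := fun h => hr (h ▸ hi)
        omega
      have h1 := ih S (fun i hi => mem_range.2 (hlt i hi)) hSne
      have h2 : mass (pathWeight T (j + 1))
            (fun P => ∀ i ∈ S, pt P i = f i ∧ pt P (i + 1) = g i) ≤
            mass (pathWeight T j) (fun P => ∀ i ∈ S, pt P i = f i ∧ pt P (i + 1) = g i) := by
        refine mass_succ_le T j fun Q v h i hi => ?_
        have h3 := h i hi
        have := hlt i hi
        rwa [pt_app_of_le _ _ (by omega), pt_app_of_le _ _ (by omega)] at h3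
      calc _ ≤ _ := mul_le_mul_of_nonneg_right h2 (by positivity)
        _ ≤ A ^ (j + 1) := h1
        _ ≤ _ := hA'

lemma IsSpreadFamily.pathWeight_repeats (hT : IsSpreadFamily H d lam A t T) (ht : 2 ≤ t)
    (hlamd : lam ≤ d) (hA : 1 ≤ A) (hlam : 0 < lam) (hpos : 0 < cnt (fun P => P ∈ T)) (j : ℕ) :
    ∀ i i', i < i' → i' ≤ t + j → mass (pathWeight T j) (fun P => pt P i = pt P i') * lam ≤ A := by
  induction j with
  | zero =>
    intro i i' hi hi'
    rw [mass_pathWeight_zero, cnt_eq_zero, zero_div, zero_mul]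
    · linarith
    · rintro P ⟨h1, h2⟩
      exact hT.inj P h1 i i' hi hi' h2
  | succ j ih =>
    intro i i' hi hi'
    by_cases h : i' ≤ t + j
    · refine le_trans (mul_le_mul_of_nonneg_right ?_ hlam.le) (ih i i' hi h)
      refine mass_succ_le T j fun Q v hQ => ?_
      rwa [pt_app_of_le _ _ (by omega), pt_app_of_le _ _ (by omega)] at hQ
    · have h1 : i' = t + j + 1 := by omega
      subst h1
      have h2 := mass_succ_le_of_determined T j (hT.zigStep_le ht hlamd hA hlam j)
        (p := fun P => pt P i = pt P (t + j + 1)) (q := fun _ => True)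
        (fun Q => pt Q i) fun Q v hQ => ⟨trivial, by
          rw [pt_app_of_le _ _ (by omega), pt_app_last] at hQ
          exact hQ.symm⟩
      rw [mass_pathWeight_true T hpos.ne', mul_one] at h2
      exact (le_div_iff₀ hlam).1 h2

lemma IsSpreadFamily.pathWeight_walk (hT : IsSpreadFamily H d lam A t T) (ht : 2 ≤ t) (j : ℕ) :
    ∀ P, pathWeight T j P ≠ 0 → IsWalk H P := by
  have hedge : ∀ x w v, lastEdge T x w v ≠ 0 → H.Adj w v := by
    intro x w v h
    by_contra hn
    apply h
    refine cnt_eq_zero ?_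
    rintro P ⟨h1, _, rfl, rfl⟩
    have := hT.walk P h1 (t - 1) (by omega)
    rw [Nat.sub_add_cancel (by omega)] at this
    exact hn this
  induction j with
  | zero =>
    intro P hP
    unfold pathWeight at hP
    by_cases h : P ∈ T
    · exact hT.walk P h
    · simp [h] at hP
  | succ j ih =>
    intro P hP
    have hP' : P = app (fun i => P (Fin.castSucc i)) (P (Fin.last _)) :=
      (Fin.snoc_init_self (α := fun _ => V) P).symm
    rw [hP'] at hP ⊢
    rw [pathWeight_app] at hP
    have h1 := left_ne_zero_of_mul hP
    have h2 := right_ne_zero_of_mul hP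
    refine (isWalk_app H _ _).2 ⟨ih _ h1, ?_⟩
    unfold zigStep at h2
    have h3 : zig T _ j _ _ ≠ 0 := fun h => h2 (by rw [h, zero_div])
    unfold zig at h3
    split_ifs at h3
    · exact (hedge _ _ _ h3).symm
    · exact hedge _ _ _ h3

/-- Of a step of the zigzag walk and the reversed step, one has about `lam` choices and the other
about `d`. So the weight of a walk and the conditional weight, given its ends, of a second walk have
the product that they have in a random graph, whatever the numbers of choices for each of the steps. -/
lemma IsSpreadFamily.exists_pathWeight_le (hT : IsSpreadFamily H d lam A t T) (ht : 2 ≤ t)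
    (hlamd : lam ≤ d) (hA : 1 ≤ A) (hlam : 0 < lam) (hpos : 0 < cnt (fun P => P ∈ T))
    [Nonempty V] (j : ℕ) :
    ∃ φ ψ : ℝ, 0 ≤ φ ∧ 0 ≤ ψ ∧ (∀ P, pathWeight T j P ≤ φ) ∧
      (∀ P, pathWeight T j P ≤
        ψ * mass (pathWeight T j) (fun Q => pt Q 0 = pt P 0 ∧ pt Q (t + j) = pt P (t + j))) ∧
      φ * ψ * (Fintype.card V * d ^ (t + j) * lam ^ (t + j - 1)) ≤ A ^ (2 * j + 2) := by
  have hd : 0 < d := by linarith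
  have hm : (0 : ℝ) < Fintype.card V := by exact_mod_cast Fintype.card_pos
  set c : ℝ := cnt (fun P => P ∈ T) with hc
  set τ : ℕ → ℝ := fun j => if Even j then A / lam else A / d with hτ
  have hτ0 : ∀ j, 0 ≤ τ j := fun j => by simp only [hτ]; split_ifs <;> positivity
  have hzig : ∀ j x u v, zig T x j u v ≤ τ j * zigDeg T x j u := by
    intro j x u v
    simp only [hτ]
    split_ifs with h
    · rw [div_mul_eq_mul_div, le_div_iff₀ hlam]; exact hT.zig_even_le ht h x u v
    · rw [div_mul_eq_mul_div, le_div_iff₀ hd]; exact hT.zig_odd_le h x u v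
  have hττ : ∀ j, τ j * τ (j + 1) * (lam * d) = A ^ 2 := by
    intro j
    by_cases h : Even j
    · simp only [hτ, h, if_true, Nat.even_add_one, not_true, if_false]; field_simp
    · simp only [hτ, h, if_false, Nat.even_add_one, not_false_iff, if_true]; field_simp
  induction j with
  | zero =>
    have hlarge := hT.large
    rw [← hc] at hlarge
    refine ⟨1 / c, A / lam ^ (t - 1), by positivity, by positivity, fun P => ?_, fun P => ?_, ?_⟩
    · unfold pathWeight
      split_ifs
      · exact le_rfl
      · positivity
    · unfold pathWeight
      by_cases hP : P ∈ T
      · rw [if_pos hP]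
        have h1 := hT.vertices (Ioo 0 t) subset_rfl (pt P 0) (pt P t) (pt P)
        rw [Nat.card_Ioo, Nat.sub_zero] at h1
        have h2 : 1 ≤ cnt (fun P' => P' ∈ T ∧ pt P' 0 = pt P 0 ∧ pt P' t = pt P t ∧
            ∀ i ∈ Ioo 0 t, pt P' i = pt P i) := by
          unfold cnt
          exact_mod_cast card_pos.2 ⟨P, by simp [hP]⟩
        have h3 : lam ^ (t - 1) ≤ A * cnt (fun P' => P' ∈ T ∧ pt P' 0 = pt P 0 ∧ pt P' t = pt P t) := by
          refine le_trans ?_ h1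
          exact le_mul_of_one_le_left (by positivity) h2
        have h4 := mass_pathWeight_zero T (fun P' => pt P' 0 = pt P 0 ∧ pt P' t = pt P t)
        erw [h4]
        rw [← hc, div_mul_div_comm, div_le_div_iff₀ hpos (by positivity)]
        nlinarith
      · rw [if_neg hP]
        exact mul_nonneg (by positivity) (mass_nonneg (pathWeight_nonneg T 0) _)
    · rw [Nat.mul_zero, Nat.zero_add, Nat.add_zero]
      calc 1 / c * (A / lam ^ (t - 1)) * (Fintype.card V * d ^ t * lam ^ (t - 1))
          = A * (Fintype.card V * d ^ t / c) := by field_simp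
        _ ≤ A * A := by
          gcongr
          rwa [div_le_iff₀ hpos]
        _ = A ^ 2 := by ring
  | succ j ih =>
    obtain ⟨φ, ψ, hφ0, hψ0, hφ, hψ, hφψ⟩ := ih
    have hsplit : ∀ P : Fin (t + (j + 1) + 1) → V, ∃ (Q : Fin (t + j + 1) → V) (v : V), P = app Q v :=
      fun P => ⟨fun i => P (Fin.castSucc i), P (Fin.last _),
        (Fin.snoc_init_self (α := fun _ => V) P).symm⟩
    have hstep : ∀ x u v, zigStep T x j u v ≤ τ j := fun x u v =>
      div_le_of_le_mul₀ (zigDeg_nonneg _ _ _ _) (hτ0 j) (hzig j x u v)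
    refine ⟨φ * τ j, ψ * τ (j + 1), mul_nonneg hφ0 (hτ0 _), mul_nonneg hψ0 (hτ0 _), fun P => ?_,
      fun P => ?_, ?_⟩
    · obtain ⟨Q, v, rfl⟩ := hsplit P
      rw [pathWeight_app]
      exact mul_le_mul (hφ Q) (hstep _ _ _) (zigStep_nonneg _ _ _ _ _) hφ0
    · obtain ⟨Q, v, rfl⟩ := hsplit P
      rw [pathWeight_app, mass_pathWeight_ends]
      erw [pt_app_of_le _ _ (Nat.zero_le _), pt_app_last]
      have h1 := hψ Q
      rw [mass_pathWeight_ends, ← hc] at h1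
      rw [← hc]
      have h2 := zigStep_nonneg T (pt Q 0) j (pt Q (t + j)) v
      calc _ ≤ ψ * (zigDeg T (pt Q 0) j (pt Q (t + j)) / c) *
            zigStep T (pt Q 0) j (pt Q (t + j)) v := by gcongr
        _ = ψ * (zigDeg T (pt Q 0) j (pt Q (t + j)) * zigStep T (pt Q 0) j (pt Q (t + j)) v / c) := by
            ring
        _ ≤ ψ * (τ (j + 1) * zigDeg T (pt Q 0) (j + 1) v / c) := by
            rw [zigDeg_mul_zigStep, ← zig_succ]
            have := hzig (j + 1) (pt Q 0) v (pt Q (t + j))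
            gcongr
        _ = _ := by ring
    · have h1 : lam ^ (t + (j + 1) - 1) = lam ^ (t + j - 1) * lam := by
        rw [← pow_succ]; congr 1; omega
      calc φ * τ j * (ψ * τ (j + 1)) * (Fintype.card V * d ^ (t + (j + 1)) * lam ^ (t + (j + 1) - 1))
          = (φ * ψ * (Fintype.card V * d ^ (t + j) * lam ^ (t + j - 1))) *
            (τ j * τ (j + 1) * (lam * d)) := by rw [h1, ← add_assoc, pow_succ]; ring
        _ ≤ A ^ (2 * j + 2) * A ^ 2 := by
            rw [hττ]; gcongr
        _ = _ := by ring

/-- The measure of random zigzag extensions of a spread family. -/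
lemma IsSpreadFamily.exists_isPathMeasure [Nonempty V] (hT : IsSpreadFamily H d lam A t T)
    (ht : 2 ≤ t) (hlamd : lam ≤ d) (hA : 1 ≤ A) (hlam : 0 < lam) {b : ℕ} (htb : t ≤ b) :
    ∃ F : (Fin (b + 1) → V) → ℝ, IsPathMeasure H d lam (A ^ (2 * b)) b F := by
  have hd : 0 < d := by linarith
  have hm : (0 : ℝ) < Fintype.card V := by exact_mod_cast Fintype.card_pos
  have hpos : 0 < cnt (fun P => P ∈ T) := by
    have h1 : 0 < (Fintype.card V : ℝ) * d ^ t := by positivity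
    have h2 := hT.large
    by_contra h
    nlinarith [cnt_nonneg (fun P => P ∈ T)]
  obtain ⟨j, rfl⟩ := Nat.exists_eq_add_of_le htb
  have hA1 : A ^ (j + 1) ≤ A ^ (2 * (t + j)) := pow_le_pow_right₀ hA (by omega)
  have hA2 : A ≤ A ^ (2 * (t + j)) := le_self_pow₀ hA (by omega)
  have hnn := pathWeight_nonneg T j
  refine ⟨pathWeight T j, hnn, mass_pathWeight_true T hpos.ne' j, hT.pathWeight_walk ht j,
    fun S hS x z f => ?_, fun S hS hSne f g => ?_, fun i i' hi hi' => ?_, fun P P' h0 hb => ?_⟩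
  · refine (hT.pathWeight_vertices ht hlamd hA hlam f j S hS x z).trans ?_
    exact mul_le_mul_of_nonneg_right hA1 (mass_nonneg hnn _)
  · exact (hT.pathWeight_edges ht hlamd hA hlam hpos f g j S hS hSne).trans hA1
  · exact (hT.pathWeight_repeats ht hlamd hA hlam hpos j i i' hi hi').trans hA2
  · obtain ⟨φ, ψ, hφ0, hψ0, hφ, hψ, hφψ⟩ := hT.exists_pathWeight_le ht hlamd hA hlam hpos j
    have h1 := hψ P'
    rw [h0, hb] at h1
    have h2 := mass_nonneg hnn fun Q => pt Q 0 = pt P 0 ∧ pt Q (t + j) = pt P (t + j)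
    have h3 : A ^ (2 * j + 2) ≤ A ^ (2 * (t + j)) := pow_le_pow_right₀ hA (by omega)
    calc _ ≤ φ * (ψ * mass (pathWeight T j) fun Q => pt Q 0 = pt P 0 ∧ pt Q (t + j) = pt P (t + j)) *
          (Fintype.card V * d ^ (t + j) * lam ^ (t + j - 1)) := by
          have := mul_le_mul (hφ P) h1 (hnn P') hφ0
          gcongr
      _ = (φ * ψ * (Fintype.card V * d ^ (t + j) * lam ^ (t + j - 1))) *
          mass (pathWeight T j) (fun Q => pt Q 0 = pt P 0 ∧ pt Q (t + j) = pt P (t + j)) := by ring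
      _ ≤ _ := mul_le_mul_of_nonneg_right (hφψ.trans h3) h2

end

/-! ### A spread measure on theta graphs -/

/-- The walks `P i` are internally disjoint paths in `H` with the same two ends. -/
structure IsTheta {V : Type*} (H : SimpleGraph V) (a b : ℕ) (P : Fin a → Fin (b + 1) → V) :
    Prop where
  walk : ∀ i, IsWalk H (P i)
  start : ∀ i i', pt (P i) 0 = pt (P i') 0
  finish : ∀ i i', pt (P i) b = pt (P i') b
  inj : ∀ i, ∀ j j', j < j' → j' ≤ b → pt (P i) j ≠ pt (P i) j'
  disj : ∀ i i', i ≠ i' → ∀ j ∈ Ioo 0 b, ∀ j' ∈ Ioo 0 b, pt (P i) j ≠ pt (P i') j'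

/-- The edges of a family of walks. -/
noncomputable def walkEdges {V : Type*} {a b : ℕ} (P : Fin a → Fin (b + 1) → V) :
    Finset (Sym2 V) :=
  univ.image fun ij : Fin a × Fin b => s(pt (P ij.1) ij.2, pt (P ij.1) (ij.2 + 1))

lemma card_walkEdges_le {V : Type*} {a b : ℕ} (P : Fin a → Fin (b + 1) → V) :
    (walkEdges P).card ≤ a * b := by
  refine card_image_le.trans ?_
  simp

section
variable {V : Type*} [Fintype V] {a b : ℕ} (F : (Fin (b + 1) → V) → ℝ)

/-- The weight `F`, conditioned on the ends `x` and `z`. -/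
noncomputable def condWeight (x z : V) (P : Fin (b + 1) → V) : ℝ :=
  if pt P 0 = x ∧ pt P b = z then F P / mass F (fun Q => pt Q 0 = x ∧ pt Q b = z) else 0

/-- The distribution of `a` walks with the same ends: the ends are distributed as those of a walk
drawn from `F`, and given the ends the `a` walks are independent. -/
noncomputable def thetaWeight (P : Fin a → Fin (b + 1) → V) : ℝ :=
  ∑ x, ∑ z, mass F (fun Q => pt Q 0 = x ∧ pt Q b = z) * ∏ i, condWeight F x z (P i)

/-- The total `thetaWeight` of the families of walks with property `p`. -/
noncomputable def thetaMass (p : (Fin a → Fin (b + 1) → V) → Prop) : ℝ :=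
  ∑ P, if p P then thetaWeight F P else 0

variable {F}

lemma condWeight_nonneg (hF : ∀ P, 0 ≤ F P) (x z : V) (P : Fin (b + 1) → V) :
    0 ≤ condWeight F x z P := by
  unfold condWeight
  split_ifs
  · exact div_nonneg (hF P) (mass_nonneg hF _)
  · exact le_rfl

lemma thetaWeight_nonneg (hF : ∀ P, 0 ≤ F P) (P : Fin a → Fin (b + 1) → V) :
    0 ≤ thetaWeight F P :=
  sum_nonneg fun x _ => sum_nonneg fun z _ => mul_nonneg (mass_nonneg hF _)
    (prod_nonneg fun i _ => condWeight_nonneg hF x z (P i))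

lemma mass_condWeight (x z : V) (p : (Fin (b + 1) → V) → Prop) :
    mass (condWeight F x z) p = mass F (fun Q => (pt Q 0 = x ∧ pt Q b = z) ∧ p Q) /
      mass F (fun Q => pt Q 0 = x ∧ pt Q b = z) := by
  conv_lhs => unfold mass condWeight
  conv_rhs => enter [1]; unfold mass
  rw [sum_div]
  refine sum_congr rfl fun P _ => ?_
  by_cases h1 : p P <;> by_cases h2 : pt P 0 = x ∧ pt P b = z <;> simp [h1, h2]

lemma mass_condWeight_le_one (hF : ∀ P, 0 ≤ F P) (x z : V) (p : (Fin (b + 1) → V) → Prop) :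
    mass (condWeight F x z) p ≤ 1 := by
  rw [mass_condWeight]
  exact div_le_one_of_le₀ (mass_mono hF fun P hP => hP.1) (mass_nonneg hF _)

lemma mass_mul_mass_condWeight (hF : ∀ P, 0 ≤ F P) (x z : V) (p : (Fin (b + 1) → V) → Prop) :
    mass F (fun Q => pt Q 0 = x ∧ pt Q b = z) * mass (condWeight F x z) p =
      mass F (fun Q => (pt Q 0 = x ∧ pt Q b = z) ∧ p Q) := by
  rw [mass_condWeight]
  by_cases h : mass F (fun Q => pt Q 0 = x ∧ pt Q b = z) = 0
  · have h1 := mass_mono hF (p := fun Q => (pt Q 0 = x ∧ pt Q b = z) ∧ p Q)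
      (q := fun Q => pt Q 0 = x ∧ pt Q b = z) fun P hP => hP.1
    have h2 := mass_nonneg hF (fun Q => (pt Q 0 = x ∧ pt Q b = z) ∧ p Q)
    rw [h] at h1 ⊢
    rw [zero_mul]; linarith
  · field_simp

lemma sum_mass_ends (p : (Fin (b + 1) → V) → Prop) :
    ∑ x, ∑ z, mass F (fun Q => (pt Q 0 = x ∧ pt Q b = z) ∧ p Q) = mass F p := by
  rw [← sum_mass_fiber p (fun Q => pt Q 0)]
  refine sum_congr rfl fun x _ => ?_
  rw [← sum_mass_fiber _ (fun Q => pt Q b)]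
  refine sum_congr rfl fun z _ => mass_congr fun Q => by tauto

lemma thetaMass_forall (p : Fin a → (Fin (b + 1) → V) → Prop) :
    thetaMass F (fun P : Fin a → Fin (b + 1) → V => ∀ i, p i (P i)) =
      ∑ x, ∑ z, mass F (fun Q => pt Q 0 = x ∧ pt Q b = z) *
        ∏ i, mass (condWeight F x z) (p i) := by
  unfold thetaMass thetaWeight
  have h1 : ∀ x z, ∏ i, mass (condWeight F x z) (p i) =
      ∑ P : Fin a → Fin (b + 1) → V, if (∀ i, p i (P i)) then ∏ i, condWeight F x z (P i) else 0 := by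
    intro x z
    unfold mass
    rw [prod_univ_sum, Fintype.piFinset_univ]
    refine sum_congr rfl fun P _ => ?_
    split_ifs with h
    · exact prod_congr rfl fun i _ => if_pos (h i)
    · obtain ⟨i, hi⟩ := not_forall.1 h
      exact prod_eq_zero (mem_univ i) (if_neg hi)
  simp only [h1, mul_sum]
  calc _ = ∑ P : Fin a → Fin (b + 1) → V, ∑ x, ∑ z, mass F (fun Q => pt Q 0 = x ∧ pt Q b = z) *
        (if (∀ i, p i (P i)) then ∏ i, condWeight F x z (P i) else 0) := by
        refine sum_congr rfl fun P _ => ?_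
        split_ifs <;> simp
    _ = _ := by
        rw [sum_comm]
        refine sum_congr rfl fun x _ => ?_
        rw [sum_comm]

lemma thetaMass_mono (hF : ∀ P, 0 ≤ F P) {p q : (Fin a → Fin (b + 1) → V) → Prop}
    (h : ∀ P, thetaWeight F P ≠ 0 → p P → q P) : thetaMass F p ≤ thetaMass F q := by
  refine sum_le_sum fun P _ => ?_
  by_cases h0 : thetaWeight F P = 0
  · simp [h0]
  by_cases h1 : p P
  · simp [h1, h P h0 h1]
  · simp only [h1, if_false]
    split_ifs <;> simp [thetaWeight_nonneg hF]

lemma thetaMass_nonneg (hF : ∀ P, 0 ≤ F P) (p : (Fin a → Fin (b + 1) → V) → Prop) :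
    0 ≤ thetaMass F p :=
  sum_nonneg fun P _ => by split_ifs <;> simp [thetaWeight_nonneg hF]

lemma thetaMass_le_sum (hF : ∀ P, 0 ≤ F P) {ι : Type*} (I : Finset ι)
    {p : (Fin a → Fin (b + 1) → V) → Prop} {q : ι → (Fin a → Fin (b + 1) → V) → Prop}
    (h : ∀ P, p P → ∃ i ∈ I, q i P) : thetaMass F p ≤ ∑ i ∈ I, thetaMass F (q i) := by
  unfold thetaMass
  rw [sum_comm]
  refine sum_le_sum fun P _ => ?_
  have hnn : ∀ i ∈ I, (0 : ℝ) ≤ if q i P then thetaWeight F P else 0 := fun i _ => by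
    split_ifs <;> simp [thetaWeight_nonneg hF]
  by_cases h1 : p P
  · obtain ⟨i, hi, hq⟩ := h P h1
    have h2 := single_le_sum hnn hi
    simp only [hq, if_true] at h2
    simp only [h1, if_true]
    exact h2
  · simp only [h1, if_false]
    exact sum_nonneg hnn

/-- Prescribe one walk absolutely and the other walks conditionally on the ends. -/
lemma thetaMass_forall_le (hF : ∀ P, 0 ≤ F P) (p : Fin a → (Fin (b + 1) → V) → Prop) (i₀ : Fin a)
    (c : Fin a → ℝ) (hc : ∀ i ≠ i₀, ∀ x z, mass (condWeight F x z) (p i) ≤ c i) :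
    thetaMass F (fun P : Fin a → Fin (b + 1) → V => ∀ i, p i (P i)) ≤
      mass F (p i₀) * ∏ i ∈ univ.erase i₀, c i := by
  rw [thetaMass_forall, ← sum_mass_ends (p i₀), sum_mul]
  refine sum_le_sum fun x _ => ?_
  rw [sum_mul]
  refine sum_le_sum fun z _ => ?_
  rw [← mul_prod_erase univ _ (mem_univ i₀), ← mul_assoc, mass_mul_mass_condWeight hF]
  refine mul_le_mul_of_nonneg_left ?_ (mass_nonneg hF _)
  exact prod_le_prod (fun i _ => mass_nonneg (condWeight_nonneg hF x z) _)
    fun i hi => hc i (ne_of_mem_erase hi) x z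

lemma thetaMass_one_le (hF : ∀ P, 0 ≤ F P) (p : (Fin (b + 1) → V) → Prop) (i₀ : Fin a) :
    thetaMass F (fun P : Fin a → Fin (b + 1) → V => p (P i₀)) ≤ mass F p := by
  have h1 := thetaMass_forall_le hF (fun i => if i = i₀ then p else fun _ => True) i₀ (fun _ => 1)
    fun i _ x z => mass_condWeight_le_one hF x z _
  simp only [if_true, prod_const_one, mul_one] at h1
  refine le_trans (thetaMass_mono hF fun P _ hP i => ?_) h1
  split_ifs with h
  · rw [h]; exact hP
  · trivial

lemma thetaMass_true (htot : mass F (fun _ => True) = 1) :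
    thetaMass F (fun _ : Fin a → Fin (b + 1) → V => True) = 1 := by
  have h1 := thetaMass_forall (F := F) (a := a) fun _ _ => True
  have h2 : thetaMass F (fun _ : Fin a → Fin (b + 1) → V => True) =
      thetaMass F (fun _ : Fin a → Fin (b + 1) → V => ∀ _ : Fin a, True) := by simp
  rw [h2, h1, ← htot, ← sum_mass_ends (fun _ => True)]
  refine sum_congr rfl fun x _ => sum_congr rfl fun z _ => ?_
  have h3 : mass F (fun Q => (pt Q 0 = x ∧ pt Q b = z) ∧ True) =
      mass F (fun Q => pt Q 0 = x ∧ pt Q b = z) := mass_congr fun Q => by simp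
  rw [mass_condWeight, h3]
  by_cases h : mass F (fun Q => pt Q 0 = x ∧ pt Q b = z) = 0
  · rw [h, zero_mul]
  · rw [div_self h]; simp

lemma mem_of_thetaWeight_ne_zero {P : Fin a → Fin (b + 1) → V} (h : thetaWeight F P ≠ 0) :
    ∃ x z, ∀ i, F (P i) ≠ 0 ∧ pt (P i) 0 = x ∧ pt (P i) b = z := by
  obtain ⟨x, _, hx⟩ := exists_ne_zero_of_sum_ne_zero h
  obtain ⟨z, _, hz⟩ := exists_ne_zero_of_sum_ne_zero hx
  refine ⟨x, z, fun i => ?_⟩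
  have h1 := (prod_ne_zero_iff.1 (right_ne_zero_of_mul hz)) i (mem_univ i)
  unfold condWeight at h1
  split_ifs at h1 with h2
  · exact ⟨fun h3 => h1 (by rw [h3, zero_div]), h2⟩
  · exact absurd rfl h1

variable {H : SimpleGraph V} {d lam A : ℝ}

lemma IsPathMeasure.cond_vertices (hF : IsPathMeasure H d lam A b F) (hlam : 0 < lam) (hA : 0 ≤ A)
    {S : Finset ℕ} (hS : S ⊆ Ioo 0 b) (x z : V) (f : ℕ → V) :
    mass (condWeight F x z) (fun P => ∀ i ∈ S, pt P i = f i) ≤ A / lam ^ S.card := by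
  rw [mass_condWeight]
  have h1 := hF.vertices S hS x z f
  refine div_le_of_le_mul₀ (mass_nonneg hF.nonneg _) (by positivity) ?_
  rw [div_mul_eq_mul_div, le_div_iff₀ (by positivity)]
  exact h1

/-- Prescribing `s` edges of a walk with given ends prescribes at least `min s (b - 1)` internal
vertices. -/
lemma IsPathMeasure.cond_edges (hF : IsPathMeasure H d lam A b F) (hlam : 0 < lam) (hA : 0 ≤ A)
    (hb : 1 ≤ b) {S : Finset ℕ} (hS : S ⊆ range b) (x z : V) (f g : ℕ → V) :
    mass (condWeight F x z) (fun P => ∀ i ∈ S, pt P i = f i ∧ pt P (i + 1) = g i) ≤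
      A / lam ^ (min S.card (b - 1)) := by
  -- orient the prescribed edges away from an edge `j₀` that is not prescribed
  obtain ⟨S', j₀, hS'S, hj₀b, hj₀, hcard⟩ : ∃ (S' : Finset ℕ) (j₀ : ℕ), S' ⊆ S ∧ j₀ < b ∧ j₀ ∉ S' ∧
      S'.card = min S.card (b - 1) := by
    by_cases h : ∃ j₀ ∈ range b, j₀ ∉ S
    · obtain ⟨j₀, hj₀, hj₀S⟩ := h
      refine ⟨S, j₀, subset_rfl, mem_range.1 hj₀, hj₀S, ?_⟩
      have h1 : S ⊂ range b := ⟨hS, fun h2 => hj₀S (h2 hj₀)⟩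
      have h2 := card_lt_card h1
      rw [card_range] at h2
      omega
    · push Not at h
      have h1 : S = range b := subset_antisymm hS h
      refine ⟨S.erase (b - 1), b - 1, erase_subset _ _, by omega, by simp, ?_⟩
      rw [card_erase_of_mem (h _ (by simp; omega)), h1, card_range]
      omega
  set e : ℕ → ℕ := fun j => if j < j₀ then j + 1 else j with he
  have hne : ∀ j ∈ S', j ≠ j₀ := fun j hj h => hj₀ (h ▸ hj)
  have hinj : Set.InjOn e S' := by
    intro j hj j' hj' h
    have h1 := hne j hj
    have h2 := hne j' hj'
    simp only [he] at h
    split_ifs at h <;> omega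
  set f' : ℕ → V := fun v => if v ≤ j₀ then g (v - 1) else f v with hf'
  have h1 := hF.cond_vertices hlam hA (S := S'.image e) (fun v hv => by
    obtain ⟨j, hj, rfl⟩ := mem_image.1 hv
    have h1 := hne j hj
    have h2 := mem_range.1 (hS (hS'S hj))
    simp only [he, mem_Ioo]
    split_ifs <;> omega) x z f'
  rw [card_image_of_injOn hinj, hcard] at h1
  refine le_trans (mass_mono (condWeight_nonneg hF.nonneg x z) fun P hP v hv => ?_) h1
  obtain ⟨j, hj, rfl⟩ := mem_image.1 hv
  have h2 := hP j (hS'S hj)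
  have h3 := hne j hj
  simp only [he, hf']
  split_ifs with h4 h5 h5
  · rw [Nat.add_sub_cancel]; exact h2.2
  · omega
  · omega
  · exact h2.1

/-- The cost of prescribing edges of the walks of a theta graph. The exponent `E` is a lower bound for
the number of factors `lam`; it is smallest relative to the number of edges when complete paths are
prescribed. -/
lemma IsPathMeasure.thetaMass_edges (hF : IsPathMeasure H d lam A b F) (hlam : 1 ≤ lam) (hA : 1 ≤ A)
    (hd : 0 < d) (hV : 0 < Fintype.card V) (hb : 1 ≤ b) {S : Fin a → Finset ℕ}
    (hS : ∀ i, S i ⊆ range b) (hSne : ∃ i, (S i).Nonempty) (f g : Fin a → ℕ → V) :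
    ∃ E : ℕ, a * (b - 1) * ((∑ i, (S i).card) - 1) ≤ E * (a * b - 1) ∧
      thetaMass F (fun P : Fin a → Fin (b + 1) → V =>
        ∀ i, ∀ j ∈ S i, pt (P i) j = f i j ∧ pt (P i) (j + 1) = g i j) ≤
        A ^ a / (Fintype.card V * d * lam ^ E) := by
  obtain ⟨i₁, hi₁⟩ := hSne
  obtain ⟨i₀, -, hmax⟩ := exists_max_image univ (fun i => (S i).card) ⟨i₁, mem_univ i₁⟩
  have hi₀ : 1 ≤ (S i₀).card := le_trans hi₁.card_pos (hmax i₁ (mem_univ _))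
  have hcb : ∀ i, (S i).card ≤ b := fun i => by simpa using card_le_card (hS i)
  set s := ∑ i, (S i).card with hs
  set E' := ∑ i ∈ univ.erase i₀, min (S i).card (b - 1) with hE'
  have hsE : s = (S i₀).card + ∑ i ∈ univ.erase i₀, (S i).card :=
    (add_sum_erase univ (fun i => (S i).card) (mem_univ i₀)).symm
  have hsab : s ≤ a * b := by
    calc s ≤ ∑ _i : Fin a, b := sum_le_sum fun i _ => hcb i
      _ = a * b := by simp
  refine ⟨(S i₀).card - 1 + E', ?_, ?_⟩
  · by_cases hfull : (S i₀).card = b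
    · have h1 : (∑ i ∈ univ.erase i₀, (S i).card) * (b - 1) ≤ E' * b := by
        rw [hE', sum_mul, sum_mul]
        refine sum_le_sum fun i _ => ?_
        have := hcb i
        rcases le_or_gt (S i).card (b - 1) with h | h
        · rw [min_eq_left h]; gcongr; omega
        · rw [min_eq_right h.le, mul_comm (b - 1)]; gcongr
      obtain ⟨c, rfl⟩ : ∃ c, b = c + 1 := ⟨b - 1, by omega⟩
      rw [hfull] at hsE ⊢
      simp only [Nat.add_sub_cancel] at h1 ⊢
      have h2 : c * s ≤ (c + E') * (c + 1) := by
        rw [hsE]; nlinarith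
      have hs1 : 1 ≤ s := by omega
      obtain ⟨s', hs'⟩ : ∃ s', s = s' + 1 := ⟨s - 1, by omega⟩
      rw [hs'] at h2 hsab ⊢
      obtain ⟨N, hN⟩ : ∃ N, a * (c + 1) = N + 1 := ⟨a * (c + 1) - 1, by omega⟩
      rw [hN] at hsab ⊢
      simp only [Nat.add_sub_cancel]
      -- multiply the claim by `c + 1` and use `s ≤ a * b`
      have h3 : (c + 1) * (a * c * s') ≤ (c + 1) * ((c + E') * N) := by
        calc (c + 1) * (a * c * s') = c * (s' * (a * (c + 1))) := by ring
          _ = c * (s' * N + s') := by rw [hN]; ring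
          _ ≤ c * (s' * N + N) := by gcongr; omega
          _ = c * (s' + 1) * N := by ring
          _ ≤ (c + E') * (c + 1) * N := by gcongr
          _ = _ := by ring
      exact le_of_mul_le_mul_left h3 (by omega)
    · have h1 : E' = ∑ i ∈ univ.erase i₀, (S i).card := by
        refine sum_congr rfl fun i _ => ?_
        have h2 := hmax i (mem_univ i)
        have h3 := hcb i₀
        have h4 : (S i).card ≤ (S i₀).card := h2
        omega
      have h2 : (S i₀).card - 1 + E' = s - 1 := by omega
      rw [h2, mul_comm]
      have h3 : a * (b - 1) ≤ a * b - 1 := by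
        have : 0 < a := by rcases Nat.eq_zero_or_pos a with rfl | h; exact i₀.elim0; exact h
        rw [Nat.mul_sub, mul_one]; omega
      gcongr
  · have h1 := thetaMass_forall_le hF.nonneg
      (fun i P => ∀ j ∈ S i, pt P j = f i j ∧ pt P (j + 1) = g i j) i₀
      (fun i => A / lam ^ (min (S i).card (b - 1)))
      fun i _ x z => hF.cond_edges (by linarith) (by linarith) hb (hS i) x z (f i) (g i)
    refine h1.trans ?_
    have h2 := hF.edges (S i₀) (hS i₀) (card_pos.1 hi₀) (f i₀) (g i₀)
    have hm : (0 : ℝ) < Fintype.card V := by exact_mod_cast hV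
    have h3 : mass F (fun P => ∀ j ∈ S i₀, pt P j = f i₀ j ∧ pt P (j + 1) = g i₀ j) ≤
        A / (Fintype.card V * d * lam ^ ((S i₀).card - 1)) := by
      rw [le_div_iff₀ (by positivity)]; exact h2
    rw [prod_div_distrib, prod_const, card_erase_of_mem (mem_univ i₀), card_univ, Fintype.card_fin,
      prod_pow_eq_pow_sum]
    calc _ ≤ A / (Fintype.card V * d * lam ^ ((S i₀).card - 1)) * (A ^ (a - 1) / lam ^ E') := by
          gcongr
      _ = (A ^ (a - 1) * A) / (Fintype.card V * d * (lam ^ ((S i₀).card - 1) * lam ^ E')) := by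
          field_simp
      _ = _ := by
          rw [← pow_add, ← pow_succ]
          congr 2
          have := i₀.pos
          omega

/-- The weight of a single family of walks: two of the walks are bounded as a pair, and each of the
others, given the ends, costs a factor `lam` for each inner vertex. -/
lemma IsPathMeasure.thetaWeight_le (hF : IsPathMeasure H d lam A b F) (hlam : 1 ≤ lam) (hA : 1 ≤ A)
    (hd : 0 < d) (hV : 0 < Fintype.card V) (ha : 2 ≤ a) (P : Fin a → Fin (b + 1) → V) :
    thetaWeight F P ≤ A ^ a / (Fintype.card V * d ^ b * lam ^ ((a - 1) * (b - 1))) := by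
  have hm : (0 : ℝ) < Fintype.card V := by exact_mod_cast hV
  by_cases h0 : thetaWeight F P = 0
  · rw [h0]; positivity
  obtain ⟨x, z, hP⟩ := mem_of_thetaWeight_ne_zero h0
  set W : ℝ := mass F (fun Q => pt Q 0 = x ∧ pt Q b = z) with hW
  set i₀ : Fin a := ⟨0, by omega⟩ with hi₀
  set i₁ : Fin a := ⟨1, by omega⟩ with hi₁
  have hne : i₁ ≠ i₀ := by simp [hi₀, hi₁]
  have hnn := hF.nonneg
  have h1 : thetaWeight F P = W * ∏ i, condWeight F x z (P i) := by
    unfold thetaWeight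
    rw [sum_eq_single x, sum_eq_single z]
    · intro z' _ hz'
      rw [prod_eq_zero (mem_univ i₀), mul_zero]
      unfold condWeight
      rw [if_neg fun h => hz' (h.2.symm.trans (hP i₀).2.2)]
    · simp
    · intro x' _ hx'
      refine sum_eq_zero fun z' _ => ?_
      rw [prod_eq_zero (mem_univ i₀), mul_zero]
      unfold condWeight
      rw [if_neg fun h => hx' (h.1.symm.trans (hP i₀).2.1)]
    · simp
  have hWpos : 0 < W := by
    have h2 := le_mass hnn (p := fun Q => pt Q 0 = x ∧ pt Q b = z) (hP i₀).2
    exact lt_of_lt_of_le (lt_of_le_of_ne (hnn _) (Ne.symm (hP i₀).1)) h2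
  have hcond : ∀ i, condWeight F x z (P i) = F (P i) / W := fun i => if_pos (hP i).2
  have hg : ∀ i, condWeight F x z (P i) ≤ A / lam ^ (b - 1) := by
    intro i
    have h2 := hF.cond_vertices (by linarith) (by linarith) (subset_refl (Ioo 0 b)) x z (pt (P i))
    rw [Nat.card_Ioo, Nat.sub_zero] at h2
    exact (le_mass (condWeight_nonneg hnn x z) (p := fun Q => ∀ j ∈ Ioo 0 b, pt Q j = pt (P i) j)
      fun _ _ => rfl).trans h2
  have hpair : W * (condWeight F x z (P i₀) * condWeight F x z (P i₁)) ≤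
      A / (Fintype.card V * d ^ b * lam ^ (b - 1)) := by
    have h2 := hF.pair (P i₀) (P i₁) ((hP i₁).2.1.trans (hP i₀).2.1.symm)
      ((hP i₁).2.2.trans (hP i₀).2.2.symm)
    rw [(hP i₀).2.1, (hP i₀).2.2, ← hW] at h2
    rw [hcond, hcond, le_div_iff₀ (by positivity)]
    calc _ = (F (P i₀) * F (P i₁) * (Fintype.card V * d ^ b * lam ^ (b - 1))) / W := by
          field_simp
      _ ≤ A := by rwa [div_le_iff₀ hWpos]
  rw [h1, ← mul_prod_erase univ _ (mem_univ i₀),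
    ← mul_prod_erase (univ.erase i₀) _ (mem_erase.2 ⟨hne, mem_univ i₁⟩)]
  have hcard : ((univ.erase i₀).erase i₁ : Finset (Fin a)).card = a - 2 := by
    rw [card_erase_of_mem (mem_erase.2 ⟨hne, mem_univ i₁⟩), card_erase_of_mem (mem_univ i₀),
      card_univ, Fintype.card_fin]
    omega
  have hprod : ∏ i ∈ (univ.erase i₀).erase i₁, condWeight F x z (P i) ≤
      (A / lam ^ (b - 1)) ^ (a - 2) := by
    rw [← hcard, ← prod_const]
    exact prod_le_prod (fun i _ => condWeight_nonneg hnn x z _) fun i _ => hg i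
  calc _ = (W * (condWeight F x z (P i₀) * condWeight F x z (P i₁))) *
        ∏ i ∈ (univ.erase i₀).erase i₁, condWeight F x z (P i) := by ring
    _ ≤ A / (Fintype.card V * d ^ b * lam ^ (b - 1)) * (A / lam ^ (b - 1)) ^ (a - 2) := by
        refine mul_le_mul hpair hprod (prod_nonneg fun i _ => condWeight_nonneg hnn x z _)
          (by positivity)
    _ = A ^ (a - 2 + 1) / (Fintype.card V * d ^ b * lam ^ ((b - 1) * (a - 2 + 1))) := by
        rw [div_pow, ← pow_mul, div_mul_div_comm, ← pow_succ', mul_assoc (_ * _), ← pow_add,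
          mul_add (b - 1), mul_one, add_comm (b - 1)]
    _ ≤ _ := by
        have h2 : a - 2 + 1 = a - 1 := by omega
        rw [h2, mul_comm (b - 1)]
        have : A ^ (a - 1) ≤ A ^ a := pow_le_pow_right₀ hA (by omega)
        gcongr

/-- If `lam` is large, most families of walks with common ends form theta graphs. Otherwise a walk
visits a vertex twice, or an inner vertex of a walk lies on another walk, and each of these boundedly
many coincidences has mass `O(1 / lam)`. -/
lemma IsPathMeasure.half_le_thetaMass (hF : IsPathMeasure H d lam A b F) (hA : 0 ≤ A)
    (hlam : 4 * a ^ 2 * (b + 1) ^ 2 * A ≤ lam) (hlam0 : 0 < lam) :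
    1 / 2 ≤ thetaMass F (fun P : Fin a → Fin (b + 1) → V => IsTheta H a b P) := by
  have hnn := hF.nonneg
  set J : Finset (Fin a × Fin a × ℕ × ℕ) := univ ×ˢ univ ×ˢ range (b + 1) ×ˢ range (b + 1) with hJ
  have hJcard : (J.card : ℝ) = a ^ 2 * (b + 1) ^ 2 := by
    rw [hJ, card_product, card_product, card_product]
    simp; ring
  obtain ⟨q₁, hq₁⟩ : ∃ q₁ : Fin a × Fin a × ℕ × ℕ → (Fin a → Fin (b + 1) → V) → Prop,
      ∀ c P, q₁ c P ↔ (c.2.2.1 < c.2.2.2 ∧ c.2.2.2 ≤ b) ∧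
        pt (P c.1) c.2.2.1 = pt (P c.1) c.2.2.2 := ⟨_, fun _ _ => Iff.rfl⟩
  obtain ⟨q₂, hq₂⟩ : ∃ q₂ : Fin a × Fin a × ℕ × ℕ → (Fin a → Fin (b + 1) → V) → Prop,
      ∀ c P, q₂ c P ↔ (c.1 ≠ c.2.1 ∧ c.2.2.1 ∈ Ioo 0 b) ∧
        pt (P c.1) c.2.2.1 = pt (P c.2.1) c.2.2.2 := ⟨_, fun _ _ => Iff.rfl⟩
  have h1 : ∀ c, thetaMass F (q₁ c) ≤ A / lam := by
    intro c
    by_cases hc : c.2.2.1 < c.2.2.2 ∧ c.2.2.2 ≤ b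
    · calc thetaMass F (q₁ c) ≤ thetaMass F (fun P : Fin a → Fin (b + 1) → V =>
            (fun Q => pt Q c.2.2.1 = pt Q c.2.2.2) (P c.1)) :=
          thetaMass_mono hnn fun P _ hP => ((hq₁ c P).1 hP).2
        _ ≤ mass F (fun Q => pt Q c.2.2.1 = pt Q c.2.2.2) := 
            thetaMass_one_le hnn (fun Q => pt Q c.2.2.1 = pt Q c.2.2.2) c.1
        _ ≤ A / lam := by
          rw [le_div_iff₀ hlam0]; exact hF.repeats _ _ hc.1 hc.2
    · have : thetaMass F (q₁ c) = 0 :=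
        sum_eq_zero fun P _ => if_neg fun h => hc ((hq₁ c P).1 h).1
      rw [this]; positivity
  have h2 : ∀ c, thetaMass F (q₂ c) ≤ A / lam := by
    intro c
    by_cases hc : c.1 ≠ c.2.1 ∧ c.2.2.1 ∈ Ioo 0 b
    · set p : V → Fin a → (Fin (b + 1) → V) → Prop := fun v i Q =>
        (i = c.1 → pt Q c.2.2.1 = v) ∧ (i = c.2.1 → pt Q c.2.2.2 = v) with hp
      have h3 : ∀ v, thetaMass F (fun P : Fin a → Fin (b + 1) → V => ∀ i, p v i (P i)) ≤
          mass F (fun Q => True ∧ pt Q c.2.2.2 = v) * (A / lam) := by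
        intro v
        have h4 := thetaMass_forall_le hnn (p v) c.2.1 (fun i => if i = c.1 then A / lam else 1)
          (fun i _ x z => by
            split_ifs with hi
            · have h5 := hF.cond_vertices hlam0 hA (S := {c.2.2.1}) (by simpa using hc.2) x z
                (fun _ => v)
              rw [card_singleton, pow_one] at h5
              refine le_trans (mass_mono (condWeight_nonneg hnn x z) fun Q hQ => ?_) h5
              simpa using hQ.1 hi
            · exact mass_condWeight_le_one hnn x z _)
        rw [prod_ite_eq' _ c.1, if_pos (mem_erase.2 ⟨hc.1, mem_univ _⟩)] at h4
        refine h4.trans ?_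
        have h5 := mass_mono hnn (p := p v c.2.1) (q := fun Q => True ∧ pt Q c.2.2.2 = v)
          fun Q hQ => ⟨trivial, hQ.2 rfl⟩
        gcongr
      calc thetaMass F (q₂ c) ≤ ∑ v, thetaMass F
            (fun P : Fin a → Fin (b + 1) → V => ∀ i, p v i (P i)) := by
            refine thetaMass_le_sum hnn univ fun P hP => ⟨pt (P c.1) c.2.2.1, mem_univ _, fun i => ?_⟩
            exact ⟨fun h => by rw [h], fun h => by rw [h]; exact ((hq₂ c P).1 hP).2.symm⟩
        _ ≤ ∑ v, mass F (fun Q => True ∧ pt Q c.2.2.2 = v) * (A / lam) := sum_le_sum fun v _ => h3 v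
        _ = A / lam := by rw [← sum_mul, sum_mass_fiber, hF.total, one_mul]
    · have : thetaMass F (q₂ c) = 0 :=
        sum_eq_zero fun P _ => if_neg fun h => hc ((hq₂ c P).1 h).1
      rw [this]; positivity
  have h3 : 1 ≤ thetaMass F (fun P : Fin a → Fin (b + 1) → V => IsTheta H a b P) +
      ∑ c ∈ J, (thetaMass F (q₁ c) + thetaMass F (q₂ c)) := by
    rw [← thetaMass_true (a := a) hF.total]
    unfold thetaMass
    simp only [← sum_add_distrib]
    rw [sum_comm, ← sum_add_distrib]
    refine sum_le_sum fun P _ => ?_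
    have hw := thetaWeight_nonneg (a := a) hnn P
    have hnn1 : ∀ c, (0 : ℝ) ≤ if q₁ c P then thetaWeight F P else 0 := fun c => by
      split_ifs <;> simp [hw]
    have hnn2 : ∀ c, (0 : ℝ) ≤ if q₂ c P then thetaWeight F P else 0 := fun c => by
      split_ifs <;> simp [hw]
    have hnn3 : 0 ≤ ∑ c ∈ J, ((if q₁ c P then thetaWeight F P else 0) +
      (if q₂ c P then thetaWeight F P else 0)) := sum_nonneg fun c _ => add_nonneg (hnn1 c) (hnn2 c)
    simp only [if_true]
    by_cases hz : thetaWeight F P = 0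
    · rw [hz] at hnn3 ⊢; simp
    by_cases hth : IsTheta H a b P
    · simp only [hth, if_true]; linarith
    simp only [hth, if_false, zero_add]
    by_contra hlt
    apply hth
    have hno : ∀ c ∈ J, ¬ q₁ c P ∧ ¬ q₂ c P := by
      intro c hc
      rw [← not_or]
      intro h
      apply hlt
      refine le_trans ?_ (single_le_sum (f := fun c => (if q₁ c P then thetaWeight F P else 0) +
        (if q₂ c P then thetaWeight F P else 0)) (fun c _ => add_nonneg (hnn1 c) (hnn2 c)) hc)
      rcases h with h | h
      · have := hnn2 c
        simp only [h, if_true]; linarith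
      · have := hnn1 c
        simp only [h, if_true]; linarith
    obtain ⟨x, z, hP⟩ := mem_of_thetaWeight_ne_zero hz
    refine ⟨fun i => hF.walk _ (hP i).1, fun i i' => (hP i).2.1.trans (hP i').2.1.symm,
      fun i i' => (hP i).2.2.trans (hP i').2.2.symm, fun i j j' hj hj' heq => ?_,
      fun i i' hi j hj j' hj' heq => ?_⟩
    · refine (hno (i, i, j, j') ?_).1 ((hq₁ _ _).2 ⟨⟨hj, hj'⟩, heq⟩)
      simp only [hJ, mem_product, mem_univ, mem_range, true_and]; omega
    · refine (hno (i, i', j, j') ?_).2 ((hq₂ _ _).2 ⟨⟨hi, hj⟩, heq⟩)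
      rw [mem_Ioo] at hj hj'
      simp only [hJ, mem_product, mem_univ, mem_range, true_and]; omega
  have h4 : ∑ c ∈ J, (thetaMass F (q₁ c) + thetaMass F (q₂ c)) ≤ 1 / 2 := by
    calc _ ≤ ∑ _c ∈ J, (A / lam + A / lam) := sum_le_sum fun c _ => add_le_add (h1 c) (h2 c)
      _ = (2 * a ^ 2 * (b + 1) ^ 2 * A) / lam := by
        rw [sum_const, nsmul_eq_mul, hJcard]; ring
      _ ≤ 1 / 2 := by
        rw [div_le_iff₀ hlam0]; linarith
  linarith

end

/-! ### From families of walks to edge sets -/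

section
variable {V W : Type*} [Fintype W] {a b : ℕ} {F : (Fin (b + 1) → W) → ℝ}
  {H : SimpleGraph W} {d lam A : ℝ}

/-- The edge sets of members of two families of walks agree at the edges of `σ` if both families
cover these edges at the same positions in the same direction. The number of ways to assign positions
and directions to the edges of `σ` is bounded. -/
lemma IsPathMeasure.thetaMass_subset_walkEdges (hF : IsPathMeasure H d lam A b F) (hlam : 1 ≤ lam)
    (hA : 1 ≤ A) (hd : 0 < d) (hW : 0 < Fintype.card W) (ha : 1 ≤ a) (hb : 2 ≤ b) {ι : W → V}
    (hι : Function.Injective ι) (σ : Finset (Sym2 V)) (hσ : σ.Nonempty) (hσab : σ.card ≤ a * b) :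
    thetaMass F (fun P : Fin a → Fin (b + 1) → W => σ ⊆ walkEdges fun i => ι ∘ P i) ≤
      (2 * (a * b : ℝ)) ^ (a * b) * (A ^ a / (Fintype.card W * d *
        lam ^ ((a * (b - 1) : ℝ) / (a * b - 1) * ((σ.card : ℝ) - 1)))) := by
  have hm : (0 : ℝ) < Fintype.card W := by exact_mod_cast hW
  set κ : ℝ := (a * (b - 1) : ℝ) / (a * b - 1) with hκ
  set B : ℝ := A ^ a / (Fintype.card W * d * lam ^ (κ * ((σ.card : ℝ) - 1))) with hB
  have hB0 : 0 ≤ B := by positivity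
  -- the two ends of an edge, in the order given by `o`
  set orient : Sym2 V → Bool → V × V := fun e o => if o then e.out else e.out.swap with horient
  have horient' : ∀ e u v, e = s(u, v) → ∃ o, (u, v) = orient e o := by
    intro e u v h
    have h1 : s(e.out.1, e.out.2) = s(u, v) := by
      rw [← h]; exact Quot.out_eq e
    rcases Sym2.eq_iff.1 h1 with ⟨h2, h3⟩ | ⟨h2, h3⟩
    · exact ⟨true, by simp [horient, ← h2, ← h3]⟩
    · exact ⟨false, by simp [horient, Prod.swap, h2, h3]⟩
  have horient2 : ∀ e o, s((orient e o).1, (orient e o).2) = e := by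
    intro e o
    have h1 : s(e.out.1, e.out.2) = e := Quot.out_eq e
    cases o
    · simp only [horient, Bool.false_eq_true, if_false, Prod.fst_swap, Prod.snd_swap]
      rw [Sym2.eq_swap]; exact h1
    · simpa [horient] using h1
  set ev : (σ → (Fin a × Fin b) × Bool) → (Fin a → Fin (b + 1) → W) → Prop := fun h P =>
    ∀ e : σ, (ι (pt (P (h e).1.1) (h e).1.2), ι (pt (P (h e).1.1) ((h e).1.2 + 1))) =
      orient e.1 (h e).2 with hev
  have hbound : ∀ h, thetaMass F (ev h) ≤ B := by
    intro h
    by_cases hex : ∃ P, ev h P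
    swap
    · have : thetaMass F (ev h) = 0 := sum_eq_zero fun P _ => if_neg fun h1 => hex ⟨P, h1⟩
      rw [this]; exact hB0
    obtain ⟨P₀, hP₀⟩ := hex
    set J : Finset (Fin a × ℕ) := univ.image fun e : σ => ((h e).1.1, ((h e).1.2 : ℕ)) with hJ
    have hJcard : J.card = σ.card := by
      rw [hJ, card_image_of_injective, card_univ, Fintype.card_coe]
      intro e e' hee
      simp only [Prod.mk.injEq] at hee
      have h1 := hP₀ e
      have h2 := hP₀ e'
      rw [hee.1, hee.2] at h1
      apply Subtype.ext
      rw [← horient2 e.1 (h e).2, ← horient2 e'.1 (h e').2, ← h1, ← h2]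
    set S : Fin a → Finset ℕ := fun i => (range b).filter fun j => (i, j) ∈ J with hS
    have hScard : ∑ i, (S i).card = σ.card := by
      rw [← hJcard, card_eq_sum_card_fiberwise (f := Prod.fst) (t := univ) fun _ _ => by simp]
      refine sum_congr rfl fun i _ => ?_
      refine card_bij (fun j _ => (i, j)) ?_ ?_ ?_
      · intro j hj
        exact mem_filter.2 ⟨(mem_filter.1 hj).2, rfl⟩
      · intro j _ j' _ hjj
        exact (Prod.mk.inj hjj).2
      · rintro ⟨i', j⟩ hj
        obtain ⟨h1, h2⟩ := mem_filter.1 hj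
        simp only at h2
        subst h2
        refine ⟨j, mem_filter.2 ⟨?_, h1⟩, rfl⟩
        obtain ⟨e, _, he⟩ := mem_image.1 h1
        rw [← (Prod.mk.inj he).2]
        simp
    have hSne : ∃ i, (S i).Nonempty := by
      by_contra hcon
      push Not at hcon
      have : ∑ i, (S i).card = 0 := sum_eq_zero fun i _ => by rw [hcon i, card_empty]
      rw [hScard] at this
      have := hσ.card_pos
      omega
    obtain ⟨E, hE1, hE2⟩ := hF.thetaMass_edges hlam hA hd hW (by omega) (S := S)
      (fun i => filter_subset _ _) hSne (fun i => pt (P₀ i)) (fun i j => pt (P₀ i) (j + 1))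
    rw [hScard] at hE1
    refine (thetaMass_mono hF.nonneg fun P _ hP i j hj => ?_).trans (hE2.trans ?_)
    · obtain ⟨e, _, he⟩ := mem_image.1 (mem_filter.1 hj).2
      have h1 := (hP e).trans (hP₀ e).symm
      obtain ⟨h2, h3⟩ := Prod.mk.inj he
      rw [h2, h3] at h1
      exact ⟨hι (Prod.mk.inj h1).1, hι (Prod.mk.inj h1).2⟩
    · have h1 : lam ^ (κ * ((σ.card : ℝ) - 1)) ≤ lam ^ E := by
        rw [← Real.rpow_natCast]
        refine Real.rpow_le_rpow_of_exponent_le hlam ?_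
        have hab : 2 ≤ a * b := by nlinarith
        have hab' : (0 : ℝ) < a * b - 1 := by
          have : (2 : ℝ) ≤ a * b := by exact_mod_cast hab
          linarith
        rw [hκ, div_mul_eq_mul_div, div_le_iff₀ hab']
        have h2 : ((a * (b - 1) * (σ.card - 1) : ℕ) : ℝ) ≤ ((E * (a * b - 1) : ℕ) : ℝ) := by
          exact_mod_cast hE1
        push_cast [Nat.cast_sub (by omega : 1 ≤ b), Nat.cast_sub (by omega : 1 ≤ a * b),
          Nat.cast_sub hσ.card_pos] at h2
        exact h2
      rw [hB]
      gcongr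
  calc thetaMass F (fun P : Fin a → Fin (b + 1) → W => σ ⊆ walkEdges fun i => ι ∘ P i)
      ≤ ∑ h ∈ (univ : Finset (σ → (Fin a × Fin b) × Bool)), thetaMass F (ev h) := by
        refine thetaMass_le_sum hF.nonneg univ fun P hP => ?_
        have h1 : ∀ e : σ, ∃ y : (Fin a × Fin b) × Bool,
            (ι (pt (P y.1.1) y.1.2), ι (pt (P y.1.1) (y.1.2 + 1))) = orient e.1 y.2 := by
          intro e
          obtain ⟨ij, _, hij⟩ := mem_image.1 (hP e.2)
          obtain ⟨o, ho⟩ := horient' e.1 _ _ hij.symm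
          exact ⟨(ij, o), ho⟩
        choose h hh using h1
        exact ⟨h, mem_univ _, hh⟩
    _ ≤ ∑ _h ∈ (univ : Finset (σ → (Fin a × Fin b) × Bool)), B := sum_le_sum fun h _ => hbound h
    _ = (2 * (a * b : ℝ)) ^ σ.card * B := by
        rw [sum_const, card_univ, nsmul_eq_mul, Fintype.card_fun]
        simp only [Fintype.card_prod, Fintype.card_fin, Fintype.card_bool, Fintype.card_coe]
        push_cast; ring
    _ ≤ _ := by
        have h1 : (1 : ℝ) ≤ 2 * (a * b) := by
          have : 1 ≤ a * b := by nlinarith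
          have : (1 : ℝ) ≤ a * b := by exact_mod_cast this
          linarith
        have := pow_le_pow_right₀ h1 hσab
        gcongr

/-- The vertices of a family of walks are the ends of its edges, so that a set is the edge set of
boundedly many families. -/
lemma IsPathMeasure.thetaMass_walkEdges_eq (hF : IsPathMeasure H d lam A b F) (hlam : 1 ≤ lam)
    (hA : 1 ≤ A) (hd : 0 < d) (hW : 0 < Fintype.card W) (ha : 2 ≤ a) (hb : 1 ≤ b) {ι : W → V}
    (hι : Function.Injective ι) (E : Finset (Sym2 V)) :
    thetaMass F (fun P : Fin a → Fin (b + 1) → W => walkEdges (fun i => ι ∘ P i) = E) ≤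
      ((a * (b + 1) : ℝ)) ^ (a * (b + 1)) *
        (A ^ a / (Fintype.card W * d ^ b * lam ^ ((a - 1) * (b - 1)))) := by
  have hm : (0 : ℝ) < Fintype.card W := by exact_mod_cast hW
  set B : ℝ := A ^ a / (Fintype.card W * d ^ b * lam ^ ((a - 1) * (b - 1))) with hB
  have hB0 : 0 ≤ B := by positivity
  by_cases hex : ∃ P : Fin a → Fin (b + 1) → W, walkEdges (fun i => ι ∘ P i) = E
  swap
  · have : thetaMass F (fun P : Fin a → Fin (b + 1) → W => walkEdges (fun i => ι ∘ P i) = E) = 0 :=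
      sum_eq_zero fun P _ => if_neg fun h1 => hex ⟨P, h1⟩
    rw [this]; positivity
  obtain ⟨P₀, hP₀⟩ := hex
  set Φ : (Fin a → Fin (b + 1) → Fin a × Fin (b + 1)) → Fin a → Fin (b + 1) → W :=
    fun g i j => P₀ (g i j).1 (g i j).2 with hΦ
  have hverts : ∀ (e : Sym2 V), e ∈ E → ∀ v ∈ e, ∃ y : Fin a × Fin (b + 1), v = ι (P₀ y.1 y.2) := by
    intro e he v hv
    rw [← hP₀] at he
    obtain ⟨ij, _, hij⟩ := mem_image.1 he
    rw [← hij] at hv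
    rcases Sym2.mem_iff.1 hv with h | h
    · exact ⟨(ij.1, ⟨min ij.2 b, by omega⟩), h⟩
    · exact ⟨(ij.1, ⟨min (ij.2 + 1) b, by omega⟩), h⟩
  have hsub : ∀ P : Fin a → Fin (b + 1) → W, walkEdges (fun i => ι ∘ P i) = E →
      P ∈ (univ.image Φ) := by
    intro P hP
    have h1 : ∀ i j, ∃ y : Fin a × Fin (b + 1), P i j = P₀ y.1 y.2 := by
      intro i j
      suffices h2 : ∃ e ∈ E, ι (P i j) ∈ e by
        obtain ⟨e, he, hv⟩ := h2
        obtain ⟨y, hy⟩ := hverts e he _ hv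
        exact ⟨y, hι hy⟩
      rw [← hP]
      by_cases hj : (j : ℕ) < b
      · refine ⟨_, mem_image.2 ⟨(i, ⟨j, hj⟩), mem_univ _, rfl⟩, ?_⟩
        rw [Sym2.mem_iff]
        left
        have := pt_coe (ι ∘ P i) j
        exact this.symm
      · -- the last vertex of a walk is the end of its last edge
        refine ⟨_, mem_image.2 ⟨(i, ⟨b - 1, by omega⟩), mem_univ _, rfl⟩, ?_⟩
        rw [Sym2.mem_iff]
        right
        have h3 := pt_coe (ι ∘ P i) j
        have h4 : (j : ℕ) = b - 1 + 1 := by omega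
        rw [h4] at h3
        exact h3.symm
    choose g hg using h1
    exact mem_image.2 ⟨g, mem_univ _, by funext i j; exact (hg i j).symm⟩
  calc _ ≤ ∑ P : Fin a → Fin (b + 1) → W, if P ∈ univ.image Φ then B else 0 := by
        refine sum_le_sum fun P _ => ?_
        by_cases h : walkEdges (fun i => ι ∘ P i) = E
        · rw [if_pos h, if_pos (hsub P h)]
          exact hF.thetaWeight_le hlam hA hd hW ha P
        · rw [if_neg h]
          split_ifs
          · exact hB0
          · exact le_rfl
    _ = ((univ.image Φ).card : ℝ) * B := by
        rw [← sum_filter, sum_const, nsmul_eq_mul]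
        congr 3
        ext P; simp
    _ ≤ _ := by
        refine mul_le_mul_of_nonneg_right ?_ hB0
        have h1 : (univ.image Φ).card ≤ (a * (b + 1)) ^ (a * (b + 1)) := by
          refine card_image_le.trans ?_
          rw [card_univ, Fintype.card_fun, Fintype.card_fun]
          simp only [Fintype.card_prod, Fintype.card_fin]
          rw [← pow_mul, mul_comm (b + 1) a]
        exact_mod_cast h1

end

/-- The edges of a theta graph in `H`. -/
def IsThetaEdges {V : Type*} (H : SimpleGraph V) (a b : ℕ) (E : Finset (Sym2 V)) : Prop :=
  ∃ P : Fin a → Fin (b + 1) → V, IsTheta H a b P ∧ walkEdges P = E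

lemma IsTheta.map {V W : Type*} {H : SimpleGraph W} {H' : SimpleGraph V} {a b : ℕ} {ι : W → V}
    (hι : Function.Injective ι) (hH : ∀ u v, H.Adj u v → H'.Adj (ι u) (ι v))
    {P : Fin a → Fin (b + 1) → W} (hP : IsTheta H a b P) :
    IsTheta H' a b fun i => ι ∘ P i :=
  ⟨fun i j hj => hH _ _ (hP.walk i j hj), fun i i' => congrArg ι (hP.start i i'),
    fun i i' => congrArg ι (hP.finish i i'), fun i j j' hj hj' h => hP.inj i j j' hj hj' (hι h),
    fun i i' hi j hj j' hj' h => hP.disj i i' hi j hj j' hj' (hι h)⟩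

lemma IsThetaEdges.mono {V : Type*} {H H' : SimpleGraph V} (h : H ≤ H') {a b : ℕ}
    {E : Finset (Sym2 V)} (hE : IsThetaEdges H a b E) : IsThetaEdges H' a b E := by
  obtain ⟨P, hP, rfl⟩ := hE
  exact ⟨P, hP.map (ι := id) Function.injective_id fun u v huv => h huv, rfl⟩

lemma IsThetaEdges.subset_edgeSet {V : Type*} {H : SimpleGraph V} {a b : ℕ}
    {E : Finset (Sym2 V)} (hE : IsThetaEdges H a b E) : ∀ e ∈ E, e ∈ H.edgeSet := by
  obtain ⟨P, hP, rfl⟩ := hE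
  intro e he
  obtain ⟨ij, _, rfl⟩ := mem_image.1 he
  exact hP.walk ij.1 ij.2 ij.2.2

lemma IsThetaEdges.card_le {V : Type*} {H : SimpleGraph V} {a b : ℕ}
    {E : Finset (Sym2 V)} (hE : IsThetaEdges H a b E) : E.card ≤ a * b := by
  obtain ⟨P, _, rfl⟩ := hE
  exact card_walkEdges_le P

lemma IsThetaEdges.nonempty {V : Type*} {H : SimpleGraph V} {a b : ℕ} (ha : 1 ≤ a) (hb : 1 ≤ b)
    {E : Finset (Sym2 V)} (hE : IsThetaEdges H a b E) : E.Nonempty := by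
  obtain ⟨P, _, rfl⟩ := hE
  exact ⟨_, mem_image_of_mem _ (mem_univ (⟨0, ha⟩, ⟨0, hb⟩))⟩

/-- In an almost regular graph, a weight on the theta graphs with small codegrees. -/
lemma exists_theta_weight (a b : ℕ) (ha : 2 ≤ a) (hb : 2 ≤ b) (K : ℝ) (hK : 1 ≤ K) :
    ∃ C lam₁ : ℝ, 1 ≤ C ∧ 1 ≤ lam₁ ∧ ∀ {V W : Type*} [Fintype V] [Fintype W] [Nonempty W]
      (H : SimpleGraph W) (H' : SimpleGraph V) (ι : W → V) (d lam : ℝ), Function.Injective ι →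
      (∀ u v, H.Adj u v → H'.Adj (ι u) (ι v)) → lam₁ ≤ lam → lam ≤ d →
      (∀ u, d ≤ degIn H univ u) → (∀ u, degIn H univ u ≤ K * d) →
      lam ^ (b - 1) * Fintype.card W = d ^ b →
      ∃ w : Finset (Sym2 V) → ℝ, (∀ E, 0 ≤ w E) ∧ (∀ E, w E ≠ 0 → IsThetaEdges H' a b E) ∧
        1 / 2 ≤ ∑ E, w E ∧
        (∀ σ : Finset (Sym2 V), σ.Nonempty → σ.card ≤ a * b → ∑ E with σ ⊆ E, w E ≤
          C / (Fintype.card W * d *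
            lam ^ ((a * (b - 1) : ℝ) / (a * b - 1) * ((σ.card : ℝ) - 1)))) ∧
        ∀ E, w E ≤ C / (Fintype.card W * d ^ b * lam ^ ((a - 1) * (b - 1))) := by
  obtain ⟨A, lam₀, hA, hlam₀, hmain⟩ := exists_isSpreadFamily b hb K hK
  set A' : ℝ := A ^ (2 * b) with hA'
  have hA'1 : 1 ≤ A' := one_le_pow₀ hA
  set C : ℝ := ((2 * (a * b : ℝ)) ^ (a * b) + ((a * (b + 1) : ℝ)) ^ (a * (b + 1))) * A' ^ a with hC
  have ha' : (1 : ℝ) ≤ a := by exact_mod_cast (by omega : 1 ≤ a)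
  have hb' : (1 : ℝ) ≤ b := by exact_mod_cast (by omega : 1 ≤ b)
  have hA'a : 1 ≤ A' ^ a := one_le_pow₀ hA'1
  have h1 : (1 : ℝ) ≤ (2 * (a * b : ℝ)) ^ (a * b) := one_le_pow₀ (by nlinarith)
  have h2 : (1 : ℝ) ≤ ((a * (b + 1) : ℝ)) ^ (a * (b + 1)) := one_le_pow₀ (by nlinarith)
  refine ⟨C, max lam₀ (4 * a ^ 2 * (b + 1) ^ 2 * A'), ?_, le_max_of_le_left hlam₀, ?_⟩
  · rw [hC]; nlinarith
  intro V W _ _ _ H H' ι d lam hι hH hlam hlamd hd hΔ hlamb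
  have hl0 : lam₀ ≤ lam := (le_max_left _ _).trans hlam
  have hl1 : 4 * a ^ 2 * (b + 1) ^ 2 * A' ≤ lam := (le_max_right _ _).trans hlam
  have hlam1 : 1 ≤ lam := hlam₀.trans hl0
  have hd0 : 0 < d := by linarith
  have hW : 0 < Fintype.card W := Fintype.card_pos
  have hm : (0 : ℝ) < Fintype.card W := by exact_mod_cast hW
  obtain ⟨t, ht, htb, T, hT⟩ := hmain H d lam hl0 hlamd hd hΔ hlamb
  obtain ⟨F, hF⟩ := hT.exists_isPathMeasure ht hlamd hA (by linarith) htb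
  set w : Finset (Sym2 V) → ℝ := fun E => thetaMass F (fun P : Fin a → Fin (b + 1) → W =>
    IsTheta H a b P ∧ walkEdges (fun i => ι ∘ P i) = E) with hw
  have hsum : ∀ p : Finset (Sym2 V) → Prop, ∑ E with p E, w E =
      thetaMass F (fun P : Fin a → Fin (b + 1) → W =>
        IsTheta H a b P ∧ p (walkEdges fun i => ι ∘ P i)) := by
    intro p
    simp only [hw, thetaMass]
    rw [sum_comm]
    refine sum_congr rfl fun P _ => ?_
    by_cases hP : IsTheta H a b P
    · simp only [hP, true_and]
      rw [sum_ite_eq]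
      simp
    · simp [hP]
  refine ⟨w, fun E => thetaMass_nonneg hF.nonneg _, fun E hE => ?_, ?_, fun σ hσ hσab => ?_,
    fun E => ?_⟩
  · obtain ⟨P, _, hP⟩ := exists_ne_zero_of_sum_ne_zero hE
    split_ifs at hP with h
    · exact ⟨_, h.1.map hι hH, h.2⟩
    · exact absurd rfl hP
  · have h3 := hF.half_le_thetaMass (by linarith) hl1 (by linarith)
    have h4 := hsum fun _ => True
    simp only [and_true, filter_true] at h4
    rw [h4]
    exact h3
  · have h5 : ∑ E with σ ⊆ E, w E = thetaMass F (fun P : Fin a → Fin (b + 1) → W =>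
        IsTheta H a b P ∧ σ ⊆ walkEdges fun i => ι ∘ P i) := by
      rw [← hsum fun E => σ ⊆ E]
      congr!
    rw [h5]
    refine (thetaMass_mono hF.nonneg fun P _ hP => hP.2).trans
      ((hF.thetaMass_subset_walkEdges hlam1 hA'1 hd0 hW (by omega) hb hι σ hσ hσab).trans ?_)
    rw [← mul_div_assoc]
    gcongr
    rw [hC]; nlinarith
  · refine (thetaMass_mono hF.nonneg fun P _ hP => hP.2).trans
      ((hF.thetaMass_walkEdges_eq hlam1 hA'1 hd0 hW ha (by omega) hι E).trans ?_)
    rw [← mul_div_assoc]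
    gcongr
    rw [hC]; nlinarith

/-! ### Weights on theta graphs in dense graphs -/

/-- The parameters of an almost regular subgraph on `m` vertices of degree about `d`: the number
`d ^ b / m` of walks of length `b` between two vertices is large. -/
lemma pow_le_of_core {a b : ℕ} (ha : 2 ≤ a) (hb : 2 ≤ b) {x n m d : ℝ} (hx : 0 ≤ x) (hm : 0 < m)
    (hmn : m ≤ n)
    (hd : x * n ^ (1 / (b : ℝ)) * (m / n) ^ ((a - 1 : ℝ) / (a * b - 1)) ≤ d) :
    x ^ b * m ≤ d ^ b := by
  have hn : 0 < n := hm.trans_le hmn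
  have ha' : (2 : ℝ) ≤ a := by exact_mod_cast ha
  have hb' : (2 : ℝ) ≤ b := by exact_mod_cast hb
  have hab : (0 : ℝ) < a * b - 1 := by nlinarith
  have hq : 0 < m / n := by positivity
  have hq1 : m / n ≤ 1 := (div_le_one hn).2 hmn
  have h1 : m / n ≤ ((m / n) ^ ((a - 1 : ℝ) / (a * b - 1))) ^ b := by
    rw [← Real.rpow_natCast, ← Real.rpow_mul hq.le]
    nth_rewrite 1 [← Real.rpow_one (m / n)]
    refine Real.rpow_le_rpow_of_exponent_ge hq hq1 ?_
    rw [div_mul_eq_mul_div, div_le_one hab]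
    nlinarith
  have h2 : (n ^ (1 / (b : ℝ))) ^ b = n := by
    rw [← Real.rpow_natCast, ← Real.rpow_mul hn.le, one_div_mul_cancel (by positivity),
      Real.rpow_one]
  calc x ^ b * m = x ^ b * n * (m / n) := by field_simp
    _ ≤ x ^ b * n * ((m / n) ^ ((a - 1 : ℝ) / (a * b - 1))) ^ b := by gcongr
    _ = (x * n ^ (1 / (b : ℝ)) * (m / n) ^ ((a - 1 : ℝ) / (a * b - 1))) ^ b := by
        rw [mul_pow, mul_pow, h2]
    _ ≤ d ^ b := by gcongr

/-- The parameters of an almost regular subgraph on `m` vertices of degree about `d`: it has, in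
proportion to its edges, at least as many theta graphs as the whole graph. The exponent
`(a - 1) / (a * b - 1)` of the regularization is made for this estimate. -/
lemma div_pow_le_of_core {a b : ℕ} (ha : 2 ≤ a) (hb : 2 ≤ b) {x n m d : ℝ} (hx : 0 < x)
    (hm : 0 < m) (hmn : m ≤ n)
    (hd : x * n ^ (1 / (b : ℝ)) * (m / n) ^ ((a - 1 : ℝ) / (a * b - 1)) ≤ d) :
    m ^ (a - 1) / d ^ (a * b - 1) ≤ n ^ (1 / (b : ℝ) - 1) / x ^ (a * b - 1) := by
  have hn : 0 < n := hm.trans_le hmn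
  have ha' : (2 : ℝ) ≤ a := by exact_mod_cast ha
  have hb' : (2 : ℝ) ≤ b := by exact_mod_cast hb
  have hab : (0 : ℝ) < a * b - 1 := by nlinarith
  have hab2 : 2 ≤ a * b := by nlinarith
  have hq : 0 < m / n := by positivity
  have hcast : ((a * b - 1 : ℕ) : ℝ) = a * b - 1 := by
    push_cast [Nat.cast_sub (by omega : 1 ≤ a * b)]; ring
  have hcast' : ((a - 1 : ℕ) : ℝ) = a - 1 := by
    push_cast [Nat.cast_sub (by omega : 1 ≤ a)]; ring
  have h1 : ((m / n) ^ ((a - 1 : ℝ) / (a * b - 1))) ^ (a * b - 1) = (m / n) ^ (a - 1) := by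
    rw [← Real.rpow_natCast, ← Real.rpow_mul hq.le, hcast, div_mul_cancel₀ _ hab.ne', ← hcast',
      Real.rpow_natCast]
  have h2 : (n ^ (1 / (b : ℝ))) ^ (a * b - 1) * n ^ (1 / (b : ℝ) - 1) = n ^ (a - 1) := by
    rw [← Real.rpow_natCast, ← Real.rpow_mul hn.le, ← Real.rpow_add hn, hcast,
      ← Real.rpow_natCast n, hcast']
    congr 1
    field_simp
    ring
  have h3 : 0 < x * n ^ (1 / (b : ℝ)) * (m / n) ^ ((a - 1 : ℝ) / (a * b - 1)) := by positivity
  have h4 : 0 < d := h3.trans_le hd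
  rw [div_le_div_iff₀ (by positivity) (by positivity)]
  calc m ^ (a - 1) * x ^ (a * b - 1) = x ^ (a * b - 1) * (m / n) ^ (a - 1) * n ^ (a - 1) := by
        rw [div_pow]; field_simp
    _ = n ^ (1 / (b : ℝ) - 1) *
        (x * n ^ (1 / (b : ℝ)) * (m / n) ^ ((a - 1 : ℝ) / (a * b - 1))) ^ (a * b - 1) := by
        rw [mul_pow, mul_pow, h1, ← h2]; ring
    _ ≤ _ := by gcongr

/-- The subgraph of the edges of `G` inside `U`, on the same vertices. -/
def edgesInside {V : Type*} (G : SimpleGraph V) (U : Finset V) : SimpleGraph V where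
  Adj u v := G.Adj u v ∧ u ∈ U ∧ v ∈ U
  symm := ⟨fun _ _ h => ⟨h.1.symm, h.2.2, h.2.1⟩⟩
  loopless := ⟨fun _ h => G.irrefl h.1⟩

lemma degSum_edgesInside {V : Type*} [Fintype V] (G : SimpleGraph V) (U : Finset V) :
    degSum (edgesInside G U) univ = degSum G U := by
  unfold degSum
  rw [← sum_subset (subset_univ U)]
  · refine sum_congr rfl fun u hu => ?_
    unfold degIn
    congr 2
    ext v
    simp [edgesInside, hu, and_comm]
  · intro u _ hu
    simp [degIn, edgesInside, hu]

lemma degIn_comap_val {V : Type*} (G : SimpleGraph V) (U : Finset V) (u : U) :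
    degIn (G.comap ((↑) : U → V)) univ u = degIn G U u := by
  unfold degIn
  rw [← card_map (Function.Embedding.subtype (· ∈ U))]
  congr 2
  ext v
  simp [and_comm]

/-- A dense graph has a subgraph with a weight on its theta graphs, of total weight proportional to
its number of edges, with small codegrees. -/
lemma exists_core_weight (a b : ℕ) (ha : 2 ≤ a) (hb : 2 ≤ b) :
    ∃ C k₁ : ℝ, 1 ≤ C ∧ 1 ≤ k₁ ∧ ∀ {V : Type*} [Fintype V] (R : SimpleGraph V) (k : ℝ),
      k₁ ≤ k → 0 < Fintype.card V →
      k * (Fintype.card V : ℝ) ^ (1 + 1 / (b : ℝ)) ≤ degSum R univ →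
      ∃ H ≤ R, H ≠ ⊥ ∧ ∃ w : Finset (Sym2 V) → ℝ,
        (∀ E, 0 ≤ w E) ∧ (∀ E, w E ≠ 0 → IsThetaEdges H a b E) ∧
        degSum H univ / 4 ≤ ∑ E, w E ∧
        (∀ σ : Finset (Sym2 V), σ.Nonempty → σ.card ≤ a * b → ∑ E with σ ⊆ E, w E ≤
          C / k ^ ((1 + 1 / ((a : ℝ) * b - 1)) * ((σ.card : ℝ) - 1))) ∧
        ∀ E, w E ≤ C * (Fintype.card V : ℝ) ^ (1 / (b : ℝ) - 1) / k ^ (a * b - 1) := by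
  have ha' : (2 : ℝ) ≤ a := by exact_mod_cast ha
  have hb' : (2 : ℝ) ≤ b := by exact_mod_cast hb
  have hab : (0 : ℝ) < a * b - 1 := by nlinarith
  have hab2 : 2 ≤ a * b := by nlinarith
  set γ : ℝ := (a - 1 : ℝ) / (a * b - 1) with hγ
  obtain ⟨K, hK, hcore⟩ := exists_almost_regular_core γ (div_pos (by linarith) hab)
  obtain ⟨C, lam₁, hC, hlam₁, hweight⟩ := exists_theta_weight a b ha hb K hK
  refine ⟨K * C * 4 ^ (a * b), 4 * lam₁, ?_, by linarith, ?_⟩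
  · have h1 : (1 : ℝ) ≤ 4 ^ (a * b) := one_le_pow₀ (by norm_num)
    have h2 : 1 ≤ K * C := by nlinarith
    nlinarith
  intro V _ R k hk hV hR
  have hn : (0 : ℝ) < Fintype.card V := by exact_mod_cast hV
  set n : ℝ := ((Fintype.card V : ℕ) : ℝ) with hndef
  have hk0 : 0 < k := by linarith
  set x : ℝ := k / 4 with hx
  have hx1 : lam₁ ≤ x := by rw [hx]; linarith
  have hx0 : 0 < x := by linarith
  have hxone : 1 ≤ x := hlam₁.trans hx1
  obtain ⟨U, d, hU, hd, hUd, hdens⟩ := hcore R (lt_of_lt_of_le (by positivity) hR)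
  have hm : (0 : ℝ) < U.card := by exact_mod_cast hU.card_pos
  have hmn : (U.card : ℝ) ≤ n := by rw [hndef]; exact_mod_cast card_le_univ U
  set m : ℝ := ((U.card : ℕ) : ℝ) with hmdef
  have hdx : x * n ^ (1 / (b : ℝ)) * (m / n) ^ γ ≤ d := by
    have h1 : k * n ^ (1 + 1 / (b : ℝ)) / n ^ (1 + γ) ≤ 4 * d / m ^ γ :=
      le_trans (by gcongr) hdens
    rw [le_div_iff₀ (by positivity)] at h1
    have h2 : k * n ^ (1 + 1 / (b : ℝ)) / n ^ (1 + γ) * m ^ γ =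
        4 * (x * n ^ (1 / (b : ℝ)) * (m / n) ^ γ) := by
      rw [Real.rpow_add hn, Real.rpow_add hn, Real.rpow_one, Real.div_rpow hm.le hn.le, hx]
      field_simp
    linarith
  have hdm : x ^ b * m ≤ d ^ b := pow_le_of_core ha hb hx0.le hm hmn hdx
  have hdle : d ≤ m := by
    obtain ⟨u, hu⟩ := hU
    refine (hUd u hu).1.trans ?_
    rw [hmdef, degIn]
    exact_mod_cast card_filter_le _ _
  -- the average number of walks of length `b` between two vertices of the core is `lam ^ (b - 1)`
  set lam : ℝ := (d ^ b / m) ^ (1 / ((b - 1 : ℕ) : ℝ)) with hlam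
  have hb1 : b - 1 ≠ 0 := by omega
  have hlam0 : 0 ≤ lam := by positivity
  have hlampow : lam ^ (b - 1) = d ^ b / m := by
    rw [hlam, one_div, Real.rpow_inv_natCast_pow (by positivity) hb1]
  have hxlam : x ^ b ≤ lam ^ (b - 1) := by
    rw [hlampow, le_div_iff₀ hm]; exact hdm
  have hlamx : x ≤ lam := by
    refine le_of_pow_le_pow_left₀ hb1 hlam0 (le_trans ?_ hxlam)
    exact pow_le_pow_right₀ hxone (by omega)
  have hlamd : lam ≤ d := by
    refine le_of_pow_le_pow_left₀ hb1 hd.le ?_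
    rw [hlampow, div_le_iff₀ hm]
    calc d ^ b = d ^ (b - 1) * d := by rw [← pow_succ]; congr 1; omega
      _ ≤ _ := by gcongr
  have hlampos : 0 < lam := hx0.trans_le hlamx
  have : Nonempty U := ⟨⟨hU.choose, hU.choose_spec⟩⟩
  have hcardU : ((Fintype.card U : ℕ) : ℝ) = m := by rw [Fintype.card_coe]
  obtain ⟨w, hw0, hwE, hwsum, hwdeg, hwpt⟩ := hweight (R.comap ((↑) : U → V)) (edgesInside R U)
    ((↑) : U → V) d lam Subtype.val_injective (fun u v huv => ⟨huv, u.2, v.2⟩)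
    (hx1.trans hlamx) hlamd (fun u => by rw [degIn_comap_val]; exact (hUd u u.2).1)
    (fun u => by rw [degIn_comap_val]; exact (hUd u u.2).2)
    (by rw [hcardU, hlampow]; field_simp)
  rw [hcardU] at hwdeg hwpt
  have hS1 : m * d ≤ degSum R U := by
    rw [hmdef, ← nsmul_eq_mul, ← sum_const]
    exact sum_le_sum fun u hu => (hUd u hu).1
  have hS2 : degSum R U ≤ m * (K * d) := by
    rw [hmdef, ← nsmul_eq_mul, ← sum_const]
    exact sum_le_sum fun u hu => (hUd u hu).2
  have hSpos : 0 < degSum R U := lt_of_lt_of_le (by positivity) hS1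
  refine ⟨edgesInside R U, fun u v h => h.1, fun hbot => ?_,
    fun E => degSum R U / 2 * w E, fun E => mul_nonneg (by positivity) (hw0 E),
    fun E hE => hwE E (right_ne_zero_of_mul hE), ?_, fun σ hσ hσab => ?_, fun E => ?_⟩
  · rw [← degSum_edgesInside, hbot] at hSpos
    simp [degSum, degIn] at hSpos
  · rw [degSum_edgesInside, ← mul_sum]
    nlinarith
  · rw [← mul_sum]
    set s : ℝ := (σ.card : ℝ) - 1 with hs
    have hs0 : 0 ≤ s := by
      have : (1 : ℝ) ≤ σ.card := by exact_mod_cast hσ.card_pos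
      rw [hs]; linarith
    have hs1 : s ≤ a * b - 1 := by
      have : (σ.card : ℝ) ≤ a * b := by exact_mod_cast hσab
      rw [hs]; linarith
    set β : ℝ := (1 + 1 / ((a : ℝ) * b - 1)) with hβ
    have hβ' : β = a * b / (a * b - 1) := by rw [hβ]; field_simp; ring
    have hβs : β * s ≤ (a * b : ℕ) := by
      push_cast
      rw [hβ', div_mul_eq_mul_div, div_le_iff₀ hab]
      gcongr
    have h1 : x ^ (β * s) ≤ lam ^ ((a * (b - 1) : ℝ) / (a * b - 1) * s) := by
      have h2 : (x ^ b) ^ ((a : ℝ) / (a * b - 1) * s) ≤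
          (lam ^ (b - 1)) ^ ((a : ℝ) / (a * b - 1) * s) := by gcongr
      rw [← Real.rpow_natCast, ← Real.rpow_natCast, ← Real.rpow_mul hx0.le,
        ← Real.rpow_mul hlam0] at h2
      convert h2 using 2
      · rw [hβ']; ring
      · push_cast [Nat.cast_sub (by omega : 1 ≤ b)]; ring
    have h3 : k ^ (β * s) ≤ 4 ^ (a * b) * x ^ (β * s) := by
      have h4 : k = 4 * x := by rw [hx]; ring
      rw [h4, Real.mul_rpow (by norm_num) hx0.le]
      gcongr
      rw [← Real.rpow_natCast]
      exact Real.rpow_le_rpow_of_exponent_le (by norm_num) hβs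
    have h5 := hwdeg σ hσ hσab
    calc degSum R U / 2 * ∑ E with σ ⊆ E, w E
        ≤ (m * (K * d)) * (C / (m * d * x ^ (β * s))) := by
          refine mul_le_mul (by linarith) (h5.trans ?_) (sum_nonneg fun E _ => hw0 E)
            (by positivity)
          gcongr
      _ = K * C / x ^ (β * s) := by field_simp
      _ ≤ K * C * 4 ^ (a * b) / k ^ (β * s) := by
          rw [div_le_div_iff₀ (by positivity) (by positivity), mul_assoc (K * C)]
          exact mul_le_mul_of_nonneg_left h3 (by positivity)
  · have h1 := div_pow_le_of_core ha hb hx0 hm hmn hdx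
    have h2 : lam ^ ((a - 1) * (b - 1)) = d ^ (b * (a - 1)) / m ^ (a - 1) := by
      rw [mul_comm (a - 1), pow_mul, hlampow, div_pow, ← pow_mul]
    have h3 : d ^ b * d ^ (b * (a - 1)) = d ^ (a * b - 1) * d := by
      rw [← pow_add, ← pow_succ]
      congr 1
      obtain ⟨a, rfl⟩ : ∃ a', a = a' + 1 := ⟨a - 1, by omega⟩
      have : 1 ≤ (a + 1) * b := by omega
      rw [Nat.sub_add_cancel this]; simp; ring
    have h4 : (4 : ℝ) ^ (a * b - 1) ≤ 4 ^ (a * b) := pow_le_pow_right₀ (by norm_num) (by omega)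
    calc degSum R U / 2 * w E
        ≤ (m * (K * d)) * (C / (m * d ^ b * lam ^ ((a - 1) * (b - 1)))) :=
          mul_le_mul (by linarith) (hwpt E) (hw0 E) (by positivity)
      _ = K * C * (m ^ (a - 1) / d ^ (a * b - 1)) := by
          have h5 : m * d ^ b * lam ^ ((a - 1) * (b - 1)) =
              m * d * d ^ (a * b - 1) / m ^ (a - 1) := by
            rw [h2, mul_assoc, ← mul_div_assoc, h3]; ring
          rw [h5]; field_simp
      _ ≤ K * C * (n ^ (1 / (b : ℝ) - 1) / x ^ (a * b - 1)) := by gcongr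
      _ = K * C * 4 ^ (a * b - 1) * n ^ (1 / (b : ℝ) - 1) / k ^ (a * b - 1) := by
          rw [hx, div_pow]; field_simp
      _ ≤ _ := by gcongr

lemma degSum_sdiff {V : Type*} [Fintype V] {R H : SimpleGraph V} (h : H ≤ R) :
    degSum R univ = degSum H univ + degSum (R \ H) univ := by
  unfold degSum
  rw [← sum_add_distrib]
  refine sum_congr rfl fun u _ => ?_
  simp only [degIn_eq_sum]
  rw [← sum_add_distrib]
  refine sum_congr rfl fun v _ => ?_
  rw [SimpleGraph.sdiff_adj]
  by_cases h1 : H.Adj u v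
  · simp [h1, h h1]
  · simp [h1]

/-- If every subgraph with at least `T` edges contains a nonempty subgraph with a good weight on its
theta graphs, take out such subgraphs as long as possible and add up the weights. As the subgraphs
are edge-disjoint, the bounds for the codegrees are those of a single weight. -/
lemma exists_weight_of_pieces {V : Type*} [Fintype V] {a b : ℕ} (ha : 1 ≤ a) (hb : 1 ≤ b) (T : ℝ)
    (c : Finset (Sym2 V) → ℝ) (hc : ∀ σ, 0 ≤ c σ) (ρ : ℝ) (hρ : 0 ≤ ρ)
    (hpiece : ∀ R : SimpleGraph V, T ≤ degSum R univ →
      ∃ H ≤ R, H ≠ ⊥ ∧ ∃ w : Finset (Sym2 V) → ℝ,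
        (∀ E, 0 ≤ w E) ∧ (∀ E, w E ≠ 0 → IsThetaEdges H a b E) ∧
        degSum H univ / 4 ≤ ∑ E, w E ∧
        (∀ σ : Finset (Sym2 V), σ.Nonempty → σ.card ≤ a * b → ∑ E with σ ⊆ E, w E ≤ c σ) ∧
        ∀ E, w E ≤ ρ) (R : SimpleGraph V) :
    ∃ w : Finset (Sym2 V) → ℝ,
      (∀ E, 0 ≤ w E) ∧ (∀ E, w E ≠ 0 → IsThetaEdges R a b E) ∧
      (degSum R univ - T) / 4 ≤ ∑ E, w E ∧
      (∀ σ : Finset (Sym2 V), σ.Nonempty → σ.card ≤ a * b → ∑ E with σ ⊆ E, w E ≤ c σ) ∧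
      ∀ E, w E ≤ ρ := by
  induction R using WellFoundedLT.induction with
  | ind R ih =>
    by_cases hR : T ≤ degSum R univ
    swap
    · refine ⟨fun _ => 0, fun _ => le_rfl, fun E h => absurd rfl h, ?_, fun σ _ _ => ?_,
        fun _ => hρ⟩
      · rw [sum_const_zero]; linarith
      · rw [sum_const_zero]; exact hc σ
    obtain ⟨H, hHR, hH, w, hw0, hwE, hwsum, hwdeg, hwpt⟩ := hpiece R hR
    have hlt : R \ H < R := by
      refine lt_of_le_of_ne sdiff_le fun h => hH ?_
      have h1 : Disjoint (R \ H) H := disjoint_sdiff_self_left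
      rw [h] at h1
      exact disjoint_self.1 (h1.mono_left hHR)
    obtain ⟨w', hw0', hwE', hwsum', hwdeg', hwpt'⟩ := ih (R \ H) hlt
    have hw : ∀ E e, e ∈ E → e ∉ H.edgeSet → w E = 0 := fun E e he heH => by
      by_contra h
      exact heH ((hwE E h).subset_edgeSet e he)
    have hw' : ∀ E e, e ∈ E → e ∈ H.edgeSet → w' E = 0 := fun E e he heH => by
      by_contra h
      have h1 := (hwE' E h).subset_edgeSet e he
      rw [SimpleGraph.edgeSet_sdiff] at h1
      exact h1.2 heH
    refine ⟨fun E => w E + w' E, fun E => add_nonneg (hw0 E) (hw0' E), fun E hE => ?_, ?_,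
      fun σ hσ hσab => ?_, fun E => ?_⟩
    · by_cases h : w E = 0
      · refine (hwE' E fun h' => hE ?_).mono sdiff_le
        change w E + w' E = 0
        rw [h, h', add_zero]
      · exact (hwE E h).mono hHR
    · rw [sum_add_distrib, degSum_sdiff hHR]
      linarith
    · obtain ⟨e, he⟩ := hσ
      rw [sum_add_distrib]
      by_cases heH : e ∈ H.edgeSet
      · have h0 : ∑ E with σ ⊆ E, w' E = 0 :=
          sum_eq_zero fun E hE => hw' E e ((mem_filter.1 hE).2 he) heH
        rw [h0, add_zero]
        exact hwdeg σ ⟨e, he⟩ hσab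
      · have h0 : ∑ E with σ ⊆ E, w E = 0 :=
          sum_eq_zero fun E hE => hw E e ((mem_filter.1 hE).2 he) heH
        rw [h0, zero_add]
        exact hwdeg' σ ⟨e, he⟩ hσab
    · change w E + w' E ≤ ρ
      by_cases h : w E = 0
      · rw [h, zero_add]; exact hwpt' E
      · obtain ⟨e, he⟩ := (hwE E h).nonempty ha hb
        rw [hw' E e he ((hwE E h).subset_edgeSet e he), add_zero]
        exact hwpt E

/-- Balanced supersaturation for theta graphs, in terms of their edge sets. -/
lemma exists_balanced_thetaEdges (a b : ℕ) (ha : 2 ≤ a) (hb : 2 ≤ b) :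
    ∃ δ k₀ : ℝ, 0 < δ ∧ 1 ≤ k₀ ∧ ∀ {V : Type*} [Fintype V] (G : SimpleGraph V) (k e : ℝ),
      k₀ ≤ k → 0 < Fintype.card V → e = k * (Fintype.card V : ℝ) ^ (1 + 1 / (b : ℝ)) →
      degSum G univ = 2 * e →
      ∃ 𝓗 : Finset (Finset (Sym2 V)), (∀ E ∈ 𝓗, IsThetaEdges G a b E) ∧
        δ * k ^ (a * b) * (Fintype.card V : ℝ) ^ 2 ≤ 𝓗.card ∧
        ∀ σ : Finset (Sym2 V), 1 ≤ σ.card → σ.card ≤ a * b →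
          ((𝓗.filter fun E => σ ⊆ E).card : ℝ) ≤ 1 / δ * 𝓗.card /
            (k ^ ((1 + 1 / ((a : ℝ) * b - 1)) * ((σ.card : ℝ) - 1)) * e) := by
  have ha' : (2 : ℝ) ≤ a := by exact_mod_cast ha
  have hb' : (2 : ℝ) ≤ b := by exact_mod_cast hb
  have hab : (0 : ℝ) < a * b - 1 := by nlinarith
  have hab2 : 2 ≤ a * b := by nlinarith
  obtain ⟨C, k₁, hC, hk₁, hcore⟩ := exists_core_weight a b ha hb
  set Q : ℝ := 2 ^ (a * b + 1) + 1 with hQ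
  have hQ0 : 0 < Q := by positivity
  refine ⟨1 / (4 * C * Q), k₁, by positivity, hk₁, ?_⟩
  intro V _ G k e hk hV he hG
  have hn : (0 : ℝ) < Fintype.card V := by exact_mod_cast hV
  set n : ℝ := ((Fintype.card V : ℕ) : ℝ) with hndef
  have hk1 : 1 ≤ k := hk₁.trans hk
  have hk0 : 0 < k := by linarith
  have he0 : 0 < e := by rw [he]; positivity
  have hen : e ≤ n ^ 2 := by
    have h1 : degSum G univ ≤ n ^ 2 := by
      calc degSum G univ ≤ ∑ _u : V, n := sum_le_sum fun u _ => by
            rw [degIn, hndef]; exact_mod_cast card_le_univ _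
        _ = n ^ 2 := by rw [sum_const, nsmul_eq_mul, card_univ]; ring
    linarith
  set β : ℝ := (1 + 1 / ((a : ℝ) * b - 1)) with hβ
  have hβ' : β = a * b / (a * b - 1) := by rw [hβ]; field_simp; ring
  -- the pointwise bound for the weights of the pieces
  have hpt : n ^ (1 / (b : ℝ) - 1) / k ^ (a * b - 1) = e / (k ^ (a * b) * n ^ 2) := by
    have h1 : k ^ (a * b) = k ^ (a * b - 1) * k := by rw [← pow_succ]; congr 1; omega
    have h2 : n ^ (1 / (b : ℝ) - 1) * n ^ 2 = n ^ (1 + 1 / (b : ℝ)) := by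
      rw [← Real.rpow_natCast, ← Real.rpow_add hn]
      congr 1; push_cast; ring
    rw [he, h1, div_eq_div_iff (by positivity) (by positivity), ← h2]
    ring
  set ρ : ℝ := C * e / (k ^ (a * b) * n ^ 2) with hρ
  have hρ0 : 0 < ρ := by positivity
  obtain ⟨w, hw0, hwE, hwsum, hwdeg, hwpt⟩ := exists_weight_of_pieces (V := V) (a := a) (b := b)
    (by omega) (by omega) e (fun σ => C / k ^ (β * ((σ.card : ℝ) - 1)))
    (fun σ => by positivity) ρ hρ0.le (fun R hR => by
      obtain ⟨H, hHR, hH, w, h0, hE, hsum, hdeg, hp⟩ := hcore R k hk hV (he ▸ hR)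
      refine ⟨H, hHR, hH, w, h0, hE, hsum, hdeg, fun E => (hp E).trans_eq ?_⟩
      rw [hρ, mul_div_assoc, hpt, mul_div_assoc]) G
  -- the codegrees allowed in a family of `k ^ (a * b) * n ^ 2` theta graphs
  set cap : ℕ → ℝ := fun s => k ^ (a * b) * n ^ 2 / (k ^ (β * ((s : ℝ) - 1)) * e) with hcap
  have hcap1 : ∀ s, 1 ≤ s → s ≤ a * b → 1 ≤ cap s := by
    intro s hs1 hs
    rw [hcap, le_div_iff₀ (by positivity), one_mul]
    refine mul_le_mul ?_ hen he0.le (by positivity)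
    rw [← Real.rpow_natCast]
    refine Real.rpow_le_rpow_of_exponent_le hk1 ?_
    have : (s : ℝ) ≤ a * b := by exact_mod_cast hs
    push_cast
    rw [hβ', div_mul_eq_mul_div, div_le_iff₀ hab]
    gcongr
  have hρcap : ∀ s : ℕ, C / k ^ (β * ((s : ℝ) - 1)) = ρ * cap s := by
    intro s
    simp only [hρ, hcap]
    field_simp
  obtain ⟨𝓗, h𝓗, hdeg, hcard⟩ := exists_balanced_subfamily w hw0 (a * b)
    (fun E hE => (hwE E hE).card_le) cap hcap1 ρ hρ0.le
    (fun σ hσ hσab => by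
      rw [← hρcap]
      refine le_of_eq_of_le ?_ (hwdeg σ hσ hσab)
      congr!) hwpt
  have hsize : 1 / (4 * C * Q) * k ^ (a * b) * n ^ 2 ≤ 𝓗.card := by
    have h1 : e / 4 ≤ ρ * Q * 𝓗.card := by
      refine le_trans ?_ (hwsum.trans hcard)
      rw [hG]; linarith
    have h2 : ρ * Q * 𝓗.card = e / 4 * (4 * C * Q / (k ^ (a * b) * n ^ 2) * 𝓗.card) := by
      rw [hρ]; field_simp
    rw [h2] at h1
    have h3 : 1 ≤ 4 * C * Q / (k ^ (a * b) * n ^ 2) * 𝓗.card :=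
      le_of_mul_le_mul_left (by linarith) (by positivity : 0 < e / 4)
    rw [div_mul_eq_mul_div, le_div_iff₀ (by positivity)] at h3
    rw [mul_assoc, div_mul_eq_mul_div, div_le_iff₀ (by positivity)]
    linarith
  refine ⟨𝓗, fun E hE => hwE E (h𝓗 E hE), hsize, fun σ hσ hσab => ?_⟩
  refine le_of_eq_of_le ?_ ((hdeg σ (card_pos.1 hσ) hσab).trans ?_)
  · congr!
  refine div_le_div_of_nonneg_right ?_ (by positivity)
  calc k ^ (a * b) * n ^ 2 = 1 / (1 / (4 * C * Q)) * (1 / (4 * C * Q) * k ^ (a * b) * n ^ 2) := by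
        field_simp
    _ ≤ _ := by gcongr

/-! ### Copies of the theta graph -/

section
variable {V : Type*} {a b : ℕ} {G : SimpleGraph V} {P : Fin a → Fin (b + 1) → V}

/-- The map from the vertices of the theta graph to those of a family of walks with the same ends.
The images of the two ends are read off the walk `i₀`. -/
def thetaMap (P : Fin a → Fin (b + 1) → V) (i₀ : Fin a) : ThetaVertex a b → V
  | Sum.inl l => if l = 0 then pt (P i₀) 0 else pt (P i₀) b
  | Sum.inr (i, j) => pt (P i) (j + 1)

lemma IsTheta.thetaMap_thetaPathVertex (hP : IsTheta G a b P) (hb : 1 ≤ b) (i₀ i : Fin a) {j : ℕ}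
    (hj : j ≤ b) : thetaMap P i₀ (thetaPathVertex a b i j) = pt (P i) j := by
  unfold thetaPathVertex
  split_ifs with h1 h2
  · simp only [thetaMap]
    congr 1
    omega
  · subst h2
    simpa [thetaMap] using hP.start i₀ i
  · obtain rfl : j = b := by omega
    simpa [thetaMap] using hP.finish i₀ i

lemma IsTheta.thetaMap_injective (hP : IsTheta G a b P) (hb : 1 ≤ b) (i₀ : Fin a) :
    Function.Injective (thetaMap P i₀) := by
  have hne : ∀ i j, 0 < j → j < b → pt (P i₀) 0 ≠ pt (P i) j ∧ pt (P i₀) b ≠ pt (P i) j := by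
    intro i j h0 hj
    rw [hP.start i₀ i, hP.finish i₀ i]
    exact ⟨hP.inj i 0 j h0 hj.le, (hP.inj i j b hj le_rfl).symm⟩
  have hends : pt (P i₀) 0 ≠ pt (P i₀) b := hP.inj i₀ 0 b (by omega) le_rfl
  have hin : ∀ l (ij : Fin a × Fin (b - 1)),
      thetaMap P i₀ (Sum.inl l) ≠ thetaMap P i₀ (Sum.inr ij) := by
    rintro l ⟨i, j⟩
    have h := hne i (j + 1) (by omega) (by omega)
    simp only [thetaMap]
    split_ifs
    exacts [h.1, h.2]
  rintro (l | ⟨i, j⟩) (l' | ⟨i', j'⟩) h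
  · congr 1
    fin_cases l <;> fin_cases l'
    · rfl
    · exact absurd h (by simpa [thetaMap] using hends)
    · exact absurd h (by simpa [thetaMap] using hends.symm)
    · rfl
  · exact absurd h (hin _ _)
  · exact absurd h.symm (hin _ _)
  · simp only [thetaMap] at h
    obtain rfl : i = i' := by
      by_contra hi
      exact hP.disj i i' hi (j + 1) (mem_Ioo.2 ⟨by omega, by omega⟩) (j' + 1)
        (mem_Ioo.2 ⟨by omega, by omega⟩) h
    obtain rfl : j = j' := by
      rcases lt_trichotomy (j : ℕ) j' with h1 | h1 | h1
      · exact absurd h (hP.inj i _ _ (by omega) (by omega))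
      · exact Fin.ext h1
      · exact absurd h.symm (hP.inj i _ _ (by omega) (by omega))
    rfl

lemma IsTheta.thetaGraph_adj (hP : IsTheta G a b P) (i : Fin a) {j : ℕ} (hj : j < b) :
    (thetaGraph a b).Adj (thetaPathVertex a b i j) (thetaPathVertex a b i (j + 1)) := by
  refine (SimpleGraph.fromRel_adj _ _ _).2 ⟨fun h => ?_, Or.inl ⟨i, j, hj, rfl, rfl⟩⟩
  have h1 := congrArg (thetaMap P i) h
  rw [hP.thetaMap_thetaPathVertex (by omega) i i (by omega),
    hP.thetaMap_thetaPathVertex (by omega) i i (by omega)] at h1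
  exact hP.inj i j (j + 1) (by omega) (by omega) h1

/-- A set of edges of a theta graph is the edge set of a copy. -/
lemma IsThetaEdges.exists_copy (ha : 1 ≤ a) (hb : 1 ≤ b) {E : Finset (Sym2 V)}
    (hE : IsThetaEdges G a b E) :
    ∃ G' : G.Subgraph, IsCopyOf (thetaGraph a b) G' ∧ G'.edgeSet = (E : Set (Sym2 V)) := by
  obtain ⟨P, hP, rfl⟩ := hE
  set f := thetaMap P ⟨0, ha⟩ with hf
  have hfv : ∀ i j, j ≤ b → f (thetaPathVertex a b i j) = pt (P i) j :=
    fun i j hj => hP.thetaMap_thetaPathVertex hb _ i hj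
  have hadj : ∀ {x y}, (thetaGraph a b).Adj x y → G.Adj (f x) (f y) ∧ s(f x, f y) ∈ walkEdges P := by
    intro x y hxy
    obtain ⟨_, ⟨i, j, hj, rfl, rfl⟩ | ⟨i, j, hj, rfl, rfl⟩⟩ := (SimpleGraph.fromRel_adj _ _ _).1 hxy
    · rw [hfv i j hj.le, hfv i (j + 1) hj]
      exact ⟨hP.walk i j hj, mem_image.2 ⟨(i, ⟨j, hj⟩), mem_univ _, rfl⟩⟩
    · rw [hfv i j hj.le, hfv i (j + 1) hj]
      exact ⟨(hP.walk i j hj).symm, mem_image.2 ⟨(i, ⟨j, hj⟩), mem_univ _, Sym2.eq_swap⟩⟩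
  let φ : SimpleGraph.Copy (thetaGraph a b) G :=
    ⟨⟨f, fun h => (hadj h).1⟩, hP.thetaMap_injective hb _⟩
  refine ⟨φ.toSubgraph, ⟨φ.isoToSubgraph⟩, ?_⟩
  ext e
  induction e using Sym2.ind with
  | h u v =>
    rw [SimpleGraph.Subgraph.mem_edgeSet, mem_coe]
    constructor
    · rintro ⟨x, y, hxy, rfl, rfl⟩
      exact (hadj hxy).2
    · intro h
      obtain ⟨⟨i, j⟩, _, hij⟩ := mem_image.1 h
      rw [← SimpleGraph.Subgraph.mem_edgeSet, ← hij, SimpleGraph.Subgraph.mem_edgeSet]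
      exact ⟨_, _, hP.thetaGraph_adj i j.2, hfv i j j.2.le, hfv i (j + 1) j.2⟩

end

lemma ncard_edgeSet_thetaGraph_le (a b : ℕ) : (thetaGraph a b).edgeSet.ncard ≤ a * b := by
  set S : Finset (Sym2 (ThetaVertex a b)) := univ.image fun ij : Fin a × Fin b =>
    s(thetaPathVertex a b ij.1 ij.2, thetaPathVertex a b ij.1 (ij.2 + 1)) with hS
  have h1 : (thetaGraph a b).edgeSet ⊆ S := by
    intro e
    induction e using Sym2.ind with
    | h x y =>
      intro hxy
      rw [SimpleGraph.mem_edgeSet] at hxy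
      rw [mem_coe, hS]
      obtain ⟨_, ⟨i, j, hj, rfl, rfl⟩ | ⟨i, j, hj, rfl, rfl⟩⟩ :=
        (SimpleGraph.fromRel_adj _ _ _).1 hxy
      · exact mem_image.2 ⟨(i, ⟨j, hj⟩), mem_univ _, rfl⟩
      · exact mem_image.2 ⟨(i, ⟨j, hj⟩), mem_univ _, Sym2.eq_swap⟩
  calc _ ≤ (S : Set (Sym2 (ThetaVertex a b))).ncard := Set.ncard_le_ncard h1 S.finite_toSet
    _ = S.card := Set.ncard_coe_finset S
    _ ≤ _ := card_image_le
    _ = a * b := by simp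

lemma degSum_univ {V : Type*} [Fintype V] (G : SimpleGraph V) :
    degSum G univ = 2 * (G.edgeSet.ncard : ℝ) := by
  have h1 : G.edgeSet.ncard = G.edgeFinset.card := by
    rw [← SimpleGraph.coe_edgeFinset, Set.ncard_coe_finset]
  rw [h1]
  have h2 := G.sum_degrees_eq_twice_card_edges
  rw [degSum]
  simp only [degIn]
  rw [← Nat.cast_sum]
  have h3 : ∑ u, (univ.filter fun v => G.Adj u v).card = ∑ u, G.degree u := by
    refine sum_congr rfl fun u _ => ?_
    rw [← SimpleGraph.card_neighborFinset_eq_degree, SimpleGraph.neighborFinset_eq_filter]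
  rw [h3, h2]
  push_cast
  ring

/-- Balanced supersaturation for theta graphs. -/
lemma exists_balanced_copies (a b : ℕ) (ha : 2 ≤ a) (hb : 2 ≤ b) :
    ∃ C δ k₀ : ℝ, 0 < C ∧ 0 < δ ∧ 0 < k₀ ∧
      ∀ (k : ℝ), k₀ ≤ k → ∀ (V : Type*) [Fintype V] (G : SimpleGraph V),
        (G.edgeSet.ncard : ℝ) = k * (Fintype.card V : ℝ) ^ (1 + 1 / (b : ℝ)) →
        ∃ ℋ : Finset G.Subgraph, (∀ H' ∈ ℋ, IsCopyOf (thetaGraph a b) H') ∧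
          δ * k ^ (a * b) * (Fintype.card V : ℝ) ^ 2 ≤ (ℋ.card : ℝ) ∧
          ∀ σ : Finset (Sym2 V), 1 ≤ σ.card → σ.card ≤ a * b →
            (familyDegree ℋ σ : ℝ) ≤ C * (ℋ.card : ℝ) /
              (k ^ ((1 + 1 / ((a : ℝ) * (b : ℝ) - 1)) * ((σ.card : ℝ) - 1)) *
                (G.edgeSet.ncard : ℝ)) := by
  obtain ⟨δ, k₀, hδ, hk₀, h⟩ := exists_balanced_thetaEdges a b ha hb
  refine ⟨1 / δ, δ, k₀, by positivity, hδ, by linarith, fun k hk V _ G he => ?_⟩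
  rcases Nat.eq_zero_or_pos (Fintype.card V) with hV | hV
  · exact ⟨∅, by simp, by simp [hV], fun σ _ _ => by simp [familyDegree]⟩
  obtain ⟨𝓗, h𝓗, hcard, hdeg⟩ := h G k _ hk hV he (degSum_univ G)
  choose! c hc using fun E (hE : E ∈ 𝓗) => (h𝓗 E hE).exists_copy (by omega) (by omega)
  have hinj : Set.InjOn c 𝓗 := fun E hE E' hE' hEE => by
    rw [← coe_inj, ← (hc E hE).2, ← (hc E' hE').2, hEE]
  have hcardc : (𝓗.image c).card = 𝓗.card := card_image_of_injOn hinj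
  refine ⟨𝓗.image c, fun H' hH' => ?_, by rw [hcardc]; exact hcard, fun σ h1 h2 => ?_⟩
  · obtain ⟨E, hE, rfl⟩ := mem_image.1 hH'
    exact (hc E hE).1
  · have h3 : familyDegree (𝓗.image c) σ = (𝓗.filter fun E => σ ⊆ E).card := by
      unfold familyDegree
      rw [filter_image, card_image_of_injOn (hinj.mono (coe_subset.2 (filter_subset _ _)))]
      congr 1
      refine filter_congr fun E hE => ?_
      rw [(hc E hE).2, coe_subset]
    rw [h3, hcardc]
    exact hdeg σ h1 h2

end ThetaSupersaturation

theorem mainTheorem1 (a b : ℕ) (ha : 2 ≤ a) (hb : 2 ≤ b) :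
    (∃ C δ k₀ : ℝ, 0 < C ∧ 0 < δ ∧ 0 < k₀ ∧
      ∀ (k : ℝ), k₀ ≤ k → ∀ (V : Type u) [Fintype V] (G : SimpleGraph V),
        (G.edgeSet.ncard : ℝ) = k * (Fintype.card V : ℝ) ^ (1 + 1 / (b : ℝ)) →
        ∃ ℋ : Finset G.Subgraph, (∀ H' ∈ ℋ, IsCopyOf (thetaGraph a b) H') ∧
          δ * k ^ (a * b) * (Fintype.card V : ℝ) ^ 2 ≤ (ℋ.card : ℝ) ∧
          ∀ σ : Finset (Sym2 V), (σ : Set (Sym2 V)) ⊆ G.edgeSet →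
            1 ≤ σ.card → σ.card ≤ a * b →
            (familyDegree ℋ σ : ℝ) ≤
              C * (ℋ.card : ℝ) /
                (k ^ ((1 + 1 / ((a : ℝ) * (b : ℝ) - 1)) * ((σ.card : ℝ) - 1)) *
                  (G.edgeSet.ncard : ℝ))) ∧
    ErdosSimonovitsGood.{u} (thetaGraph a b) (1 / ((a : ℝ) * (b : ℝ) - 1))
      (fun n => (n : ℝ) ^ (1 + 1 / (b : ℝ))) := by
  obtain ⟨C, δ, k₀, hC, hδ, hk₀, h⟩ :=
    ThetaSupersaturation.exists_balanced_copies.{u} a b ha hb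
  have hab : (0 : ℝ) < (a : ℝ) * (b : ℝ) - 1 := by
    have ha' : (2 : ℝ) ≤ a := by exact_mod_cast ha
    have hb' : (2 : ℝ) ≤ b := by exact_mod_cast hb
    nlinarith
  refine ⟨⟨C, δ, k₀, hC, hδ, hk₀, fun k hk V _ G he => ?_⟩, by positivity, C, k₀, hC, hk₀,
    fun k hk V _ _ G he => ?_⟩
  · obtain ⟨ℋ, hℋ, hcard, hdeg⟩ := h k hk V G he
    exact ⟨ℋ, hℋ, hcard, fun σ _ => hdeg σ⟩
  · obtain ⟨ℋ, hℋ, hcard, hdeg⟩ := h k hk V G he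
    refine ⟨ℋ, ?_, hℋ, fun σ _ h1 h2 =>
      hdeg σ h1 (h2.trans (ThetaSupersaturation.ncard_edgeSet_thetaGraph_le a b))⟩
    have hk' : 0 < k := hk₀.trans_le hk
    have hV : (0 : ℝ) < Fintype.card V := by exact_mod_cast Fintype.card_pos
    have h1 : (0 : ℝ) < ℋ.card := lt_of_lt_of_le (by positivity) hcard
    exact Finset.card_pos.1 (by exact_mod_cast h1)
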